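/- Let $k\in\mathbb C$, $k\neq 0,-2$. Let $\phi_{0,n},\phi_{2,n}$ ($n$ odd), $\phi_{1,n}$ ($n$ even) and $Q$ satisfy $$[\phi_{0,m},\phi_{0,n}]=4km\,\delta_{m+n,0},\quad [\phi_{1,m},\phi_{1,n}]=4(k+2)m\,\delta_{m+n,0},\quad [\phi_{2,m},\phi_{2,n}]=-4km\,\delta_{m+n,0},\quad [\phi_{1,0},Q]=4(k+2),$$ all other commutators being $0$. For $j\in\mathbb C$ let $\mathcal F_{j,k}$ be the Fock space of polynomials in the creation operators $\phi_{i,-n}$ ($n>0$) applied to the vacuum $|j,k\rangle$, where $\phi_{i,n}|j,k\rangle=0$ for $n>0$, $\phi_{1,0}|j,k\rangle=2j|j,k\rangle$ and $e^{Q/(2(k+2))}|j,k\rangle=|j+1,k\rangle$. Let $d$ be the grading operator, $[d,\phi_{i,n}]=-n\phi_{i,n}$, $d|j,k\rangle=\frac{2j^2+k}{4(k+2)}|j,k\rangle$. Put $\phi_1(\zeta)=-\sum_{n\ne0\text{ even}}\frac{\phi_{1,n}}n\zeta^{-n}+\phi_{1,0}\log\zeta+Q$, $\phi_i(\zeta)=-\sum_{n\text{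 odd}}\frac{\phi_{i,n}}n\zeta^{-n}$ ($i=0,2$), $D=D_\zeta=\zeta\frac{d}{d\zeta}$, $\delta(z)=\sum_{m\in\mathbb Z}z^m$. In a normally ordered product $:\ :$ the modes $\phi_{i,n}$ with $n<0$ and $Q$ stand to the left of those with $n\ge0$. Define $$\beta(\zeta)=\sum_n\beta_n\zeta^{-n}=\tfrac12D\phi_0(\zeta),\qquad x(\zeta)=\sum_n x_n\zeta^{-n}=\tfrac12:\bigl(D\phi_1(\zeta)+D\phi_2(\zeta)\bigr)e^{\phi_2(\zeta)/k+\phi_0(\zeta)/k}:,$$ $$S(\zeta)=\tfrac12\zeta^{\frac2{k+2}}:D\phi_2(\zeta)\,e^{-\phi_1(\zeta)/(k+2)}:.$$ These are formal series in complex powers of $\zeta$ whose coefficients are operators on $\bigoplus_j\mathcal F_{j,k}$. Then the following hold. (1) All coefficients of $S(\zeta)$ map $\mathcal F_{j,k}$ into $\mathcal F_{j-2,k}$. (2) $[\beta(\zeta),S(\xi)]=0$. (3) $$[x(\zeta),S(\xi)]=\frac{k+2}2D_\xi\Bigl(-\delta\bigl(\tfrac\xi\zeta\bigr)\xi^{\frac2{k+2}}:e^{-\frac{\phi_1(\xi)}{k+2}+\frac{\phi_2(\xi)}k+\frac{\phi_0(\xi)}k}:+\delta\bigl(-\tfrac\xi\zeta\bigr)\xi^{\frac2{k+2}}:e^{-\frac{\phi_1(\xi)}{k+2}-\frac{\phi_2(\xi)}k-\frac{\phi_0(\xi)}k}:\Bigr).$$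 (4) Let $m\ge0$. The series of each matrix element of $S(\xi_1)\cdots S(\xi_m)$ between a vector of $\mathcal F_{j,k}$ and a monomial of $\mathcal F_{j-2m,k}$ converges absolutely for $|\xi_1|>\cdots>|\xi_m|>0$; let branches of $S(\xi_1)\cdots S(\xi_m)$ in $X_m=\{\xi\in(\mathbb C^\times)^m:\xi_i\ne\pm\xi_l\ (i\neq l)\}$ be the families of germs obtained from all matrix elements by analytic continuation along a common path in $X_m$. Let $\Gamma$ be a closed contour, that is, a finite $\mathbb C$-linear combination of smooth singular $m$-cubes in $X_m$, each with a branch of $S(\xi_1)\cdots S(\xi_m)$ along it, whose boundary, with the induced branches and modulo degenerate cubes, is zero. (For example, a smooth map of an $m$-dimensional torus to $X_m$ along which the integrand is single-valued.) Then the matrix elements $$\oint\!\cdots\!\oint_\Gamma\frac{d\xi_1}{\xi_1}\cdots\frac{d\xi_m}{\xi_m}\,S(\xi_1)\cdots S(\xi_m)$$ are those of a linear operator $Q^m:\mathcal F_{j,k}\to\mathcal F_{j-2m,k}$, and $Q^m$ commutes with the action of $\widehat{\mathfrak{sl}}_2$, that is, with $\beta_n$ and $x_n$ for all $n\in\mathbb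 Z$ and with $\rho=-d$ (the central element acts on both spaces by $k$). -/

import Mathlib

open scoped ContDiff Topology Nat
open Set

noncomputable section

namespace ZAlg

/-! ### Three free bosons and their Fock spaces -/

/-- Labels of the creation operators: `(i, n)` stands for the oscillator `φ_{i,-n}`, where `n > 0`,
`n` is even for `i = 1` and odd for `i = 0, 2`. -/
abbrev Osc : Type := {p : Fin 3 × ℕ // 0 < p.2 ∧ (p.1 = 1 ↔ Even p.2)}

/-- The direct sum over all `j ∈ ℂ` of the Fock spaces `F_{j,k}`.  The element `single j 1` is the
vacuum `|j,k⟩` and `F_{j,k}` is the space of polynomials in the creation operators applied to it. -/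
abbrev FockSum : Type := ℂ →₀ MvPolynomial Osc ℂ

/-- Linear operators on the sum of the Fock spaces. -/
abbrev Op : Type := Module.End ℂ FockSum

/-- The Fock space `F_{j,k}` inside the sum of the Fock spaces. -/
def fock (j : ℂ) : Submodule ℂ FockSum := LinearMap.range (Finsupp.lsingle j)

/-- The operator that acts on the summand `F_{j,k}` by `T j`. -/
def diag (T : ℂ → Module.End ℂ (MvPolynomial Osc ℂ)) : Op :=
  Finsupp.lsum ℂ fun j => Finsupp.lsingle j ∘ₗ T j

/-- The constants `κ_i` in `[φ_{i,m}, φ_{i,n}] = κ_i m δ_{m+n,0}`. -/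
def kap (k : ℂ) : Fin 3 → ℂ := ![4 * k, 4 * (k + 2), -4 * k]

open Classical in
/-- Multiplication by the creation operator `φ_{i,-n}` (zero if there is no such oscillator). -/
def create (i : Fin 3) (n : ℕ) : Module.End ℂ (MvPolynomial Osc ℂ) :=
  if h : 0 < n ∧ (i = 1 ↔ Even n) then LinearMap.mulLeft ℂ (MvPolynomial.X ⟨(i, n), h⟩) else 0

open Classical in
/-- The derivation `∂/∂φ_{i,-n}` (zero if there is no such oscillator). -/
def annih (i : Fin 3) (n : ℕ) : Module.End ℂ (MvPolynomial Osc ℂ) :=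
  if h : 0 < n ∧ (i = 1 ↔ Even n) then (MvPolynomial.pderiv ⟨(i, n), h⟩).toLinearMap else 0

/-- The Fourier mode `φ_{i,n}`, for every integer `n` (it is zero if `n` has the wrong parity). -/
def mode (k : ℂ) (i : Fin 3) (n : ℤ) : Op :=
  if n < 0 then diag fun _ => create i n.natAbs
  else if 0 < n then diag fun _ => (kap k i * n) • annih i n.natAbs
  else if i = 1 then diag fun j => (2 * j) • LinearMap.id
  else 0

/-- The operator `e^{αQ}`, where `e^{Q/(2(k+2))}` sends `|j,k⟩` to `|j+1,k⟩`. -/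
def expQ (k α : ℂ) : Op := Finsupp.lmapDomain _ ℂ fun j => j + 2 * (k + 2) * α

open Classical in
/-- The coefficient of `ζ^c` in `ζ^{α φ_{1,0}}`, which acts on `F_{j,k}` by `ζ^{2jα}`. -/
def zeroPow (α c : ℂ) : Op := diag fun j => if c = α * (2 * j) then LinearMap.id else 0

/-- The grading operator `d`: on `F_{j,k}` it multiplies a monomial in the creation operators of
total degree `N` by `N + (2j²+k)/(4(k+2))`. -/
def grading (k : ℂ) : Op :=
  diag fun j => (MvPolynomial.mkDerivation ℂ fun o : Osc =>
      (o.1.2 : ℂ) • (MvPolynomial.X o : MvPolynomial Osc ℂ)).toLinearMap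
    + ((2 * j ^ 2 + k) / (4 * (k + 2))) • LinearMap.id

/-! ### Locally finite sums of operators -/

/-- On every vector only finitely many members of the family are nonzero. -/
def LocFin {ι : Type} (T : ι → Op) : Prop := ∀ v, {i | T i v ≠ 0}.Finite

/-- The sum of a locally finite family of operators. -/
def locSum {ι : Type} (T : ι → Op) (h : LocFin T) : Op where
  toFun v := ∑ᶠ i, T i v
  map_add' v w := by
    simp only [map_add]
    exact finsum_add_distrib (h v) (h w)
  map_smul' c v := by
    simp only [map_smul, RingHom.id_apply]
    exact (smul_finsum' c (h v)).symm

/-- The `r`-th coefficient of `exp f`, for a power series `f` without constant term. -/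
def expCoeff (f : PowerSeries Op) (r : ℕ) : Op :=
  ∑ l ∈ Finset.range (r + 1), ((l ! : ℂ)⁻¹) • PowerSeries.coeff r (f ^ l)

/-- Coefficient of `ζ^r` in `exp (∑_i α_i ∑_{n>0} φ_{i,-n} ζ^n / n)`. -/
def expCre (k : ℂ) (α : Fin 3 → ℂ) (r : ℕ) : Op :=
  expCoeff (PowerSeries.mk fun n => ∑ i, (α i / n) • mode k i (-n)) r

/-- Coefficient of `ζ^{-s}` in `exp (-∑_i α_i ∑_{n>0} φ_{i,n} ζ^{-n} / n)`. -/
def expAnn (k : ℂ) (α : Fin 3 → ℂ) (s : ℕ) : Op :=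
  expCoeff (PowerSeries.mk fun n => -∑ i, (α i / n) • mode k i n) s

/-- The contribution of `(r, s)` to the coefficient of `ζ^a` in `:exp (∑_i α_i φ_i(ζ)):`. -/
def vertexTerm (k : ℂ) (α : Fin 3 → ℂ) (a : ℂ) (p : ℕ × ℕ) : Op :=
  expCre k α p.1 * expAnn k α p.2 * expQ k (α 1) * zeroPow (α 1) (a - p.1 + p.2)

/-! The two sums that occur below are locally finite; this is checked with the filtration by the
total degree of the creation operators. -/

/-- The vectors all of whose monomials have degree less than `N`. -/
def below (N : ℕ) : Submodule ℂ FockSum where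
  carrier := {f | ∀ j m, N ≤ Finsupp.weight (fun o : Osc => o.1.2) m → (f j).coeff m = 0}
  zero_mem' := by intro j m _; simp
  add_mem' := by
    intro f g hf hg j m h
    simp [hf j m h, hg j m h]
  smul_mem' := by
    intro c f hf j m h
    simp [hf j m h]

lemma below_zero {v : FockSum} (h : v ∈ below 0) : v = 0 := by
  ext j m
  simpa using h j m (Nat.zero_le _)

lemma exists_below (v : FockSum) : ∃ N, v ∈ below N := by
  classical
  refine ⟨(v.support.sup fun j => (v j).support.sup
    fun m => Finsupp.weight (fun o : Osc => o.1.2) m) + 1, ?_⟩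
  intro j m h
  by_contra hc
  have hm : m ∈ (v j).support := by simpa [MvPolynomial.mem_support_iff] using hc
  have hj : j ∈ v.support := by
    rw [Finsupp.mem_support_iff]
    intro h0
    simp [h0] at hc
  have h1 := Finset.le_sup (f := fun m => Finsupp.weight (fun o : Osc => o.1.2) m) hm
  have h2 := Finset.le_sup (f := fun j => (v j).support.sup
    fun m => Finsupp.weight (fun o : Osc => o.1.2) m) hj
  exact absurd (h1.trans h2) (by omega)

lemma diag_apply (T : ℂ → Module.End ℂ (MvPolynomial Osc ℂ)) (v : FockSum) (j : ℂ) :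
    diag T v j = T j (v j) := by
  classical
  simp only [diag, Finsupp.lsum_apply, Finsupp.sum, LinearMap.comp_apply, Finsupp.lsingle_apply,
    Finsupp.finsetSum_apply, Finsupp.single_apply]
  rw [Finset.sum_ite_eq' v.support j fun x => T x (v x)]
  split_ifs with h
  · rfl
  · rw [Finsupp.notMem_support_iff.mp h, map_zero]

lemma mode_below (k : ℂ) (i : Fin 3) (n : ℕ) {N : ℕ} {v : FockSum} (hv : v ∈ below N) :
    mode k i n v ∈ below (N - n) := by
  rcases Nat.eq_zero_or_pos n with rfl | hn
  · unfold mode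
    simp only [Nat.cast_zero, lt_irrefl, if_false, Nat.sub_zero]
    split_ifs
    · intro j m h
      simp [diag_apply, hv j m h]
    · simp
  · have h1 : ¬ ((n : ℤ) < 0) := by omega
    have h2 : (0 : ℤ) < n := by omega
    unfold mode
    rw [if_neg h1, if_pos h2]
    intro j m h
    rw [diag_apply]
    simp only [Int.natAbs_natCast, annih]
    split_ifs with hc
    · simp only [LinearMap.smul_apply, MvPolynomial.coeff_smul, Derivation.coeFn_coe,
        MvPolynomial.coeff_pderiv]
      rw [hv j _ ?_]
      · simp
      · rw [map_add, Finsupp.weight_single]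
        simp only [smul_eq_mul, one_mul]
        omega
    · simp

lemma pow_below (k : ℂ) (α : Fin 3 → ℂ) (l : ℕ) : ∀ (s N : ℕ) (v : FockSum), v ∈ below N →
    PowerSeries.coeff s ((PowerSeries.mk fun n : ℕ => -∑ i, (α i / n) • mode k i n) ^ l) v
      ∈ below (N - s) := by
  induction l with
  | zero =>
    intro s N v hv
    rw [pow_zero, PowerSeries.coeff_one]
    split_ifs with h
    · simpa [h] using hv
    · simp
  | succ l ih =>
    intro s N v hv
    rw [pow_succ, PowerSeries.coeff_mul, LinearMap.sum_apply]
    refine Submodule.sum_mem _ fun p hp => ?_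
    have hp := Finset.HasAntidiagonal.mem_antidiagonal.mp hp
    rw [PowerSeries.coeff_mk, Module.End.mul_apply]
    have : N - s = N - p.2 - p.1 := by omega
    rw [this]
    apply ih
    rw [LinearMap.neg_apply, LinearMap.sum_apply]
    exact Submodule.neg_mem _ (Submodule.sum_mem _ fun i _ =>
      Submodule.smul_mem _ _ (mode_below k i p.2 hv))

lemma expAnn_below (k : ℂ) (α : Fin 3 → ℂ) {s N : ℕ} {v : FockSum} (hv : v ∈ below N) :
    expAnn k α s v ∈ below (N - s) := by
  unfold expAnn expCoeff
  rw [LinearMap.sum_apply]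
  exact Submodule.sum_mem _ fun l _ => Submodule.smul_mem _ _ (pow_below k α l s N v hv)

lemma expQ_below (k α : ℂ) {N : ℕ} {v : FockSum} (hv : v ∈ below N) : expQ k α v ∈ below N := by
  classical
  rw [expQ, Finsupp.lmapDomain_apply, Finsupp.mapDomain]
  refine Submodule.sum_mem _ fun j _ => ?_
  intro j' m h
  rw [Finsupp.single_apply]
  split_ifs
  · exact hv j m h
  · simp

/-- If a term of a vertex operator does not kill `v`, its indices are restricted by `v`. -/
lemma vertexTerm_ne (k : ℂ) (α : Fin 3 → ℂ) (a : ℂ) (p : ℕ × ℕ) {N : ℕ} {v : FockSum}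
    (hv : v ∈ below N) (h : vertexTerm k α a p v ≠ 0) :
    p.2 < N ∧ ∃ j ∈ v.support, a - p.1 + p.2 = α 1 * (2 * j) := by
  have hz : zeroPow (α 1) (a - p.1 + p.2) v ∈ below N := by
    intro j m hm
    rw [zeroPow, diag_apply]
    split_ifs
    · exact hv j m hm
    · simp
  constructor
  · by_contra hN
    apply h
    have h1 := expAnn_below k α (s := p.2) (expQ_below k (α 1) hz)
    rw [Nat.sub_eq_zero_of_le (not_lt.mp hN)] at h1
    simp only [vertexTerm, Module.End.mul_apply]
    rw [below_zero h1, map_zero]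
  · by_contra hj
    push Not at hj
    apply h
    have : zeroPow (α 1) (a - p.1 + p.2) v = 0 := by
      ext1 j
      rw [zeroPow, diag_apply]
      split_ifs with hc
      · by_contra hne
        exact hj j (Finsupp.mem_support_iff.mpr hne) hc
      · simp
    simp only [vertexTerm, Module.End.mul_apply]
    rw [this]
    simp

lemma vertexTerm_locFin (k : ℂ) (α : Fin 3 → ℂ) (a : ℂ) : LocFin (vertexTerm k α a) := by
  classical
  intro v
  obtain ⟨N, hN⟩ := exists_below v
  have hfin : ((fun q : ℂ × ℕ => (a + q.2 - α 1 * (2 * q.1), q.2)) ''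
      (((v.support ×ˢ Finset.range N : Finset (ℂ × ℕ))) : Set (ℂ × ℕ))).Finite :=
    (Finset.finite_toSet _).image _
  have hinj : Function.Injective fun p : ℕ × ℕ => ((p.1 : ℂ), p.2) := by
    intro p q h
    simp only [Prod.mk.injEq, Nat.cast_inj] at h
    exact Prod.ext h.1 h.2
  refine (hfin.preimage hinj.injOn).subset ?_
  intro p hp
  obtain ⟨h1, j, hj, h2⟩ := vertexTerm_ne k α a p hN hp
  refine ⟨(j, p.2), by simp [h1, Finsupp.mem_support_iff.mp hj], ?_⟩
  simp only [Prod.mk.injEq, and_true]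
  rw [← h2]
  ring

/-- The coefficient of `ζ^a` in the normally ordered exponential `:exp (∑_i α_i φ_i(ζ)):`, that is in
`exp (∑_i α_i ∑_{n>0} φ_{i,-n} ζ^n / n) exp (-∑_i α_i ∑_{n>0} φ_{i,n} ζ^{-n} / n)
  e^{α_1 Q} ζ^{α_1 φ_{1,0}}`. -/
def vertex (k : ℂ) (α : Fin 3 → ℂ) (a : ℂ) : Op :=
  locSum (vertexTerm k α a) (vertexTerm_locFin k α a)

/-- The contribution of `φ_{i,n} ζ^{-n}` to the coefficient of `ζ^a` in
`:Dφ_i(ζ) exp (∑_l α_l φ_l(ζ)):`. -/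
def insertTerm (k : ℂ) (i : Fin 3) (α : Fin 3 → ℂ) (a : ℂ) (n : ℤ) : Op :=
  if n < 0 then mode k i n * vertex k α (a + n) else vertex k α (a + n) * mode k i n

lemma insertTerm_locFin (k : ℂ) (i : Fin 3) (α : Fin 3 → ℂ) (a : ℂ) :
    LocFin (insertTerm k i α a) := by
  classical
  intro v
  obtain ⟨N, hN⟩ := exists_below v
  let b : ℝ := ∑ j ∈ v.support, |(α 1 * (2 * j)).re|
  refine (Set.finite_Icc (⌊-(b + N + |a.re|)⌋) (N : ℤ)).subset ?_
  intro n hn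
  change insertTerm k i α a n v ≠ 0 at hn
  rw [insertTerm] at hn
  split_ifs at hn with hneg
  · have hne : vertex k α (a + n) v ≠ 0 := by
      intro h0
      simp [Module.End.mul_apply, h0] at hn
    have : ∃ p, vertexTerm k α (a + n) p v ≠ 0 := by
      by_contra hall
      push Not at hall
      exact hne (by simp [vertex, locSum, hall])
    obtain ⟨p, hp⟩ := this
    obtain ⟨h1, j, hj, h2⟩ := vertexTerm_ne k α (a + n) p hN hp
    have h3 := congrArg Complex.re h2
    have h4 : |(α 1 * (2 * j)).re| ≤ b :=
      Finset.single_le_sum (f := fun j => |(α 1 * (2 * j)).re|) (fun _ _ => abs_nonneg _) hj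
    rw [← h3] at h4
    simp only [Complex.add_re, Complex.sub_re, Complex.intCast_re, Complex.natCast_re] at h4
    have h5 := (abs_le.mp h4).1
    have h6 := le_abs_self a.re
    have h7 : (p.2 : ℝ) ≤ N := by exact_mod_cast h1.le
    have h8 : (0 : ℝ) ≤ p.1 := Nat.cast_nonneg _
    refine ⟨?_, by omega⟩
    have h9 : ((⌊-(b + N + |a.re|)⌋ : ℤ) : ℝ) ≤ n := (Int.floor_le _).trans (by linarith)
    exact_mod_cast h9
  · obtain ⟨l, rfl⟩ := Int.eq_ofNat_of_zero_le (not_lt.mp hneg)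
    have hb : (0 : ℝ) ≤ b := Finset.sum_nonneg fun _ _ => abs_nonneg _
    constructor
    · have h9 : ((⌊-(b + N + |a.re|)⌋ : ℤ) : ℝ) ≤ 0 :=
        (Int.floor_le _).trans (by
          have := abs_nonneg a.re
          have : (0 : ℝ) ≤ N := Nat.cast_nonneg _
          linarith)
      have : ⌊-(b + N + |a.re|)⌋ ≤ 0 := by exact_mod_cast h9
      omega
    · by_contra hl
      apply hn
      have h1 := mode_below k i l hN
      rw [Nat.sub_eq_zero_of_le (by omega)] at h1
      rw [Module.End.mul_apply, below_zero h1, map_zero]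

/-- The coefficient of `ζ^a` in `:Dφ_i(ζ) exp (∑_l α_l φ_l(ζ)):`, where `Dφ_i(ζ) = ∑_n φ_{i,n} ζ^{-n}`:
the modes with `n < 0` stand on the left and those with `n ≥ 0` on the right. -/
def vertexInsert (k : ℂ) (i : Fin 3) (α : Fin 3 → ℂ) (a : ℂ) : Op :=
  locSum (insertTerm k i α a) (insertTerm_locFin k i α a)

/-! ### Formal series with complex exponents -/

/-- A formal series `∑_a A a ζ^a` with operator coefficients and exponents `a ∈ ℂ`. -/
abbrev Field1 : Type := ℂ → Op

/-- A formal series `∑_{a,b} A a b ζ^a ξ^b` with operator coefficients. -/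
abbrev Field2 : Type := ℂ → ℂ → Op

/-- The series `∑_n M n ζ^{-n}`, `n ∈ ℤ`. -/
def ofModes (M : ℤ → Op) : Field1 := fun a => ∑ᶠ n : ℤ, if a = -(n : ℂ) then M n else 0

/-- The Fourier mode `A_n`, the coefficient of `ζ^{-n}` in `A(ζ)`. -/
def coeffMode (A : Field1) (n : ℤ) : Op := A (-(n : ℂ))

/-- The product `ζ^c A(ζ)`. -/
def powMul (c : ℂ) (A : Field1) : Field1 := fun a => A (a - c)

/-- The commutator `[A(ζ), B(ξ)]`. -/
def bracket (A B : Field1) : Field2 := fun a b => A a * B b - B b * A a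

/-- The derivation `D_ξ = ξ d/dξ` in the second variable. -/
def derivXi (A : Field2) : Field2 := fun a b => b • A a b

/-- The product `δ(ε ξ/ζ) W(ξ)`, where `δ(z) = ∑_{m ∈ ℤ} z^m`. -/
def deltaMul (ε : ℂ) (W : Field1) : Field2 :=
  fun a b => ∑ᶠ m : ℤ, if a = -(m : ℂ) then ε ^ m • W (b - m) else 0

/-! ### The currents -/

/-- `β(ζ) = (1/2) Dφ_0(ζ)`. -/
def betaField (k : ℂ) : Field1 := ofModes fun n => (1 / 2 : ℂ) • mode k 0 n

/-- `x(ζ) = (1/2) :(Dφ_1(ζ) + Dφ_2(ζ)) exp (φ_2(ζ)/k + φ_0(ζ)/k):`. -/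
def xField (k : ℂ) : Field1 := fun a => (1 / 2 : ℂ) •
  (vertexInsert k 1 ![1 / k, 0, 1 / k] a + vertexInsert k 2 ![1 / k, 0, 1 / k] a)

/-- The screening current `S(ζ) = (1/2) ζ^{2/(k+2)} :Dφ_2(ζ) exp (-φ_1(ζ)/(k+2)):`. -/
def screening (k : ℂ) : Field1 := fun a => (1 / 2 : ℂ) •
  powMul (2 / (k + 2)) (vertexInsert k 2 ![0, -1 / (k + 2), 0]) a

/-- `ξ^{2/(k+2)} :exp (-φ_1(ξ)/(k+2) + ε φ_2(ξ)/k + ε φ_0(ξ)/k):`. -/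
def potential (k ε : ℂ) : Field1 :=
  powMul (2 / (k + 2)) (vertex k ![ε / k, -1 / (k + 2), ε / k])

/-! ### The products `S(ξ_1) ⋯ S(ξ_m)` as multivalued analytic functions -/

/-- The coordinate of a vector in `F_{j,k}` along the monomial `d` in the creation operators. -/
def coord (j : ℂ) (d : Osc →₀ ℕ) : FockSum →ₗ[ℂ] ℂ :=
  MvPolynomial.lcoeff ℂ d ∘ₗ Finsupp.lapply j

/-- The domain `|ξ_1| > |ξ_2| > ⋯ > |ξ_m| > 0`. -/
def radialRegion (m : ℕ) : Set (Fin m → ℂ) :=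
  {ξ | (∀ i, ξ i ≠ 0) ∧ StrictAnti fun i => ‖ξ i‖}

/-- The space of all `ξ` with `ξ_i ≠ 0` and `ξ_i ≠ ± ξ_l` for `i ≠ l`. -/
def confSpace (m : ℕ) : Set (Fin m → ℂ) :=
  {ξ | (∀ i, ξ i ≠ 0) ∧ ∀ i l, i ≠ l → ξ i ≠ ξ l ∧ ξ i ≠ -ξ l}

/-- The term with exponents `a` of the matrix element, between a vector `v` of `F_{j,k}` and the
monomial `d` of `F_{j-2m,k}`, of `S(ξ_1) ⋯ S(ξ_m)` (with principal powers). -/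
def corrTerm (k j : ℂ) {m : ℕ} (d : Osc →₀ ℕ) (v : fock j) (ξ : Fin m → ℂ) (a : Fin m → ℂ) : ℂ :=
  coord (j - 2 * m) d ((List.ofFn fun i => screening k (a i)).prod (v : FockSum)) * ∏ i, ξ i ^ a i

/-- The matrix element of `S(ξ_1) ⋯ S(ξ_m)`, as the sum of its series. -/
def corrSeries (k j : ℂ) {m : ℕ} (d : Osc →₀ ℕ) (v : fock j) (ξ : Fin m → ℂ) : ℂ :=
  ∑' a : Fin m → ℂ, corrTerm k j d v ξ a

/-- Functions, one for each matrix element of an operator from `F_{j,k}` to `F_{j-2m,k}`; only their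
germs at a given point will matter. -/
abbrev Germs (j : ℂ) (m : ℕ) : Type := (Osc →₀ ℕ) → fock j → (Fin m → ℂ) → ℂ

/-- `B` is a branch at `p` of the multivalued function `S(ξ_1) ⋯ S(ξ_m)`: its germs at `p` arise by
analytic continuation, along one path `γ` in the configuration space, from the sums of the series at a
point of the domain `|ξ_1| > ⋯ > |ξ_m| > 0` (off the cuts of the principal powers). -/
def IsBranchAt (k j : ℂ) {m : ℕ} (p : Fin m → ℂ) (B : Germs j m) : Prop :=
  ∃ (γ : ℝ → Fin m → ℂ) (G : ℝ → Germs j m),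
    ContinuousOn γ (Icc 0 1) ∧ (∀ t ∈ Icc (0 : ℝ) 1, γ t ∈ confSpace m) ∧
    γ 0 ∈ radialRegion m ∧ (∀ i, γ 0 i ∈ Complex.slitPlane) ∧ γ 1 = p ∧
    ∀ d v, G 0 d v =ᶠ[𝓝 (γ 0)] corrSeries k j d v ∧ G 1 d v =ᶠ[𝓝 p] B d v ∧
      ∀ t ∈ Icc (0 : ℝ) 1, AnalyticAt ℂ (G t d v) (γ t) ∧
        ∀ᶠ s in 𝓝[Icc 0 1] t, G s d v =ᶠ[𝓝 (γ s)] G t d v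

/-! ### Closed contours and screening charges -/

/-- A smooth singular `m`-cube in the configuration space with a branch of `S(ξ_1) ⋯ S(ξ_m)` along
it. -/
structure BranchCube (k j : ℂ) (m : ℕ) where
  /-- The parametrization; only its restriction to `[0,1]^m` matters. -/
  map : (Fin m → ℝ) → Fin m → ℂ
  smooth : ContDiff ℝ ∞ map
  mem_confSpace : ∀ t ∈ Icc (0 : Fin m → ℝ) 1, map t ∈ confSpace m
  /-- The germs of the branch at `map t`. -/
  germ : (Fin m → ℝ) → Germs j m
  isBranch : ∀ t ∈ Icc (0 : Fin m → ℝ) 1, IsBranchAt k j (map t) (germ t)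
  continued : ∀ t ∈ Icc (0 : Fin m → ℝ) 1, ∀ d v,
    ∀ᶠ s in 𝓝[Icc 0 1] t, germ s d v =ᶠ[𝓝 (map s)] germ t d v

/-- The integral of a matrix element of `(dξ_1/ξ_1) ⋯ (dξ_m/ξ_m) S(ξ_1) ⋯ S(ξ_m)` over a cube. -/
def BranchCube.integral {k j : ℂ} {m : ℕ} (σ : BranchCube k j m) (d : Osc →₀ ℕ) (v : fock j) : ℂ :=
  ∫ t in Icc (0 : Fin m → ℝ) 1,
    σ.germ t d v (σ.map t) *
      (Matrix.of fun i l => fderiv ℝ σ.map t (Pi.single l 1) i).det / ∏ i, σ.map t i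

/-- A finite linear combination of cubes. -/
structure BranchChain (k j : ℂ) (m : ℕ) where
  size : ℕ
  coef : Fin size → ℂ
  cube : Fin size → BranchCube k j m

/-- The integral of a matrix element of `(dξ_1/ξ_1) ⋯ (dξ_m/ξ_m) S(ξ_1) ⋯ S(ξ_m)` over a chain. -/
def BranchChain.integral {k j : ℂ} {m : ℕ} (Γ : BranchChain k j m) (d : Osc →₀ ℕ) (v : fock j) : ℂ :=
  ∑ q, Γ.coef q * (Γ.cube q).integral d v

/-- The labels of the faces `t_i = 0` (`false`) and `t_i = 1` (`true`) of the cubes of a chain. -/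
abbrev BranchChain.Face {k j : ℂ} {n : ℕ} (Γ : BranchChain k j (n + 1)) : Type :=
  Fin Γ.size × Fin (n + 1) × Bool

/-- The inclusion of the face `t_i = 0` or `t_i = 1` into `[0,1]^{n+1}`. -/
def faceIncl {n : ℕ} (i : Fin (n + 1)) (ε : Bool) (t : Fin n → ℝ) : Fin (n + 1) → ℝ :=
  i.insertNth (if ε then 1 else 0) t

/-- The coefficient of a face in the boundary of a chain. -/
def BranchChain.faceCoef {k j : ℂ} {n : ℕ} (Γ : BranchChain k j (n + 1)) (f : Γ.Face) : ℂ :=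
  (-1) ^ (f.2.1 : ℕ) * (if f.2.2 then 1 else -1) * Γ.coef f.1

/-- A face, as a singular `n`-cube. -/
def BranchChain.faceMap {k j : ℂ} {n : ℕ} (Γ : BranchChain k j (n + 1)) (f : Γ.Face)
    (t : Fin n → ℝ) : Fin (n + 1) → ℂ :=
  (Γ.cube f.1).map (faceIncl f.2.1 f.2.2 t)

/-- The branch along a face. -/
def BranchChain.faceGerm {k j : ℂ} {n : ℕ} (Γ : BranchChain k j (n + 1)) (f : Γ.Face)
    (t : Fin n → ℝ) : Germs j (n + 1) :=
  (Γ.cube f.1).germ (faceIncl f.2.1 f.2.2 t)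

/-- A singular cube is degenerate if it does not depend on one of its parameters. -/
def IsDegenerate {n : ℕ} {E : Type} (τ : (Fin n → ℝ) → E) : Prop :=
  ∃ l : Fin n, ∀ s ∈ Icc (0 : Fin n → ℝ) 1, ∀ t ∈ Icc (0 : Fin n → ℝ) 1,
    (∀ i, i ≠ l → s i = t i) → τ s = τ t

open Classical in
/-- The chain is a closed contour for the multivalued function `S(ξ_1) ⋯ S(ξ_m)`: its boundary
vanishes in the complex of cubical chains with coefficients in the branches, modulo degenerate cubes.
That is, for every nondegenerate `n`-cube `τ`, the branches along the faces that coincide with `τ`,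
taken with their coefficients, add up to zero.  For instance a smooth map of an `m`-dimensional torus
along which the integrand is single-valued is a closed contour. -/
def BranchChain.IsClosed {k j : ℂ} : {m : ℕ} → BranchChain k j m → Prop
  | 0, _ => True
  | n + 1, Γ => ∀ f₀ : Γ.Face, ¬ IsDegenerate (Γ.faceMap f₀) →
      ∀ t ∈ Icc (0 : Fin n → ℝ) 1, ∀ d v,
        (fun ξ => ∑ f : Γ.Face with EqOn (Γ.faceMap f) (Γ.faceMap f₀) (Icc 0 1),
          Γ.faceCoef f * Γ.faceGerm f t d v ξ) =ᶠ[𝓝 (Γ.faceMap f₀ t)] 0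

/-- `Q` is the screening charge `Q^m = ∮⋯∮ (dξ_1/ξ_1) ⋯ (dξ_m/ξ_m) S(ξ_1) ⋯ S(ξ_m)` on `F_{j,k}`
over the chain `Γ`: it maps `F_{j,k}` to `F_{j-2m,k}` and its matrix elements are the integrals. -/
def IsScreeningCharge {k j : ℂ} {m : ℕ} (Γ : BranchChain k j m) (Q : fock j →ₗ[ℂ] FockSum) : Prop :=
  (∀ v, Q v ∈ fock (j - 2 * m)) ∧ ∀ d v, coord (j - 2 * m) d (Q v) = Γ.integral d v

/-- The operator `T` preserves `F_{j,k}`, and `Q` commutes with `T`. -/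
def CommutesOn {j : ℂ} (Q : fock j →ₗ[ℂ] FockSum) (T : Op) : Prop :=
  ∀ v : fock j, ∃ w : fock j, (w : FockSum) = T v ∧ Q w = T (Q v)

end ZAlg

end

open ZAlg

noncomputable section

namespace ZAlg

/-! The commutators rest on one uniqueness principle (`reduction`, `family_eq_zero`). Since all `κ_i
≠ 0`, a matrix element of an operator between arbitrary monomials is a combination of vacuum
expectation values of its iterated commutators with the oscillators `φ_{i,n}`, `n ≠ 0`. Hence a
family of operators that shift `j` by a common amount and whose span is stable under these
commutators vanishes as soon as its vacuum expectation values do. A mode commutes with a vertex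
operator by producing a charge, a shift of the exponent and possibly the removal of an insertion
`Dφ` (`cm_mode_vertex`, `cm_mode_vertexInsert`). With `V` and `U` the exponentials in `x` and `S`,
the commutators `[V,U]`, `[V,S]`, `[x,U]`, `[x,S]` can therefore be found in this order: commuting a
mode with one of them yields the same family and earlier ones, and only vacuum two-point functions
remain to be computed.

For the charges, let `F` be the vacuum expectation value of `m` factors `U` (`corrBase`). By Wick
contraction and the same reduction, every matrix element of `S(ξ_1) ⋯ S(ξ_m)`, also with one `S`
replaced by a potential, is a series that converges for `|ξ_1| > ⋯ > |ξ_m| > 0` to `F R`, with `R`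
analytic and single-valued on `X_m` (`coord_prodSlot_mem`): contractions of insertions are rational
with poles at `ξ_i = ±ξ_l`, and commutators shift exponents by integers. No closed form of `F` is
used. Convergence follows from a majorant, and one matrix element of the screening product is `F`
times an elementary factor (`hasSum_oscTwo`). So a branch of the product carries a germ of `F`, and
all its germs are multiples of that one (`eventuallyEq_of_isBranchAt`).

For `T = β_n, x_n, d` the commutator with `S(ξ_1) ⋯ S(ξ_m)` has matrix elements `∑ D_{ξ_i}(F L_i)`
with such `L_i` (`IsExact`). Termwise differentiation and continuation along paths make this an
identity of germs on every branch (`exists_sum_eulerD`). Stokes' theorem on each cube and the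
cancellation of faces show that its integral over a closed contour is zero
(`BranchChain.IsClosed.sum_integral_eulerD`). The grading makes the rows of `T` finite
(`exists_row`), so `T` passes through the integral. Applied to `d` itself, the argument shows that a
vector has only finitely many nonzero integrated coordinates, so that the integrals do define an
operator into the Fock space. -/

open Classical in
/-- The indicator of the parity allowed for the modes of `φ_i`. -/
def chi (i : Fin 3) (n : ℤ) : ℂ := if (i = 1 ↔ Even n) then 1 else 0

lemma chi_neg (i : Fin 3) (n : ℤ) : chi i (-n) = chi i n := by simp [chi]

/-! ### Commutator calculus -/

/-- The commutator. -/
def cm {R : Type*} [Ring R] (A B : R) : R := A * B - B * A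

lemma cm_mul {R : Type*} [Ring R] (A B C : R) : cm A (B * C) = cm A B * C + B * cm A C := by
  simp only [cm, mul_sub, sub_mul, mul_assoc]; abel

lemma cm_swap {R : Type*} [Ring R] (A B : R) : cm A B = -cm B A := by
  simp only [cm]; abel

lemma cm_add {R : Type*} [Ring R] (A B C : R) : cm A (B + C) = cm A B + cm A C := by
  simp only [cm, mul_add, add_mul]; abel

lemma cm_smul {R : Type*} [Ring R] [Algebra ℂ R] (c : ℂ) (A B : R) : cm A (c • B) = c • cm A B := by
  simp only [cm, mul_smul_comm, smul_mul_assoc, smul_sub]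

lemma smul_cm {R : Type*} [Ring R] [Algebra ℂ R] (c : ℂ) (A B : R) : cm (c • A) B = c • cm A B := by
  simp only [cm, mul_smul_comm, smul_mul_assoc, smul_sub]

lemma cm_zero {R : Type*} [Ring R] (A : R) : cm A 0 = 0 := by simp [cm]

lemma zero_cm {R : Type*} [Ring R] (A : R) : cm 0 A = 0 := by simp [cm]

lemma cm_one {R : Type*} [Ring R] (A : R) : cm A 1 = 0 := by simp [cm]

lemma cm_sum {R : Type*} [Ring R] {ι : Type*} (s : Finset ι) (A : R) (B : ι → R) :
    cm A (∑ i ∈ s, B i) = ∑ i ∈ s, cm A (B i) := by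
  simp [cm, Finset.mul_sum, Finset.sum_mul]

lemma mul_eq_add_cm {R : Type*} [Ring R] (A B : R) : A * B = B * A + cm A B := by
  simp [cm]

lemma mul_comm_of_cm {R : Type*} [Ring R] {A B : R} (h : cm A B = 0) : A * B = B * A := by
  rwa [cm, sub_eq_zero] at h

/-! ### The Heisenberg relations -/

/-- The action of `φ_{i,n}` on the polynomials that make up `F_{j,k}`. -/
def modeP (k : ℂ) (i : Fin 3) (n : ℤ) (j : ℂ) : Module.End ℂ (MvPolynomial Osc ℂ) :=
  if n < 0 then create i n.natAbs
  else if 0 < n then (kap k i * n) • annih i n.natAbs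
  else if i = 1 then (2 * j) • LinearMap.id
  else 0

lemma diag_mul (T U : ℂ → Module.End ℂ (MvPolynomial Osc ℂ)) :
    diag T * diag U = diag fun j => T j * U j := by
  refine LinearMap.ext fun v => Finsupp.ext fun j => ?_
  simp [Module.End.mul_apply, diag_apply]

lemma diag_sub (T U : ℂ → Module.End ℂ (MvPolynomial Osc ℂ)) :
    diag T - diag U = diag fun j => T j - U j := by
  refine LinearMap.ext fun v => Finsupp.ext fun j => ?_
  simp [diag_apply]

lemma diag_smul (c : ℂ) (T : ℂ → Module.End ℂ (MvPolynomial Osc ℂ)) :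
    c • diag T = diag fun j => c • T j := by
  refine LinearMap.ext fun v => Finsupp.ext fun j => ?_
  simp [diag_apply]

lemma diag_one : diag (fun _ => 1) = 1 := by
  refine LinearMap.ext fun v => Finsupp.ext fun j => ?_
  simp [diag_apply]

lemma diag_zero : diag (fun _ => 0) = 0 := by
  refine LinearMap.ext fun v => Finsupp.ext fun j => ?_
  simp [diag_apply]

lemma diag_cm (T U : ℂ → Module.End ℂ (MvPolynomial Osc ℂ)) :
    cm (diag T) (diag U) = diag fun j => cm (T j) (U j) := by
  simp only [cm, diag_mul, diag_sub]

lemma mode_eq_diag (k : ℂ) (i : Fin 3) (n : ℤ) : mode k i n = diag (modeP k i n) := by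
  unfold mode modeP
  split_ifs <;> first | rfl | exact diag_zero.symm

lemma create_comm (i l : Fin 3) (m n : ℕ) : cm (create i m) (create l n) = 0 := by
  unfold create
  split_ifs <;> simp only [cm, mul_zero, zero_mul, sub_self]
  refine LinearMap.ext fun p => ?_
  simp only [LinearMap.sub_apply, Module.End.mul_apply, LinearMap.mulLeft_apply, LinearMap.zero_apply]
  ring

lemma annih_comm (i l : Fin 3) (m n : ℕ) : cm (annih i m) (annih l n) = 0 := by
  unfold annih
  split_ifs <;> simp only [cm, mul_zero, zero_mul, sub_self]
  -- The commutator of two derivations is a derivation, so it suffices that it vanishes on the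
  -- variables.
  have : ∀ a b : Osc, ⁅MvPolynomial.pderiv (R := ℂ) a, MvPolynomial.pderiv (R := ℂ) b⁆ = 0 := by
    classical
    intro a b
    refine MvPolynomial.derivation_ext fun c => ?_
    rw [Derivation.commutator_apply]
    simp only [MvPolynomial.pderiv_X, Pi.single_apply, Derivation.zero_apply]
    split_ifs <;> simp
  refine LinearMap.ext fun p => ?_
  have h := congrArg (fun D => D p) (this ⟨(i, m), ‹_›⟩ ⟨(l, n), ‹_›⟩)
  simpa [Derivation.commutator_apply, Module.End.mul_apply] using h

open Classical in
lemma annih_create (i l : Fin 3) (m n : ℕ) : cm (annih i m) (create l n) =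
    (if i = l ∧ m = n ∧ 0 < m ∧ (i = 1 ↔ Even m) then (1 : ℂ) else 0) • 1 := by
  by_cases h1 : 0 < m ∧ (i = 1 ↔ Even m)
  · by_cases h2 : 0 < n ∧ (l = 1 ↔ Even n)
    · simp only [annih, create, dif_pos h1, dif_pos h2, cm]
      refine LinearMap.ext fun p => ?_
      simp only [LinearMap.sub_apply, Module.End.mul_apply, LinearMap.mulLeft_apply,
        Derivation.coeFn_coe, Derivation.leibniz, MvPolynomial.pderiv_X, Pi.single_apply,
        smul_eq_mul]
      by_cases h : i = l ∧ m = n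
      · obtain ⟨rfl, rfl⟩ := h
        simp [h1]
      · have h' : ¬ ((⟨(l, n), h2⟩ : Osc) = ⟨(i, m), h1⟩) := by
          intro h3
          simp only [Subtype.mk.injEq, Prod.mk.injEq] at h3
          exact h ⟨h3.1.symm, h3.2.symm⟩
        have h4 : ¬ (i = l ∧ m = n ∧ 0 < m ∧ (i = 1 ↔ Even m)) := fun h5 => h ⟨h5.1, h5.2.1⟩
        rw [if_neg h', if_neg h4]
        simp
    · have h4 : ¬ (i = l ∧ m = n ∧ 0 < m ∧ (i = 1 ↔ Even m)) := by
        rintro ⟨rfl, rfl, h5⟩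
        exact h2 h5
      rw [if_neg h4]
      simp [create, dif_neg h2, cm]
  · have h4 : ¬ (i = l ∧ m = n ∧ 0 < m ∧ (i = 1 ↔ Even m)) := fun h5 => h1 h5.2.2
    rw [if_neg h4]
    simp [annih, dif_neg h1, cm]

-- The factor `chi` accounts for the modes of the wrong parity, which are zero. The relations then
-- hold for all pairs of integers and no parity hypothesis has to be carried along.
open Classical in
lemma cm_mode_mode (k : ℂ) (i l : Fin 3) (m n : ℤ) : cm (mode k i m) (mode k l n) =
    (if i = l ∧ m + n = 0 then kap k i * m * chi i m else 0) • (1 : Op) := by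
  rw [mode_eq_diag, mode_eq_diag, diag_cm, ← diag_one, diag_smul]
  congr 1
  ext1 j
  rcases lt_trichotomy m 0 with hm | rfl | hm <;> rcases lt_trichotomy n 0 with hn | rfl | hn
  · rw [if_neg (by omega)]
    simp only [modeP, if_pos hm, if_pos hn, create_comm, zero_smul]
  · rw [if_neg (by omega)]
    simp only [modeP, if_pos hm, lt_irrefl, if_false]
    split_ifs <;> simp [cm, ← Module.End.one_eq_id]
  · have hn' : ¬ n < 0 := by omega
    simp only [modeP, if_pos hm, if_neg hn', if_pos hn]
    rw [cm_swap, smul_cm, annih_create, smul_smul, ← neg_smul]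
    congr 1
    by_cases h : i = l ∧ m + n = 0
    · obtain ⟨rfl, h⟩ := h
      obtain rfl : n = -m := by omega
      by_cases hp : i = 1 ↔ Even m
      · have : (i = i ∧ (-m).natAbs = m.natAbs ∧ 0 < (-m).natAbs ∧ (i = 1 ↔ Even (-m).natAbs)) := by
          refine ⟨rfl, by simp, by omega, by simpa [Int.natAbs_even] using hp⟩
        rw [if_pos this, if_pos ⟨rfl, h⟩, chi, if_pos hp]
        push_cast; ring
      · have : ¬ (i = i ∧ (-m).natAbs = m.natAbs ∧ 0 < (-m).natAbs ∧ (i = 1 ↔ Even (-m).natAbs)) := by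
          rintro ⟨-, -, -, h'⟩
          exact hp (by simpa [Int.natAbs_even] using h')
        rw [if_neg this, if_pos ⟨rfl, h⟩, chi, if_neg hp]
        simp
    · have : ¬ (l = i ∧ n.natAbs = m.natAbs ∧ 0 < n.natAbs ∧ (l = 1 ↔ Even n.natAbs)) := by
        rintro ⟨h1, h2, -⟩
        exact h ⟨h1.symm, by omega⟩
      rw [if_neg this, if_neg h]
      simp
  · rw [if_neg (by omega)]
    simp only [modeP, if_pos hn, lt_irrefl, if_false]
    split_ifs <;> simp [cm, ← Module.End.one_eq_id]
  · simp only [modeP, lt_irrefl, if_false]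
    split_ifs <;> simp [cm, ← Module.End.one_eq_id]
  · rw [if_neg (by omega)]
    have hn' : ¬ n < 0 := by omega
    simp only [modeP, if_neg hn', if_pos hn, lt_irrefl, if_false]
    split_ifs <;> simp [cm, ← Module.End.one_eq_id]
    rw [smul_comm, sub_self]
  · have hm' : ¬ m < 0 := by omega
    simp only [modeP, if_pos hn, if_neg hm', if_pos hm]
    rw [smul_cm, annih_create, smul_smul]
    congr 1
    by_cases h : i = l ∧ m + n = 0
    · obtain ⟨rfl, h⟩ := h
      obtain rfl : n = -m := by omega
      by_cases hp : i = 1 ↔ Even m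
      · have : (i = i ∧ m.natAbs = (-m).natAbs ∧ 0 < m.natAbs ∧ (i = 1 ↔ Even m.natAbs)) := by
          refine ⟨rfl, by simp, by omega, by simpa [Int.natAbs_even] using hp⟩
        rw [if_pos this, if_pos ⟨rfl, h⟩, chi, if_pos hp]
      · have : ¬ (i = i ∧ m.natAbs = (-m).natAbs ∧ 0 < m.natAbs ∧ (i = 1 ↔ Even m.natAbs)) := by
          rintro ⟨-, -, -, h'⟩
          exact hp (by simpa [Int.natAbs_even] using h')
        rw [if_neg this, if_pos ⟨rfl, h⟩, chi, if_neg hp]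
    · have : ¬ (i = l ∧ m.natAbs = n.natAbs ∧ 0 < m.natAbs ∧ (i = 1 ↔ Even m.natAbs)) := by
        rintro ⟨h1, h2, -⟩
        exact h ⟨h1, by omega⟩
      rw [if_neg this, if_neg h]
      simp
  · rw [if_neg (by omega)]
    have hm' : ¬ m < 0 := by omega
    simp only [modeP, if_neg hm', if_pos hm, lt_irrefl, if_false]
    split_ifs <;> simp [cm, ← Module.End.one_eq_id]
    rw [smul_comm, sub_self]
  · rw [if_neg (by omega)]
    have hm' : ¬ m < 0 := by omega
    have hn' : ¬ n < 0 := by omega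
    simp only [modeP, if_neg hm', if_pos hm, if_neg hn', if_pos hn, smul_cm, cm_smul, annih_comm,
      smul_zero, zero_smul]

/-! ### Coefficients of exponentials -/

lemma neg_op (A : Op) : -A = (-1 : ℂ) • A := by
  refine LinearMap.ext fun v => ?_
  simp

lemma coeff_pow_eq_zero {f : PowerSeries Op} (h0 : PowerSeries.coeff 0 f = 0) (l : ℕ) :
    ∀ r < l, PowerSeries.coeff r (f ^ l) = 0 := by
  induction l with
  | zero => intro r hr; omega
  | succ l ih =>
    intro r hr
    rw [pow_succ, PowerSeries.coeff_mul]
    refine Finset.sum_eq_zero fun p hp => ?_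
    have hp := Finset.HasAntidiagonal.mem_antidiagonal.mp hp
    rcases Nat.eq_zero_or_pos p.2 with h | h
    · rw [h, h0, mul_zero]
    · rw [ih p.1 (by omega), zero_mul]

/-- Without constant term, `f ^ l` starts at order `l`. The truncation in `expCoeff` can thus be
lengthened at will, which allows sums for different orders to be compared. -/
lemma expCoeff_eq {f : PowerSeries Op} (h0 : PowerSeries.coeff 0 f = 0) {r L : ℕ} (h : r < L) :
    expCoeff f r = ∑ l ∈ Finset.range L, ((l ! : ℂ)⁻¹) • PowerSeries.coeff r (f ^ l) := by
  unfold expCoeff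
  refine Finset.sum_subset (Finset.range_subset_range.mpr h) fun l _ hl => ?_
  rw [coeff_pow_eq_zero h0 l r (by simpa using hl), smul_zero]

lemma coeff_cm (T : Op) (g : PowerSeries Op) (r : ℕ) :
    PowerSeries.coeff r (cm (PowerSeries.C T) g) = cm T (PowerSeries.coeff r g) := by
  simp [cm, PowerSeries.coeff_C_mul, PowerSeries.coeff_mul_C]

lemma coeff_smul' (c : ℂ) (g : PowerSeries Op) (r : ℕ) :
    PowerSeries.coeff r (c • g) = c • PowerSeries.coeff r g := rfl

lemma cm_pow {T f : PowerSeries Op} (h : Commute f (cm T f)) (l : ℕ) :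
    cm T (f ^ (l + 1)) = ((l : ℂ) + 1) • (cm T f * f ^ l) := by
  induction l with
  | zero => simp
  | succ l ih =>
    rw [pow_succ, cm_mul, ih, (h.pow_left (l + 1)).eq, smul_mul_assoc, mul_assoc, ← pow_succ]
    push_cast
    rw [add_smul ((l : ℂ) + 1), one_smul]

/-- The commutator of `T` with `f` is the scalar series `c X^p`, which commutes with `f`. So `T`
acts on `exp f` as a derivation and `[T, exp f] = c X^p exp f`. -/
lemma cm_expCoeff {f : PowerSeries Op} (h0 : PowerSeries.coeff 0 f = 0) {T : Op} {c : ℂ} {p : ℕ}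
    (hp : 0 < p)
    (hT : ∀ n, cm T (PowerSeries.coeff n f) = if n = p then c • (1 : Op) else 0) (r : ℕ) :
    cm T (expCoeff f r) = if p ≤ r then c • expCoeff f (r - p) else 0 := by
  have h1 : cm (PowerSeries.C T) f = c • PowerSeries.X ^ p := by
    ext1 n
    rw [coeff_cm, hT, coeff_smul', PowerSeries.coeff_X_pow]
    split_ifs <;> simp
  have h2 : Commute f (cm (PowerSeries.C T) f) := by
    rw [h1]
    exact ((PowerSeries.commute_X_pow f p)).smul_right c
  have h3 : ∀ l : ℕ, cm T (PowerSeries.coeff r (f ^ (l + 1))) =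
      if p ≤ r then (((l : ℂ) + 1) * c) • PowerSeries.coeff (r - p) (f ^ l) else 0 := by
    intro l
    rw [← coeff_cm, cm_pow h2, h1, coeff_smul', smul_mul_assoc, coeff_smul',
      PowerSeries.coeff_X_pow_mul', smul_smul]
    split_ifs <;> simp
  rw [expCoeff, cm_sum, Finset.sum_range_succ']
  have h4 : cm T ((((0 : ℕ) ! : ℂ)⁻¹) • PowerSeries.coeff r (f ^ 0)) = 0 := by
    rw [cm_smul, pow_zero, PowerSeries.coeff_one]
    split_ifs <;> simp [cm]
  rw [h4, add_zero]
  by_cases hr : p ≤ r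
  · rw [if_pos hr, expCoeff_eq h0 (L := r) (by omega), Finset.smul_sum]
    refine Finset.sum_congr rfl fun l _ => ?_
    rw [cm_smul, h3, if_pos hr, smul_smul, smul_smul]
    congr 1
    rw [Nat.factorial_succ]
    have : ((l : ℂ) + 1) ≠ 0 := by exact_mod_cast Nat.succ_ne_zero l
    have h5 : (l ! : ℂ) ≠ 0 := by exact_mod_cast Nat.factorial_ne_zero l
    push_cast
    field_simp
  · rw [if_neg hr]
    refine Finset.sum_eq_zero fun l _ => ?_
    rw [cm_smul, h3, if_neg hr, smul_zero]

lemma cm_expCoeff_zero {f : PowerSeries Op} (h0 : PowerSeries.coeff 0 f = 0) {T : Op}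
    (hT : ∀ n, cm T (PowerSeries.coeff n f) = 0) (r : ℕ) : cm T (expCoeff f r) = 0 := by
  rw [cm_expCoeff h0 (c := 0) one_pos]
  · simp
  · intro n
    rw [hT]; simp

/-- On `f` the operator `T` acts as `μ` times the Euler derivation, and both are derivations, so
they agree on all powers of `f`. The coefficients need not commute here. -/
lemma cm_expCoeff_grading {f : PowerSeries Op} {T : Op} {μ : ℂ}
    (hT : ∀ n : ℕ, cm T (PowerSeries.coeff n f) = (μ * n) • PowerSeries.coeff n f) (r : ℕ) :
    cm T (expCoeff f r) = (μ * r) • expCoeff f r := by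
  have : ∀ l r, cm T (PowerSeries.coeff r (f ^ l)) = (μ * r) • PowerSeries.coeff r (f ^ l) := by
    intro l
    induction l with
    | zero =>
      intro r
      rw [pow_zero, PowerSeries.coeff_one]
      split_ifs with h <;> simp [cm, h]
    | succ l ih =>
      intro r
      rw [pow_succ, PowerSeries.coeff_mul, cm_sum, Finset.smul_sum]
      refine Finset.sum_congr rfl fun p hp => ?_
      have hp := Finset.HasAntidiagonal.mem_antidiagonal.mp hp
      rw [cm_mul, ih, hT, smul_mul_assoc, mul_smul_comm, ← add_smul, ← hp]
      push_cast
      ring_nf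
  rw [expCoeff, cm_sum, Finset.smul_sum]
  refine Finset.sum_congr rfl fun l _ => ?_
  rw [cm_smul, this, smul_comm]

/-- The Euler derivation of power series. -/
def euler (g : PowerSeries Op) : PowerSeries Op :=
  PowerSeries.mk fun n => (n : ℂ) • PowerSeries.coeff n g

lemma euler_mul (f g : PowerSeries Op) : euler (f * g) = euler f * g + f * euler g := by
  ext1 r
  simp only [euler, PowerSeries.coeff_mk, PowerSeries.coeff_mul, map_add, Finset.smul_sum]
  rw [← Finset.sum_add_distrib]
  refine Finset.sum_congr rfl fun p hp => ?_
  have hp := Finset.HasAntidiagonal.mem_antidiagonal.mp hp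
  rw [smul_mul_assoc, mul_smul_comm, ← add_smul, ← hp]
  push_cast
  rfl

lemma euler_pow {f : PowerSeries Op} (h : Commute f (euler f)) (l : ℕ) :
    euler (f ^ (l + 1)) = ((l : ℂ) + 1) • (euler f * f ^ l) := by
  induction l with
  | zero => simp
  | succ l ih =>
    rw [pow_succ, euler_mul, ih, (h.pow_left (l + 1)).eq, smul_mul_assoc, mul_assoc, ← pow_succ]
    push_cast
    rw [add_smul ((l : ℂ) + 1), one_smul]

/-- This is the differential equation `D exp f = (D f) exp f` for the Euler derivation `D`.
Commuting coefficients are needed to collect `D (f ^ l)` into `l (D f) f ^ (l-1)`. -/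
lemma expCoeff_recursion {f : PowerSeries Op} (h0 : PowerSeries.coeff 0 f = 0)
    (hc : ∀ m n, Commute (PowerSeries.coeff m f) (PowerSeries.coeff n f)) (r : ℕ) :
    (r : ℂ) • expCoeff f r =
      ∑ p ∈ Finset.HasAntidiagonal.antidiagonal r, ((p.1 : ℂ) • PowerSeries.coeff p.1 f) * expCoeff f p.2 := by
  have h2 : Commute f (euler f) := by
    ext1 n
    simp only [euler, PowerSeries.coeff_mul, PowerSeries.coeff_mk]
    rw [← Finset.Nat.sum_antidiagonal_swap]
    refine Finset.sum_congr rfl fun p _ => ?_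
    exact ((hc _ _).smul_right _).eq
  have h3 : ∀ l : ℕ, (r : ℂ) • PowerSeries.coeff r (f ^ (l + 1)) =
      ((l : ℂ) + 1) • PowerSeries.coeff r (euler f * f ^ l) := by
    intro l
    rw [← coeff_smul' ((l : ℂ) + 1), ← euler_pow h2, euler, PowerSeries.coeff_mk]
  have h4 : (r : ℂ) • ((((0 : ℕ) ! : ℂ)⁻¹) • PowerSeries.coeff r (f ^ 0)) = 0 := by
    rw [pow_zero, PowerSeries.coeff_one]
    split_ifs with h <;> simp [h]
  rw [expCoeff, Finset.smul_sum, Finset.sum_range_succ', h4, add_zero]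
  have h5 : ∀ l : ℕ, (r : ℂ) • ((((l + 1 : ℕ) ! : ℂ)⁻¹) • PowerSeries.coeff r (f ^ (l + 1))) =
      ((l ! : ℂ)⁻¹) • PowerSeries.coeff r (euler f * f ^ l) := by
    intro l
    rw [smul_comm, h3, smul_smul, Nat.factorial_succ]
    congr 1
    have : ((l : ℂ) + 1) ≠ 0 := by exact_mod_cast Nat.succ_ne_zero l
    have h5 : (l ! : ℂ) ≠ 0 := by exact_mod_cast Nat.factorial_ne_zero l
    push_cast
    field_simp
  simp only [h5, PowerSeries.coeff_mul, Finset.smul_sum]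
  rw [Finset.sum_comm]
  refine Finset.sum_congr rfl fun p hp => ?_
  have hp := Finset.HasAntidiagonal.mem_antidiagonal.mp hp
  simp only [euler, PowerSeries.coeff_mk]
  rcases Nat.eq_zero_or_pos p.1 with h | h
  · simp [h]
  · rw [expCoeff_eq h0 (L := r) (by omega), Finset.mul_sum]
    refine Finset.sum_congr rfl fun l _ => ?_
    rw [mul_smul_comm]

/-! ### Creation and annihilation parts of the vertex operators -/

lemma coeff_cre_zero (k : ℂ) (α : Fin 3 → ℂ) : PowerSeries.coeff 0
    (PowerSeries.mk fun n : ℕ => ∑ i, (α i / n) • mode k i (-n)) = 0 := by simp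

lemma coeff_ann_zero (k : ℂ) (α : Fin 3 → ℂ) : PowerSeries.coeff 0
    (PowerSeries.mk fun n : ℕ => -∑ i, (α i / n) • mode k i n) = 0 := by
  simp [neg_op]

lemma cm_mode_mode_of_ne (k : ℂ) (i l : Fin 3) {m n : ℤ} (h : m + n ≠ 0) :
    cm (mode k i m) (mode k l n) = 0 := by
  rw [cm_mode_mode, if_neg fun h' => h h'.2, zero_smul]

lemma expCre_zero (k : ℂ) (α : Fin 3 → ℂ) : expCre k α 0 = 1 := by
  simp [expCre, expCoeff]

lemma expAnn_zero (k : ℂ) (α : Fin 3 → ℂ) : expAnn k α 0 = 1 := by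
  simp [expAnn, expCoeff]

/-- The factor `n` of the Heisenberg relation cancels the denominator `n` in the exponent. What
remains is a charge independent of `n`, up to parity. -/
lemma cm_mode_expCre_of_pos (k : ℂ) (α : Fin 3 → ℂ) (i : Fin 3) {p : ℕ} (hp : 0 < p) (r : ℕ) :
    cm (mode k i p) (expCre k α r) =
      if p ≤ r then (α i * kap k i * chi i p) • expCre k α (r - p) else 0 := by
  refine cm_expCoeff (coeff_cre_zero k α) hp (fun n => ?_) r
  rw [PowerSeries.coeff_mk, cm_sum]
  simp only [cm_smul, cm_mode_mode, smul_smul]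
  split_ifs with h
  · subst h
    rw [Finset.sum_eq_single i]
    · rw [if_pos ⟨rfl, by omega⟩]
      congr 1
      have : (n : ℂ) ≠ 0 := by exact_mod_cast hp.ne'
      push_cast
      field_simp
    · intro l _ hl
      rw [if_neg fun h => hl h.1.symm]
      simp
    · simp
  · refine Finset.sum_eq_zero fun l _ => ?_
    rw [if_neg fun h' => h (by omega)]
    simp

lemma cm_mode_expCre_of_nonpos (k : ℂ) (α : Fin 3 → ℂ) (i : Fin 3) {p : ℤ} (hp : p ≤ 0) (r : ℕ) :
    cm (mode k i p) (expCre k α r) = 0 := by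
  refine cm_expCoeff_zero (coeff_cre_zero k α) (fun n => ?_) r
  rw [PowerSeries.coeff_mk, cm_sum]
  refine Finset.sum_eq_zero fun l _ => ?_
  rcases Nat.eq_zero_or_pos n with h | h
  · simp [h, cm]
  · rw [cm_smul, cm_mode_mode_of_ne _ _ _ (by omega), smul_zero]

lemma cm_mode_expAnn_of_neg (k : ℂ) (α : Fin 3 → ℂ) (i : Fin 3) {p : ℕ} (hp : 0 < p) (r : ℕ) :
    cm (mode k i (-p)) (expAnn k α r) =
      if p ≤ r then (α i * kap k i * chi i p) • expAnn k α (r - p) else 0 := by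
  refine cm_expCoeff (coeff_ann_zero k α) hp (fun n => ?_) r
  rw [PowerSeries.coeff_mk, neg_op, cm_smul, cm_sum]
  simp only [cm_smul, cm_mode_mode, smul_smul]
  split_ifs with h
  · subst h
    rw [Finset.sum_eq_single i]
    · rw [if_pos ⟨rfl, by omega⟩, smul_smul, chi_neg]
      congr 1
      have : (n : ℂ) ≠ 0 := by exact_mod_cast hp.ne'
      push_cast
      field_simp
    · intro l _ hl
      rw [if_neg fun h => hl h.1.symm]
      simp
    · simp
  · refine smul_eq_zero_of_right _ ?_
    refine Finset.sum_eq_zero fun l _ => ?_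
    rw [if_neg fun h' => h (by omega)]
    simp

lemma cm_mode_expAnn_of_nonneg (k : ℂ) (α : Fin 3 → ℂ) (i : Fin 3) {p : ℤ} (hp : 0 ≤ p) (r : ℕ) :
    cm (mode k i p) (expAnn k α r) = 0 := by
  refine cm_expCoeff_zero (coeff_ann_zero k α) (fun n => ?_) r
  rw [PowerSeries.coeff_mk, neg_op, cm_smul, cm_sum]
  refine smul_eq_zero_of_right _ ?_
  refine Finset.sum_eq_zero fun l _ => ?_
  rcases Nat.eq_zero_or_pos n with h | h
  · simp [h, cm]
  · rw [cm_smul, cm_mode_mode_of_ne _ _ _ (by omega), smul_zero]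

lemma expAnn_recursion (k : ℂ) (α : Fin 3 → ℂ) (s : ℕ) :
    (s : ℂ) • expAnn k α s = (-1 : ℂ) • ∑ p ∈ Finset.HasAntidiagonal.antidiagonal s,
      if p.1 = 0 then 0 else ∑ i, α i • (mode k i p.1 * expAnn k α p.2) := by
  rw [expAnn, expCoeff_recursion (coeff_ann_zero k α), Finset.smul_sum]
  · refine Finset.sum_congr rfl fun p _ => ?_
    split_ifs with h
    · simp [h]
    · rw [PowerSeries.coeff_mk, neg_op, smul_comm, smul_mul_assoc, Finset.smul_sum, Finset.sum_mul]
      congr 1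
      refine Finset.sum_congr rfl fun i _ => ?_
      have : (p.1 : ℂ) ≠ 0 := by exact_mod_cast h
      rw [smul_smul, smul_mul_assoc, mul_div_cancel₀ _ this]
      rfl
  · intro m n
    simp only [PowerSeries.coeff_mk]
    rw [neg_op, neg_op]
    refine ((Commute.sum_left _ _ _ fun i _ => Commute.sum_right _ _ _ fun l _ => ?_).smul_left
      _).smul_right _
    rcases Nat.eq_zero_or_pos m with h | h
    · simp [h]
    · have h1 : Commute (mode k i m) (mode k l n) :=
        mul_comm_of_cm (cm_mode_mode_of_ne k i l (m := m) (n := n) (by omega))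
      exact (h1.smul_left _).smul_right _

/-! ### Zero modes -/

lemma expQ_apply (k α : ℂ) (v : FockSum) (j : ℂ) :
    expQ k α v j = v (j - 2 * (k + 2) * α) := by
  have h : Function.Injective fun j : ℂ => j + 2 * (k + 2) * α := add_left_injective _
  have := Finsupp.mapDomain_apply h v (j - 2 * (k + 2) * α)
  simp only [sub_add_cancel] at this
  exact this

lemma mode_apply (k : ℂ) (i : Fin 3) (n : ℤ) (v : FockSum) (j : ℂ) :
    mode k i n v j = modeP k i n j (v j) := by
  rw [mode_eq_diag, diag_apply]

lemma cm_mode_expQ (k α : ℂ) (i : Fin 3) {n : ℤ} (h : n ≠ 0) :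
    cm (mode k i n) (expQ k α) = 0 := by
  refine LinearMap.ext fun v => Finsupp.ext fun j => ?_
  simp only [cm, LinearMap.sub_apply, Module.End.mul_apply, Finsupp.sub_apply, expQ_apply,
    mode_apply, LinearMap.zero_apply, Finsupp.zero_apply]
  rcases lt_or_gt_of_ne h with h | h
  · simp [modeP, h]
  · simp [modeP, h, not_lt.mpr h.le]

lemma cm_mode_zero_expQ (k α : ℂ) (i : Fin 3) :
    cm (mode k i 0) (expQ k α) = (if i = 1 then kap k i * α else 0) • expQ k α := by
  refine LinearMap.ext fun v => Finsupp.ext fun j => ?_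
  simp only [cm, LinearMap.sub_apply, Module.End.mul_apply, Finsupp.sub_apply, expQ_apply,
    mode_apply, LinearMap.smul_apply, Finsupp.smul_apply]
  by_cases h : i = 1
  · subst h
    simp only [modeP, lt_irrefl, if_false, if_true, LinearMap.smul_apply, LinearMap.id_apply]
    rw [← sub_smul]
    congr 1
    simp [kap]
    ring
  · simp [modeP, h]

lemma cm_mode_zeroPow (k α c : ℂ) (i : Fin 3) (n : ℤ) : cm (mode k i n) (zeroPow α c) = 0 := by
  rw [mode_eq_diag, zeroPow, diag_cm, ← diag_zero]
  congr 1
  ext1 j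
  split_ifs
  · rw [← Module.End.one_eq_id, cm_one]
  · rw [cm_zero]

/-! ### The grading -/

/-- The eigenvalue of `d` on the vacuum of `F_{j,k}`. -/
def vacGrade (k j : ℂ) : ℂ := (2 * j ^ 2 + k) / (4 * (k + 2))

/-- The derivation that multiplies a monomial by its degree. -/
def degDer : Derivation ℂ (MvPolynomial Osc ℂ) (MvPolynomial Osc ℂ) :=
  MvPolynomial.mkDerivation ℂ fun o : Osc => (o.1.2 : ℂ) • (MvPolynomial.X o : MvPolynomial Osc ℂ)

lemma grading_apply (k : ℂ) (v : FockSum) (j : ℂ) :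
    grading k v j = degDer (v j) + vacGrade k j • v j := by
  rw [grading, diag_apply]
  rfl

lemma degDer_X (o : Osc) : degDer (MvPolynomial.X o) = (o.1.2 : ℂ) • MvPolynomial.X o := by
  simp [degDer, MvPolynomial.mkDerivation_X]

lemma degDer_pderiv (o : Osc) (p : MvPolynomial Osc ℂ) :
    degDer (MvPolynomial.pderiv o p) =
      MvPolynomial.pderiv o (degDer p) - (o.1.2 : ℂ) • MvPolynomial.pderiv o p := by
  classical
  have : ⁅degDer, MvPolynomial.pderiv (R := ℂ) o⁆ = -((o.1.2 : ℂ) • MvPolynomial.pderiv o) := by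
    refine MvPolynomial.derivation_ext fun c => ?_
    rw [Derivation.commutator_apply]
    simp only [MvPolynomial.pderiv_X, Pi.single_apply, Derivation.neg_apply, Derivation.smul_apply,
      degDer_X, Derivation.map_smul]
    split_ifs with h
    · subst h; simp
    · simp
  have h := congrArg (fun D => D p) this
  simp only [Derivation.commutator_apply, Derivation.neg_apply, Derivation.smul_apply] at h
  rw [sub_eq_iff_eq_add] at h
  rw [h]; abel

lemma cm_grading_mode (k : ℂ) (i : Fin 3) (n : ℤ) :
    cm (grading k) (mode k i n) = (-(n : ℂ)) • mode k i n := by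
  refine LinearMap.ext fun v => Finsupp.ext fun j => ?_
  simp only [cm, LinearMap.sub_apply, Module.End.mul_apply, Finsupp.sub_apply, grading_apply,
    mode_apply, LinearMap.smul_apply, Finsupp.smul_apply, map_add, map_smul]
  rw [add_sub_add_right_eq_sub]
  unfold modeP
  split_ifs with h1 h2 h3
  · unfold create
    split_ifs with h
    · simp only [LinearMap.mulLeft_apply, Derivation.leibniz, degDer_X, smul_eq_mul,
        add_sub_cancel_left, mul_smul_comm]
      rw [mul_comm (v j)]
      congr 1
      rw [← Int.cast_natCast, Int.ofNat_natAbs_of_nonpos h1.le]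
      simp
    · simp
  · unfold annih
    split_ifs with h
    · simp only [LinearMap.smul_apply, Derivation.coeFn_coe, Derivation.map_smul, degDer_pderiv]
      rw [smul_sub, sub_sub_cancel_left, smul_comm, ← neg_smul]
      congr 2
      rw [← Int.cast_natCast, Int.natAbs_of_nonneg h2.le]
    · simp
  · obtain rfl : n = 0 := by omega
    simp
  · simp

lemma cm_grading_expCre (k : ℂ) (α : Fin 3 → ℂ) (r : ℕ) :
    cm (grading k) (expCre k α r) = (r : ℂ) • expCre k α r := by
  have := cm_expCoeff_grading (f := PowerSeries.mk fun n : ℕ => ∑ i, (α i / n) • mode k i (-n))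
    (T := grading k) (μ := 1) (fun n => ?_) r
  · rwa [one_mul] at this
  · rw [PowerSeries.coeff_mk, cm_sum, Finset.smul_sum]
    refine Finset.sum_congr rfl fun i _ => ?_
    rw [cm_smul, cm_grading_mode, smul_comm]
    simp

lemma cm_grading_expAnn (k : ℂ) (α : Fin 3 → ℂ) (r : ℕ) :
    cm (grading k) (expAnn k α r) = (-(r : ℂ)) • expAnn k α r := by
  have := cm_expCoeff_grading (f := PowerSeries.mk fun n : ℕ => -∑ i, (α i / n) • mode k i n)
    (T := grading k) (μ := -1) (fun n => ?_) r
  · rwa [neg_one_mul] at this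
  · rw [PowerSeries.coeff_mk, neg_op, cm_smul, cm_sum, smul_comm]
    refine congrArg _ ?_
    rw [Finset.smul_sum]
    refine Finset.sum_congr rfl fun i _ => ?_
    rw [cm_smul, cm_grading_mode, smul_comm]
    simp

lemma zeroPow_apply (α c : ℂ) (v : FockSum) (j : ℂ) :
    zeroPow α c v j = if c = α * (2 * j) then v j else 0 := by
  rw [zeroPow, diag_apply]
  split_ifs <;> rfl

/-- The vacuum energy is quadratic in `j` and `e^{αQ}` shifts `j` by `2(k+2)α`. The energy therefore
grows by `2αj + 2(k+2)α²`, and `zeroPow` selects the `j` with `2αj = c`. -/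
lemma cm_grading_expQ_zeroPow {k : ℂ} (hk : k ≠ -2) (α c : ℂ) :
    cm (grading k) (expQ k α * zeroPow α c) =
      (c + 2 * (k + 2) * α ^ 2) • (expQ k α * zeroPow α c) := by
  have hk' : k + 2 ≠ 0 := fun h => hk (eq_neg_of_add_eq_zero_left h)
  refine LinearMap.ext fun v => Finsupp.ext fun j => ?_
  simp only [cm, LinearMap.sub_apply, Module.End.mul_apply, Finsupp.sub_apply, grading_apply,
    expQ_apply, zeroPow_apply, LinearMap.smul_apply, Finsupp.smul_apply]
  split_ifs with h
  · rw [add_sub_add_left_eq_sub, ← sub_smul, h]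
    congr 1
    unfold vacGrade
    field_simp
    ring
  · simp

/-! ### Commutators with vertex operators -/

lemma finsum_of_injective {ι κ M : Type*} [AddCommMonoid M] {e : κ → ι} (he : Function.Injective e)
    {f : ι → M} (h : ∀ b, b ∉ range e → f b = 0) : ∑ᶠ b, f b = ∑ᶠ a, f (e a) := by
  rw [← finsum_mem_range he, finsum_mem_def]
  refine finsum_congr fun b => ?_
  by_cases hb : b ∈ range e
  · rw [indicator_of_mem hb]
  · rw [indicator_of_notMem hb, h b hb]

lemma locSum_apply {ι : Type} (F : ι → Op) (h : LocFin F) (v : FockSum) :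
    locSum F h v = ∑ᶠ i, F i v := rfl

lemma cm_apply (A B : Op) (v : FockSum) : cm A B v = A (B v) - B (A v) := rfl

lemma cm_locSum_apply {ι : Type} (F : ι → Op) (h : LocFin F) (T : Op) (v : FockSum) :
    cm T (locSum F h) v = ∑ᶠ i, cm T (F i) v := by
  rw [cm_apply, locSum_apply, locSum_apply, map_finsum T (h v), ← finsum_sub_distrib]
  · rfl
  · refine (h v).subset fun i hi => ?_
    intro h0
    exact hi (by simp [h0])
  · exact h (T v)

lemma vertex_apply (k : ℂ) (α : Fin 3 → ℂ) (a : ℂ) (v : FockSum) :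
    vertex k α a v = ∑ᶠ p, vertexTerm k α a p v := rfl

lemma vertexInsert_apply (k : ℂ) (i : Fin 3) (α : Fin 3 → ℂ) (a : ℂ) (v : FockSum) :
    vertexInsert k i α a v = ∑ᶠ n, insertTerm k i α a n v := rfl

lemma vertex_cm_apply (k : ℂ) (α : Fin 3 → ℂ) (a : ℂ) (T : Op) (v : FockSum) :
    cm T (vertex k α a) v = ∑ᶠ p, cm T (vertexTerm k α a p) v := cm_locSum_apply _ _ _ _

/-- A negative mode sees only the annihilation exponential, a positive mode only the creation
exponential, the zero mode only `e^{αQ}`. In the first two cases an index of the term drops by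
`|n|`, terms whose index is too small drop out, and the others are reindexed. The result is the same
charge in all three cases. -/
theorem cm_mode_vertex (k : ℂ) (α : Fin 3 → ℂ) (a : ℂ) (i : Fin 3) (n : ℤ) :
    cm (mode k i n) (vertex k α a) = (α i * kap k i * chi i n) • vertex k α (a - n) := by
  refine LinearMap.ext fun v => ?_
  rw [vertex_cm_apply, LinearMap.smul_apply, vertex_apply, smul_finsum' _ (vertexTerm_locFin k α _ v)]
  rcases lt_trichotomy n 0 with hn | rfl | hn
  · obtain ⟨p, rfl⟩ : ∃ p : ℕ, n = -(p : ℤ) := ⟨n.natAbs, by omega⟩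
    have hp : 0 < p := by omega
    have key : ∀ q : ℕ × ℕ, cm (mode k i (-p)) (vertexTerm k α a q) = if p ≤ q.2 then
        (α i * kap k i * chi i (-p)) • vertexTerm k α (a - (-p : ℤ)) (q.1, q.2 - p) else 0 := by
      intro q
      simp only [vertexTerm, cm_mul, cm_mode_expCre_of_nonpos k α i hn.le, cm_mode_expQ k _ i hn.ne,
        cm_mode_zeroPow, cm_mode_expAnn_of_neg k α i hp, mul_zero, add_zero, zero_mul, zero_add]
      split_ifs with h
      · simp only [mul_smul_comm, smul_mul_assoc, chi_neg]
        congr 3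
        push_cast [Nat.cast_sub h]
        ring
      · simp
    rw [finsum_of_injective (e := fun q : ℕ × ℕ => (q.1, q.2 + p))]
    · refine finsum_congr fun q => ?_
      rw [key]
      simp
    · intro q q' h
      simp only [Prod.mk.injEq] at h
      exact Prod.ext h.1 (by omega)
    · intro q hq
      rw [key, if_neg, LinearMap.zero_apply]
      intro h
      exact hq ⟨(q.1, q.2 - p), by simp [Nat.sub_add_cancel h]⟩
  · refine finsum_congr fun q => ?_
    have key : cm (mode k i 0) (vertexTerm k α a q) =
        (α i * kap k i * chi i 0) • vertexTerm k α (a - (0 : ℤ)) q := by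
      simp only [vertexTerm, cm_mul, cm_mode_expCre_of_nonpos k α i le_rfl, cm_mode_zero_expQ,
        cm_mode_zeroPow, cm_mode_expAnn_of_nonneg k α i le_rfl, mul_zero, add_zero, zero_mul, zero_add]
      rw [mul_smul_comm, smul_mul_assoc]
      push_cast
      rw [sub_zero]
      congr 1
      by_cases h : i = 1
      · subst h; simp [chi]; ring
      · simp [chi, h]
    rw [key]
    simp
  · obtain ⟨p, rfl⟩ : ∃ p : ℕ, n = (p : ℤ) := ⟨n.natAbs, by omega⟩
    have hp : 0 < p := by omega
    have key : ∀ q : ℕ × ℕ, cm (mode k i p) (vertexTerm k α a q) = if p ≤ q.1 then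
        (α i * kap k i * chi i p) • vertexTerm k α (a - (p : ℤ)) (q.1 - p, q.2) else 0 := by
      intro q
      simp only [vertexTerm, cm_mul, cm_mode_expCre_of_pos k α i hp, cm_mode_expQ k _ i hn.ne',
        cm_mode_zeroPow, cm_mode_expAnn_of_nonneg k α i hn.le, mul_zero, add_zero]
      split_ifs with h
      · simp only [smul_mul_assoc]
        congr 3
        push_cast [Nat.cast_sub h]
        ring
      · simp
    rw [finsum_of_injective (e := fun q : ℕ × ℕ => (q.1 + p, q.2))]
    · refine finsum_congr fun q => ?_
      rw [key]
      simp
    · intro q q' h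
      simp only [Prod.mk.injEq] at h
      exact Prod.ext (by omega) h.2
    · intro q hq
      rw [key, if_neg, LinearMap.zero_apply]
      intro h
      exact hq ⟨(q.1 - p, q.2), by simp [Nat.sub_add_cancel h]⟩

-- Besides the action on the exponential, the mode `φ_{i,n}` meets exactly one mode of the
-- insertion, `φ_{l,-n}`. The result is the same on whichever side of the exponential normal
-- ordering has put that mode.
open Classical in
theorem cm_mode_vertexInsert (k : ℂ) (α : Fin 3 → ℂ) (a : ℂ) (i l : Fin 3) (n : ℤ) :
    cm (mode k i n) (vertexInsert k l α a) =
      (α i * kap k i * chi i n) • vertexInsert k l α (a - n)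
        + (if i = l then kap k i * n * chi i n else 0) • vertex k α (a - n) := by
  refine LinearMap.ext fun v => ?_
  rw [LinearMap.add_apply, LinearMap.smul_apply, LinearMap.smul_apply, vertexInsert,
    cm_locSum_apply, vertexInsert_apply, smul_finsum' _ (insertTerm_locFin k l α _ v)]
  have key : ∀ p, cm (mode k i n) (insertTerm k l α a p) =
      (α i * kap k i * chi i n) • insertTerm k l α (a - n) p +
        if p = -n then (if i = l then kap k i * n * chi i n else 0) • vertex k α (a - n) else 0 := by
    intro p
    have h0 : a + p - n = a - n + p := by ring
    by_cases h : p = -n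
    · have h2 : a + ((-n : ℤ) : ℂ) = a - n := by push_cast; ring
      have h3 : n + -n = 0 := by ring
      subst h
      unfold insertTerm
      rw [if_pos rfl]
      by_cases h1 : -n < 0
      · simp only [if_pos h1]
        rw [cm_mul, cm_mode_vertex, cm_mode_mode, h0, mul_smul_comm, smul_mul_assoc, one_mul, h2, h3,
          add_comm]
        simp only [and_true]
      · simp only [if_neg h1]
        rw [cm_mul, cm_mode_vertex, cm_mode_mode, h0, mul_smul_comm, smul_mul_assoc, mul_one, h2, h3]
        simp only [and_true]
    · unfold insertTerm
      rw [if_neg h, add_zero]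
      split_ifs with h1
      · rw [cm_mul, cm_mode_vertex, cm_mode_mode_of_ne k i l (by omega), h0, mul_smul_comm, zero_mul,
          zero_add]
      · rw [cm_mul, cm_mode_vertex, cm_mode_mode_of_ne k i l (by omega), h0, smul_mul_assoc, mul_zero,
          add_zero]
  simp only [key, LinearMap.add_apply, LinearMap.smul_apply]
  rw [finsum_add_distrib]
  · congr 1
    rw [finsum_eq_single _ (-n)]
    · rw [if_pos rfl]; rfl
    · intro p hp
      simp [hp]
  · refine (insertTerm_locFin k l α (a - n) v).subset fun p hp h0 => hp (by simp [h0])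
  · refine (finite_singleton (-n)).subset fun p hp => ?_
    by_contra h
    exact hp (by simp only [mem_singleton_iff] at h; simp only [if_neg h]; rfl)

theorem cm_grading_vertex {k : ℂ} (hk : k ≠ -2) (α : Fin 3 → ℂ) (a : ℂ) :
    cm (grading k) (vertex k α a) = (a + 2 * (k + 2) * α 1 ^ 2) • vertex k α a := by
  refine LinearMap.ext fun v => ?_
  rw [vertex_cm_apply, LinearMap.smul_apply, vertex_apply, smul_finsum' _ (vertexTerm_locFin k α _ v)]
  refine finsum_congr fun q => ?_
  have key : cm (grading k) (vertexTerm k α a q) =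
      (a + 2 * (k + 2) * α 1 ^ 2) • vertexTerm k α a q := by
    rw [vertexTerm, mul_assoc _ (expQ k (α 1)), cm_mul, cm_mul, cm_grading_expCre,
      cm_grading_expAnn, cm_grading_expQ_zeroPow hk]
    simp only [smul_mul_assoc, mul_smul_comm, ← add_smul]
    congr 1
    ring
  rw [key]
  rfl

theorem cm_grading_vertexInsert {k : ℂ} (hk : k ≠ -2) (i : Fin 3) (α : Fin 3 → ℂ) (a : ℂ) :
    cm (grading k) (vertexInsert k i α a) = (a + 2 * (k + 2) * α 1 ^ 2) • vertexInsert k i α a := by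
  refine LinearMap.ext fun v => ?_
  rw [vertexInsert, cm_locSum_apply, LinearMap.smul_apply, locSum_apply,
    smul_finsum' _ (insertTerm_locFin k i α _ v)]
  refine finsum_congr fun n => ?_
  have key : cm (grading k) (insertTerm k i α a n) =
      (a + 2 * (k + 2) * α 1 ^ 2) • insertTerm k i α a n := by
    unfold insertTerm
    split_ifs <;>
    · rw [cm_mul, cm_grading_vertex hk, cm_grading_mode]
      simp only [smul_mul_assoc, mul_smul_comm, ← add_smul]
      congr 1
      ring
  rw [key]
  rfl

/-! ### Operators between the Fock spaces -/

lemma mem_fock_iff {j : ℂ} {v : FockSum} : v ∈ fock j ↔ ∃ p, v = Finsupp.single j p := by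
  constructor
  · rintro ⟨p, rfl⟩; exact ⟨p, rfl⟩
  · rintro ⟨p, rfl⟩; exact ⟨p, rfl⟩

lemma mem_fock_iff_apply {j : ℂ} {v : FockSum} : v ∈ fock j ↔ ∀ j', j' ≠ j → v j' = 0 := by
  classical
  rw [mem_fock_iff]
  constructor
  · rintro ⟨p, rfl⟩ j' h
    rw [Finsupp.single_apply, if_neg h.symm]
  · intro h
    refine ⟨v j, Finsupp.ext fun j' => ?_⟩
    rw [Finsupp.single_apply]
    split_ifs with h'
    · rw [h']
    · exact h j' (Ne.symm h')

/-- The operators that map `F_{j,k}` to `F_{j+s,k}` for all `j`. -/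
def shiftOps (s : ℂ) : Submodule ℂ Op where
  carrier := {T | ∀ j, ∀ v ∈ fock j, T v ∈ fock (j + s)}
  zero_mem' := fun j v _ => by simp
  add_mem' := fun hT hU j v hv => (fock _).add_mem (hT j v hv) (hU j v hv)
  smul_mem' := fun c T hT j v hv => (fock _).smul_mem c (hT j v hv)

lemma mul_mem_shiftOps {s t : ℂ} {T U : Op} (hT : T ∈ shiftOps s) (hU : U ∈ shiftOps t) :
    T * U ∈ shiftOps (t + s) := by
  intro j v hv
  rw [← add_assoc]
  exact hT _ _ (hU _ _ hv)

lemma mul_mem_shiftOps_zero {s : ℂ} {T U : Op} (hT : T ∈ shiftOps 0) (hU : U ∈ shiftOps s) :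
    T * U ∈ shiftOps s := by
  simpa using mul_mem_shiftOps hT hU

lemma one_mem_shiftOps : (1 : Op) ∈ shiftOps 0 := fun j v hv => by simpa using hv

lemma locSum_mem_shiftOps {ι : Type} {F : ι → Op} {h : LocFin F} {s : ℂ}
    (hF : ∀ i, F i ∈ shiftOps s) : locSum F h ∈ shiftOps s := by
  intro j v hv
  rw [locSum_apply]
  exact finsum_induction (· ∈ fock (j + s)) (Submodule.zero_mem _)
    (fun _ _ => Submodule.add_mem _) fun i => hF i j v hv

lemma diag_mem_shiftOps (T : ℂ → Module.End ℂ (MvPolynomial Osc ℂ)) : diag T ∈ shiftOps 0 := by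
  intro j v hv
  rw [add_zero]
  rw [mem_fock_iff_apply] at hv ⊢
  intro j' h
  rw [diag_apply, hv j' h, map_zero]

lemma mode_mem_shiftOps (k : ℂ) (i : Fin 3) (n : ℤ) : mode k i n ∈ shiftOps 0 := by
  rw [mode_eq_diag]; exact diag_mem_shiftOps _

lemma expQ_mem_shiftOps (k α : ℂ) : expQ k α ∈ shiftOps (2 * (k + 2) * α) := by
  intro j v hv
  rw [mem_fock_iff_apply] at hv ⊢
  intro j' h
  rw [expQ_apply]
  exact hv _ fun h' => h (by rw [← h']; ring)

lemma expCoeff_mem_shiftOps {f : PowerSeries Op} (hf : ∀ n, PowerSeries.coeff n f ∈ shiftOps 0)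
    (r : ℕ) : expCoeff f r ∈ shiftOps 0 := by
  suffices h : ∀ l r, PowerSeries.coeff r (f ^ l) ∈ shiftOps 0 from
    Submodule.sum_mem _ fun l _ => Submodule.smul_mem _ _ (h l r)
  intro l
  induction l with
  | zero =>
    intro r
    rw [pow_zero, PowerSeries.coeff_one]
    split_ifs
    · exact one_mem_shiftOps
    · exact Submodule.zero_mem _
  | succ l ih =>
    intro r
    rw [pow_succ, PowerSeries.coeff_mul]
    exact Submodule.sum_mem _ fun p _ => mul_mem_shiftOps_zero (ih _) (hf _)

lemma expCre_mem_shiftOps (k : ℂ) (α : Fin 3 → ℂ) (r : ℕ) : expCre k α r ∈ shiftOps 0 := by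
  refine expCoeff_mem_shiftOps (fun n => ?_) r
  rw [PowerSeries.coeff_mk]
  exact Submodule.sum_mem _ fun i _ => Submodule.smul_mem _ _ (mode_mem_shiftOps k i _)

lemma expAnn_mem_shiftOps (k : ℂ) (α : Fin 3 → ℂ) (r : ℕ) : expAnn k α r ∈ shiftOps 0 := by
  refine expCoeff_mem_shiftOps (fun n => ?_) r
  rw [PowerSeries.coeff_mk, neg_op]
  exact Submodule.smul_mem _ _
    (Submodule.sum_mem _ fun i _ => Submodule.smul_mem _ _ (mode_mem_shiftOps k i _))

theorem vertex_mem_shiftOps (k : ℂ) (α : Fin 3 → ℂ) (a : ℂ) :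
    vertex k α a ∈ shiftOps (2 * (k + 2) * α 1) := by
  refine locSum_mem_shiftOps fun p => ?_
  have := mul_mem_shiftOps (mul_mem_shiftOps_zero (mul_mem_shiftOps_zero
    (expCre_mem_shiftOps k α p.1) (expAnn_mem_shiftOps k α p.2)) (expQ_mem_shiftOps k (α 1)))
    (diag_mem_shiftOps fun j => if a - p.1 + p.2 = α 1 * (2 * j) then LinearMap.id else 0)
  rw [zero_add] at this
  convert this using 1
  unfold vertexTerm zeroPow
  congr! 4

theorem vertexInsert_mem_shiftOps (k : ℂ) (i : Fin 3) (α : Fin 3 → ℂ) (a : ℂ) :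
    vertexInsert k i α a ∈ shiftOps (2 * (k + 2) * α 1) := by
  refine locSum_mem_shiftOps fun n => ?_
  unfold insertTerm
  split_ifs
  · exact mul_mem_shiftOps_zero (mode_mem_shiftOps k i n) (vertex_mem_shiftOps _ _ _)
  · simpa using mul_mem_shiftOps (vertex_mem_shiftOps k α _) (mode_mem_shiftOps k i n)

lemma grading_mem_shiftOps (k : ℂ) : grading k ∈ shiftOps 0 := diag_mem_shiftOps _

/-! ### Vacuum vectors and vacuum functionals -/

/-- The vacuum `|j,k⟩`. -/
def vac (j : ℂ) : FockSum := Finsupp.single j 1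

lemma vac_mem (j : ℂ) : vac j ∈ fock j := ⟨1, rfl⟩

lemma coord_apply (j : ℂ) (d : Osc →₀ ℕ) (v : FockSum) : coord j d v = (v j).coeff d := rfl

lemma mode_vac (k : ℂ) (i : Fin 3) {n : ℤ} (hn : 0 < n) (j : ℂ) : mode k i n (vac j) = 0 := by
  classical
  refine Finsupp.ext fun j' => ?_
  rw [mode_apply, modeP, if_neg (by omega), if_pos hn, vac, Finsupp.single_apply]
  unfold annih
  split_ifs <;> simp

lemma mode_zero_vac (k : ℂ) (j : ℂ) : mode k 1 0 (vac j) = (2 * j) • vac j := by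
  classical
  refine Finsupp.ext fun j' => ?_
  rw [mode_apply, modeP, if_neg (by omega), if_neg (by omega), if_pos rfl, vac,
    Finsupp.single_apply, Finsupp.smul_apply, Finsupp.single_apply]
  split_ifs with h
  · rw [h]; rfl
  · simp

lemma mode_zero_of_ne (k : ℂ) {i : Fin 3} (h : i ≠ 1) : mode k i 0 = 0 := by
  simp [mode, h]

lemma coord_mode_neg (k : ℂ) (i : Fin 3) {n : ℤ} (hn : n < 0) (j : ℂ) (v : FockSum) :
    coord j 0 (mode k i n v) = 0 := by
  rw [coord_apply, mode_apply, modeP, if_pos hn]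
  unfold create
  split_ifs
  · simp only [LinearMap.mulLeft_apply]
    rw [MvPolynomial.coeff_X_mul']
    simp
  · simp

lemma coord_expCre (k : ℂ) (α : Fin 3 → ℂ) {r : ℕ} (hr : 0 < r) (j : ℂ) (v : FockSum) :
    coord j 0 (expCre k α r v) = 0 := by
  rw [expCre, expCoeff, LinearMap.sum_apply, map_sum]
  refine Finset.sum_eq_zero fun l _ => ?_
  rw [LinearMap.smul_apply, map_smul]
  refine smul_eq_zero_of_right _ ?_
  cases l with
  | zero =>
    rw [pow_zero, PowerSeries.coeff_one, if_neg hr.ne']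
    simp
  | succ l =>
    rw [pow_succ', PowerSeries.coeff_mul, LinearMap.sum_apply, map_sum]
    refine Finset.sum_eq_zero fun p _ => ?_
    rw [PowerSeries.coeff_mk, Module.End.mul_apply, LinearMap.sum_apply, map_sum]
    refine Finset.sum_eq_zero fun i _ => ?_
    rw [LinearMap.smul_apply, map_smul]
    rcases Nat.eq_zero_or_pos p.1 with h | h
    · simp [h]
    · rw [coord_mode_neg k i (by omega), smul_zero]

lemma expAnn_vac (k : ℂ) (α : Fin 3 → ℂ) {r : ℕ} (hr : 0 < r) (j : ℂ) :
    expAnn k α r (vac j) = 0 := by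
  rw [expAnn, expCoeff, LinearMap.sum_apply]
  refine Finset.sum_eq_zero fun l _ => ?_
  rw [LinearMap.smul_apply]
  refine smul_eq_zero_of_right _ ?_
  cases l with
  | zero =>
    rw [pow_zero, PowerSeries.coeff_one, if_neg hr.ne']
    simp
  | succ l =>
    rw [pow_succ, PowerSeries.coeff_mul, LinearMap.sum_apply]
    refine Finset.sum_eq_zero fun p _ => ?_
    rw [PowerSeries.coeff_mk, Module.End.mul_apply, neg_op, LinearMap.smul_apply,
      LinearMap.sum_apply]
    refine (congrArg _ ?_).trans (map_zero _)
    refine smul_eq_zero_of_right _ (Finset.sum_eq_zero fun i _ => ?_)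
    rw [LinearMap.smul_apply]
    rcases Nat.eq_zero_or_pos p.2 with h | h
    · simp [h]
    · rw [mode_vac k i (by omega), smul_zero]

lemma cm_expQ_expAnn (k α : ℂ) (β : Fin 3 → ℂ) (s : ℕ) : cm (expQ k α) (expAnn k β s) = 0 := by
  refine cm_expCoeff_zero (coeff_ann_zero k β) (fun n => ?_) s
  rw [PowerSeries.coeff_mk, neg_op, cm_smul, cm_sum]
  refine smul_eq_zero_of_right _ (Finset.sum_eq_zero fun l _ => ?_)
  rcases Nat.eq_zero_or_pos n with h | h
  · simp [h, cm]
  · rw [cm_smul, cm_swap, cm_mode_expQ k α l (by omega)]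
    simp

lemma coord_expQ (k α j : ℂ) (d : Osc →₀ ℕ) (v : FockSum) :
    coord (j + 2 * (k + 2) * α) d (expQ k α v) = coord j d v := by
  rw [coord_apply, coord_apply, expQ_apply, add_sub_cancel_right]

-- Creation operators annihilate the dual vacuum, so only the terms with trivial creation part
-- survive. The factor `e^{αQ}` commutes with the annihilation part and merely relabels the Fock
-- space.
open Classical in
theorem coord_vertex (k : ℂ) (α : Fin 3 → ℂ) (a j : ℂ) {v : FockSum} (hv : v ∈ fock j) :
    coord (j + 2 * (k + 2) * α 1) 0 (vertex k α a v) =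
      ∑ᶠ s : ℕ, if a + s = α 1 * (2 * j) then coord j 0 (expAnn k α s v) else 0 := by
  rw [vertex_apply, map_finsum _ (vertexTerm_locFin k α a v),
    finsum_of_injective (e := fun s : ℕ => ((0, s) : ℕ × ℕ))]
  · refine finsum_congr fun s => ?_
    have h1 : zeroPow (α 1) (a + s) v = if a + s = α 1 * (2 * j) then v else 0 := by
      refine Finsupp.ext fun j' => ?_
      rw [zeroPow_apply]
      by_cases hj : j' = j
      · subst hj
        split_ifs <;> rfl
      · rw [mem_fock_iff_apply.mp hv j' hj]
        split_ifs <;> first | rfl | exact (mem_fock_iff_apply.mp hv j' hj).symm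
    simp only [vertexTerm, expCre_zero, one_mul, Module.End.mul_apply, Nat.cast_zero, sub_zero, h1]
    rw [← Module.End.mul_apply, ← mul_comm_of_cm (cm_expQ_expAnn k (α 1) α s), Module.End.mul_apply,
      coord_expQ]
    split_ifs <;> simp
  · intro s t h
    simpa using h
  · rintro ⟨r, s⟩ h
    simp only [vertexTerm, Module.End.mul_apply]
    rcases Nat.eq_zero_or_pos r with h0 | h0
    · exact absurd ⟨s, by simp [h0]⟩ h
    · exact coord_expCre k α h0 _ _

/-! ### Exchange of annihilation operators and vertex operators -/

/-- The coefficients of `exp (-∑_{n>0} w_n z^n / n)`. -/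
def exch (w : ℕ → ℂ) : ℕ → ℂ
  | 0 => 1
  | s + 1 => -(∑ i : Fin (s + 1), w (s + 1 - i) * exch w i) / (s + 1)

lemma exch_recursion (w : ℕ → ℂ) (s : ℕ) : (s : ℂ) * exch w s =
    -∑ p ∈ Finset.HasAntidiagonal.antidiagonal s, if p.1 = 0 then 0 else w p.1 * exch w p.2 := by
  cases s with
  | zero => simp
  | succ s =>
    rw [exch, Finset.Nat.antidiagonal_succ]
    have : ((s : ℂ) + 1) ≠ 0 := by exact_mod_cast Nat.succ_ne_zero s
    push_cast
    rw [mul_div_cancel₀ _ this]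
    simp only [Finset.sum_cons, if_true, zero_add, Finset.sum_map, Function.Embedding.prodMap,
      Function.Embedding.coeFn_mk, Prod.map_fst, Prod.map_snd, Function.Embedding.refl_apply,
      Nat.succ_ne_zero, if_false]
    rw [← Finset.Nat.sum_antidiagonal_swap, Finset.Nat.sum_antidiagonal_eq_sum_range_succ_mk,
      Finset.sum_range]
    congr 1
    refine Finset.sum_congr rfl fun i _ => ?_
    simp only [Prod.swap_prod_mk]
    congr 2
    omega

/-- The pairing of two exponents at the level `n`. -/
def pairing (k : ℂ) (α β : Fin 3 → ℂ) (n : ℕ) : ℂ := ∑ c, α c * β c * kap k c * chi c n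

/-- Since `A` has no constant term, the equation `D R = A R` expresses `n R_n` through the
coefficients below `n`. The constant term thus determines `R`. -/
lemma eq_of_euler {A R R' : PowerSeries Op} (hA : PowerSeries.coeff 0 A = 0)
    (h0 : PowerSeries.coeff 0 R = PowerSeries.coeff 0 R') (h : euler R = A * R)
    (h' : euler R' = A * R') : R = R' := by
  ext1 n
  induction n using Nat.strong_induction_on with
  | _ n ih =>
    rcases Nat.eq_zero_or_pos n with rfl | hn
    · exact h0
    · have h2 : (n : ℂ) ≠ 0 := by exact_mod_cast hn.ne'
      refine smul_right_injective _ h2 ?_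
      have h1 := congrArg (PowerSeries.coeff n) h
      have h1' := congrArg (PowerSeries.coeff n) h'
      rw [euler, PowerSeries.coeff_mk, PowerSeries.coeff_mul] at h1 h1'
      simp only [h1, h1']
      refine Finset.sum_congr rfl fun p hp => ?_
      have hp := Finset.HasAntidiagonal.mem_antidiagonal.mp hp
      rcases Nat.eq_zero_or_pos p.1 with h0 | h0
      · rw [h0, hA, zero_mul, zero_mul]
      · rw [ih p.2 (by omega)]

/-- For the generating series in `s`, both sides solve the same Euler equation with the same
constant term. This replaces the Baker-Campbell-Hausdorff argument for moving the annihilation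
exponential past a vertex operator. -/
theorem expAnn_mul_vertex (k : ℂ) (α β : Fin 3 → ℂ) (s : ℕ) (b : ℂ) :
    expAnn k α s * vertex k β b = ∑ p ∈ Finset.HasAntidiagonal.antidiagonal s,
      exch (pairing k α β) p.1 • (vertex k β (b - p.1) * expAnn k α p.2) := by
  let f := exch (pairing k α β)
  let E : PowerSeries Op := PowerSeries.mk fun s => expAnn k α s
  let A : PowerSeries Op := PowerSeries.mk fun n => if n = 0 then 0 else (-1 : ℂ) • ∑ i, α i • mode k i n
  let W : PowerSeries Op := PowerSeries.mk fun t => f t • vertex k β (b - t)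
  have hE : euler E = A * E := by
    ext1 n
    simp only [euler, E, A, PowerSeries.coeff_mk, PowerSeries.coeff_mul]
    rw [expAnn_recursion, Finset.smul_sum]
    refine Finset.sum_congr rfl fun p _ => ?_
    split_ifs with h
    · simp
    · rw [smul_mul_assoc, Finset.sum_mul]
      simp only [smul_mul_assoc]
  have hr : ∀ n : ℕ, (n : ℂ) * f n = (-1) * ∑ p ∈ Finset.HasAntidiagonal.antidiagonal n,
      if p.1 = 0 then 0 else pairing k α β p.1 * f p.2 := fun n => by
    rw [exch_recursion, neg_one_mul]
  -- The modes in `A` act on the vertex operator by the charges collected in `pairing`. The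
  -- recursion for `exch` is what makes the commutator of `A` with `W` equal to the Euler derivative
  -- of `W`.
  have hW : A * W = W * A + euler W := by
    ext1 n
    simp only [map_add, PowerSeries.coeff_mul, W, A, euler, PowerSeries.coeff_mk, smul_smul]
    rw [← Finset.Nat.sum_antidiagonal_swap (f := fun x : ℕ × ℕ => f x.1 • vertex k β (b - x.1) *
      if x.2 = 0 then 0 else (-1 : ℂ) • ∑ i, α i • mode k i x.2), hr,
      mul_smul, Finset.sum_smul, Finset.smul_sum, ← Finset.sum_add_distrib]
    refine Finset.sum_congr rfl fun p hp => ?_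
    have hp := Finset.HasAntidiagonal.mem_antidiagonal.mp hp
    simp only [Prod.fst_swap, Prod.snd_swap]
    split_ifs with h
    · simp
    · simp only [smul_mul_assoc, mul_smul_comm, Finset.sum_mul, Finset.mul_sum, pairing,
        Finset.sum_smul]
      rw [← smul_add, smul_comm (f p.2)]
      refine congrArg _ ?_
      rw [Finset.smul_sum, ← Finset.sum_add_distrib]
      refine Finset.sum_congr rfl fun i _ => ?_
      have h1 : b - (p.2 : ℂ) - ((p.1 : ℤ) : ℂ) = b - n := by rw [← hp]; push_cast; ring
      rw [mul_eq_add_cm (mode k i p.1) (vertex k β (b - p.2)), cm_mode_vertex, h1, smul_add, smul_add,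
        smul_comm (f p.2)]
      congr 1
      rw [smul_smul, smul_smul]
      congr 1
      ring
  have key : E * PowerSeries.C (vertex k β b) = W * E := by
    refine eq_of_euler (A := A) ?_ ?_ ?_ ?_
    · simp [A]
    · simp [E, W, f, exch, expAnn_zero]
    · have e2 : euler (PowerSeries.C (vertex k β b)) = 0 := by
        ext1 n
        simp only [euler, PowerSeries.coeff_mk, PowerSeries.coeff_C]
        split_ifs with h <;> simp [h]
      rw [euler_mul, e2, hE, mul_zero, add_zero, mul_assoc]
    · rw [euler_mul, hE, ← mul_assoc A W, hW, add_mul, mul_assoc W A, add_comm]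
  have := congrArg (PowerSeries.coeff s) key
  rw [PowerSeries.coeff_mul_C, PowerSeries.coeff_mul] at this
  simp only [E, W, PowerSeries.coeff_mk] at this
  rw [this]
  simp only [smul_mul_assoc]
  rfl

/-! ### Reduction of matrix elements to vacuum expectation values -/

lemma kap_ne_zero {k : ℂ} (hk0 : k ≠ 0) (hk2 : k ≠ -2) (i : Fin 3) : kap k i ≠ 0 := by
  have hk' : k + 2 ≠ 0 := fun h => hk2 (eq_neg_of_add_eq_zero_left h)
  fin_cases i <;> simp [kap, hk0, hk']

lemma coord_mode_pos (k : ℂ) (o : Osc) (j : ℂ) (d : Osc →₀ ℕ) (v : FockSum) :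
    coord j d (mode k o.1.1 o.1.2 v) =
      kap k o.1.1 * o.1.2 * (d o + 1) * coord j (d + Finsupp.single o 1) v := by
  have h : (0 : ℤ) < o.1.2 := by exact_mod_cast o.2.1
  rw [coord_apply, coord_apply, mode_apply, modeP, if_neg h.not_gt, if_pos h, annih]
  simp only [Int.natAbs_natCast]
  rw [dif_pos o.2, LinearMap.smul_apply, Derivation.coeFn_coe, MvPolynomial.coeff_smul,
    MvPolynomial.coeff_pderiv]
  simp only [smul_eq_mul]
  push_cast
  ring

open Classical in
lemma coord_mode_neg_osc (k : ℂ) (o : Osc) (j : ℂ) (d : Osc →₀ ℕ) (v : FockSum) :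
    coord j d (mode k o.1.1 (-(o.1.2 : ℤ)) v) =
      if o ∈ d.support then coord j (d - Finsupp.single o 1) v else 0 := by
  have h : -(o.1.2 : ℤ) < 0 := by have := o.2.1; omega
  rw [coord_apply, coord_apply, mode_apply, modeP, if_pos h, create]
  simp only [Int.natAbs_neg, Int.natAbs_natCast]
  rw [dif_pos o.2, LinearMap.mulLeft_apply, MvPolynomial.coeff_X_mul']

lemma mode_neg_single (k : ℂ) (o : Osc) (j : ℂ) (p : MvPolynomial Osc ℂ) :
    mode k o.1.1 (-(o.1.2 : ℤ)) (Finsupp.single j p) =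
      Finsupp.single j (p * MvPolynomial.X o) := by
  classical
  have h : -(o.1.2 : ℤ) < 0 := by have := o.2.1; omega
  refine Finsupp.ext fun j' => ?_
  rw [mode_apply, modeP, if_pos h, create]
  simp only [Int.natAbs_neg, Int.natAbs_natCast]
  rw [dif_pos o.2, LinearMap.mulLeft_apply, Finsupp.single_apply, Finsupp.single_apply]
  split_ifs
  · exact mul_comm _ _
  · simp

/-- A coordinate is read off with annihilation operators and a vector is built with creation
operators. Moving either kind through `Y` costs commutators, which stay in `S`, until only vacua
remain. Families over `ι` serve two purposes: `N = 0` gives uniqueness, and `N` a space of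
coefficient families of series transports analyticity from vacuum expectation values to all matrix
elements. -/
theorem reduction {ι : Type*} {k : ℂ} (hk0 : k ≠ 0) (hk2 : k ≠ -2) {S : Submodule ℂ (ι → Op)}
    {N : Submodule ℂ (ι → ℂ)}
    (hS : ∀ Y ∈ S, ∀ i (n : ℤ), n ≠ 0 → (fun a => cm (mode k i n) (Y a)) ∈ S) {j j' : ℂ}
    (h0 : ∀ Y ∈ S, (fun a => coord j' 0 (Y a (vac j))) ∈ N) :
    ∀ Y ∈ S, ∀ d, ∀ v ∈ fock j, (fun a => coord j' d (Y a v)) ∈ N := by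
  classical
  have hB : ∀ (M : ℕ) (d : Osc →₀ ℕ), d.degree = M → ∀ Y ∈ S,
      (fun a => coord j' d (Y a (vac j))) ∈ N := by
    intro M
    induction M with
    | zero =>
      intro d hd Y hY
      rw [Finsupp.degree_eq_zero_iff] at hd
      subst hd
      exact h0 Y hY
    | succ M ih =>
      intro d hd Y hY
      have hd0 : d ≠ 0 := by rintro rfl; simp at hd
      obtain ⟨o, ho⟩ := Finsupp.ne_iff.mp hd0
      obtain ⟨d', rfl⟩ : ∃ d', d = d' + Finsupp.single o 1 := by
        refine ⟨d - Finsupp.single o 1, (tsub_add_cancel_of_le ?_).symm⟩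
        rw [Finsupp.single_le_iff]
        exact Nat.one_le_iff_ne_zero.mpr ho
      have hd' : d'.degree = M := by
        simp only [map_add, Finsupp.degree_single] at hd
        omega
      have h1 := ih d' hd' _ (hS Y hY o.1.1 o.1.2 (by have := o.2.1; omega))
      -- The annihilation operator kills the vacuum, so its commutator with `Y` is just its action
      -- on `Y |j,k⟩`. This raises the coordinate by one oscillator, with a factor that is nonzero
      -- because `κ_i ≠ 0`.
      have h2 : ∀ a, coord j' d' (cm (mode k o.1.1 o.1.2) (Y a) (vac j)) =
          kap k o.1.1 * o.1.2 * (d' o + 1) * coord j' (d' + Finsupp.single o 1) (Y a (vac j)) := by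
        intro a
        rw [cm_apply, mode_vac k _ (by have := o.2.1; omega), map_zero, sub_zero, coord_mode_pos]
      simp only [h2] at h1
      have h3 : kap k o.1.1 * o.1.2 * (d' o + 1) ≠ 0 := by
        refine mul_ne_zero (mul_ne_zero (kap_ne_zero hk0 hk2 _) ?_) ?_
        · exact_mod_cast o.2.1.ne'
        · exact_mod_cast Nat.succ_ne_zero (d' o)
      have h4 := N.smul_mem (kap k o.1.1 * o.1.2 * (d' o + 1))⁻¹ h1
      convert h4 using 1
      funext a
      simp only [Pi.smul_apply, smul_eq_mul]
      rw [inv_mul_cancel_left₀ h3]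
  intro Y hY d v hv
  obtain ⟨p, rfl⟩ := mem_fock_iff.mp hv
  clear hv
  revert Y d
  induction p using MvPolynomial.induction_on with
  | C c =>
    intro Y hY d
    have : Finsupp.single j (MvPolynomial.C c) = c • vac j := by
      rw [vac, Finsupp.smul_single, MvPolynomial.smul_eq_C_mul, mul_one]
    simp only [this, map_smul]
    exact N.smul_mem c (hB _ d rfl Y hY)
  | add p q hp hq =>
    intro Y hY d
    simp only [Finsupp.single_add, map_add]
    exact N.add_mem (hp Y hY d) (hq Y hY d)
  | mul_X p o ih =>
    intro Y hY d
    -- The creation operator is moved to the left of `Y`, where it removes an oscillator from the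
    -- coordinate `d`. Both remaining terms involve the smaller polynomial `p`.
    have h1 : ∀ a, coord j' d (Y a (Finsupp.single j (p * MvPolynomial.X o))) =
        (if o ∈ d.support then coord j' (d - Finsupp.single o 1) (Y a (Finsupp.single j p)) else 0)
        - coord j' d (cm (mode k o.1.1 (-(o.1.2 : ℤ))) (Y a) (Finsupp.single j p)) := by
      intro a
      rw [cm_apply, mode_neg_single, map_sub, coord_mode_neg_osc, sub_sub_cancel]
    simp only [h1]
    refine N.sub_mem ?_ (ih _ (hS Y hY o.1.1 _ (by have := o.2.1; omega)) d)
    split_ifs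
    · exact ih Y hY _
    · exact N.zero_mem

/-- This is `reduction` for a one-point index set and `N = 0`. The span of the whole family takes
the place of `S`, because commutators mix its members. -/
theorem family_eq_zero {κ : Type*} {k : ℂ} (hk0 : k ≠ 0) (hk2 : k ≠ -2) {Y : κ → Op} {s : ℂ}
    (hs : ∀ x, Y x ∈ shiftOps s)
    (hcm : ∀ x i (n : ℤ), n ≠ 0 → cm (mode k i n) (Y x) ∈ Submodule.span ℂ (range Y))
    (h0 : ∀ x j, coord (j + s) 0 (Y x (vac j)) = 0) (x : κ) : Y x = 0 := by
  have main : ∀ j d, ∀ v ∈ fock j, coord (j + s) d (Y x v) = 0 := by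
    intro j d v hv
    have := reduction hk0 hk2 (ι := Unit) (j := j) (j' := j + s)
      (S := (Submodule.span ℂ (range Y)).comap (LinearMap.proj ())) (N := ⊥)
      (fun Z hZ i n hn => ?_) (fun Z hZ => ?_) (fun _ => Y x)
      (Submodule.subset_span ⟨x, rfl⟩) d v hv
    · exact congrFun ((Submodule.mem_bot ℂ).mp this) ()
    · rw [Submodule.mem_comap] at hZ ⊢
      simp only [LinearMap.proj_apply] at hZ ⊢
      refine Submodule.span_induction ?_ ?_ ?_ ?_ hZ
      · rintro _ ⟨y, rfl⟩; exact hcm y i n hn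
      · rw [cm_zero]; exact Submodule.zero_mem _
      · intro A B _ _ hA hB; rw [cm_add]; exact Submodule.add_mem _ hA hB
      · intro c A _ hA; rw [cm_smul]; exact Submodule.smul_mem _ c hA
    · rw [Submodule.mem_comap] at hZ
      simp only [LinearMap.proj_apply] at hZ
      rw [Submodule.mem_bot]
      funext u
      refine Submodule.span_induction (p := fun A _ => coord (j + s) 0 (A (vac j)) = 0)
        ?_ ?_ ?_ ?_ hZ
      · rintro _ ⟨y, rfl⟩; exact h0 y j
      · simp
      · intro A B _ _ hA hB; rw [LinearMap.add_apply, map_add, hA, hB, add_zero]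
      · intro c A _ hA; rw [LinearMap.smul_apply, map_smul, hA, smul_zero]
  refine LinearMap.ext fun v => ?_
  induction v using Finsupp.induction_linear with
  | zero => simp
  | add v w hv hw => rw [map_add, hv, hw]; simp
  | single j p =>
    have hv : Finsupp.single j p ∈ fock j := ⟨p, rfl⟩
    refine Finsupp.ext fun j' => ?_
    by_cases h : j' = j + s
    · subst h
      ext d
      exact main j d _ hv
    · exact mem_fock_iff_apply.mp (hs x j _ hv) j' h

/-! ### Vacuum expectation values of vertex operators -/

lemma exch_zero (s : ℕ) : exch 0 s = if s = 0 then 1 else 0 := by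
  cases s with
  | zero => simp [exch]
  | succ s => simp [exch]

open Classical in
lemma coord_vertex_vac (k : ℂ) (α : Fin 3 → ℂ) (a j : ℂ) :
    coord (j + 2 * (k + 2) * α 1) 0 (vertex k α a (vac j)) = if a = α 1 * (2 * j) then 1 else 0 := by
  rw [coord_vertex k α a j (vac_mem j), finsum_eq_single _ 0]
  · simp only [Nat.cast_zero, add_zero, expAnn_zero]
    simp [coord, vac]
  · intro s hs
    rw [expAnn_vac k α (Nat.pos_of_ne_zero hs), map_zero, ite_self]

-- When the pairing vanishes, the annihilation part of the left factor passes through the right one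
-- and kills the vacuum. Only the zero modes contribute, and each fixes one exponent.
open Classical in
lemma coord_vertex_vertex_vac (k : ℂ) {α β : Fin 3 → ℂ} (h : pairing k α β = 0) (a b j : ℂ) :
    coord (j + 2 * (k + 2) * β 1 + 2 * (k + 2) * α 1) 0 (vertex k α a (vertex k β b (vac j))) =
      if a = α 1 * (2 * (j + 2 * (k + 2) * β 1)) ∧ b = β 1 * (2 * j) then 1 else 0 := by
  rw [coord_vertex k α a _ (vertex_mem_shiftOps k β b j _ (vac_mem j)), finsum_eq_single _ 0]
  · simp only [Nat.cast_zero, add_zero, expAnn_zero, Module.End.one_apply, coord_vertex_vac]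
    split_ifs <;> simp_all
  · intro s hs
    rw [← Module.End.mul_apply, expAnn_mul_vertex, h, LinearMap.sum_apply, Finset.sum_eq_zero]
    · simp
    · intro p hp
      have hp := Finset.HasAntidiagonal.mem_antidiagonal.mp hp
      rw [exch_zero]
      split_ifs with h0
      · rw [LinearMap.smul_apply, Module.End.mul_apply, expAnn_vac k α (by omega), map_zero,
          smul_zero]
      · simp

/-! ### The currents and the screening current -/

/-- The exponents of the vertex operator in `x(ζ)`. -/
abbrev xExp (k : ℂ) : Fin 3 → ℂ := ![1 / k, 0, 1 / k]

/-- The exponents of the vertex operator in `S(ζ)`. -/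
abbrev sExp (k : ℂ) : Fin 3 → ℂ := ![0, -1 / (k + 2), 0]

/-- The exponents of the vertex operators in the potentials of `[x(ζ), S(ξ)]`. -/
abbrev wExp (k ε : ℂ) : Fin 3 → ℂ := ![ε / k, -1 / (k + 2), ε / k]

/-- The operators `x_n` with the sign of the index reversed. -/
def xOp (k : ℂ) (a : ℤ) : Op := xField k a

/-- The coefficients of `:exp (φ_2(ζ)/k + φ_0(ζ)/k):`. -/
def vOp (k : ℂ) (a : ℤ) : Op := vertex k (xExp k) a

/-- The coefficients of `ζ^{2/(k+2)} :exp (-φ_1(ζ)/(k+2)):`. -/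
def uOp (k b : ℂ) : Op := vertex k (sExp k) (b - 2 / (k + 2))

lemma screening_eq (k b : ℂ) :
    screening k b = (1 / 2 : ℂ) • vertexInsert k 2 (sExp k) (b - 2 / (k + 2)) := rfl

lemma potential_eq (k ε b : ℂ) : potential k ε b = vertex k (wExp k ε) (b - 2 / (k + 2)) := rfl

lemma xOp_eq (k : ℂ) (a : ℤ) : xOp k a =
    (1 / 2 : ℂ) • (vertexInsert k 1 (xExp k) a + vertexInsert k 2 (xExp k) a) := rfl

lemma shift_sExp {k : ℂ} (hk2 : k ≠ -2) : 2 * (k + 2) * (-1 / (k + 2)) = -2 := by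
  have hk' : k + 2 ≠ 0 := fun h => hk2 (eq_neg_of_add_eq_zero_left h)
  field_simp

lemma screening_mem {k : ℂ} (hk2 : k ≠ -2) (b : ℂ) : screening k b ∈ shiftOps (-2) := by
  rw [screening_eq]
  refine Submodule.smul_mem _ _ ?_
  have := vertexInsert_mem_shiftOps k 2 (sExp k) (b - 2 / (k + 2))
  rwa [show sExp k 1 = -1 / (k + 2) from rfl, shift_sExp hk2] at this

lemma uOp_mem {k : ℂ} (hk2 : k ≠ -2) (b : ℂ) : uOp k b ∈ shiftOps (-2) := by
  have := vertex_mem_shiftOps k (sExp k) (b - 2 / (k + 2))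
  rwa [show sExp k 1 = -1 / (k + 2) from rfl, shift_sExp hk2] at this

lemma potential_mem {k : ℂ} (hk2 : k ≠ -2) (ε b : ℂ) : potential k ε b ∈ shiftOps (-2) := by
  have := vertex_mem_shiftOps k (wExp k ε) (b - 2 / (k + 2))
  rwa [show wExp k ε 1 = -1 / (k + 2) from rfl, shift_sExp hk2] at this

lemma vOp_mem (k : ℂ) (a : ℤ) : vOp k a ∈ shiftOps 0 := by
  have := vertex_mem_shiftOps k (xExp k) a
  rwa [show xExp k 1 = 0 from rfl, mul_zero] at this

lemma xOp_mem (k : ℂ) (a : ℤ) : xOp k a ∈ shiftOps 0 := by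
  have h := fun i => vertexInsert_mem_shiftOps k i (xExp k) a
  simp only [show xExp k 1 = 0 from rfl, mul_zero] at h
  rw [xOp_eq]
  exact Submodule.smul_mem _ _ (Submodule.add_mem _ (h 1) (h 2))

/-! Commutators with the modes. -/

/-- The charges of `x(ζ)`. -/
def xCh : Fin 3 → ℂ := ![4, 0, -4]

/-- The charges of the potentials. -/
def wCh (ε : ℂ) : Fin 3 → ℂ := ![4 * ε, -4, -4 * ε]

lemma xExp_kap {k : ℂ} (hk0 : k ≠ 0) (i : Fin 3) : xExp k i * kap k i = xCh i := by
  fin_cases i <;> simp [xExp, kap, xCh] <;> field_simp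

lemma wExp_kap {k : ℂ} (hk0 : k ≠ 0) (hk2 : k ≠ -2) (ε : ℂ) (i : Fin 3) :
    wExp k ε i * kap k i = wCh ε i := by
  have hk' : k + 2 ≠ 0 := fun h => hk2 (eq_neg_of_add_eq_zero_left h)
  fin_cases i <;> simp [wExp, kap, wCh] <;> field_simp

lemma wExp_zero (k : ℂ) : wExp k 0 = sExp k := by simp [wExp, sExp]

section
variable {k : ℂ} (hk0 : k ≠ 0) (hk2 : k ≠ -2)

lemma cm_mode_vOp (hk0 : k ≠ 0) (i : Fin 3) (n a : ℤ) :
    cm (mode k i n) (vOp k a) = (xCh i * chi i n) • vOp k (a - n) := by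
  rw [vOp, cm_mode_vertex, xExp_kap hk0, vOp, Int.cast_sub]

lemma cm_mode_uOp (hk0 : k ≠ 0) (hk2 : k ≠ -2) (i : Fin 3) (n : ℤ) (b : ℂ) :
    cm (mode k i n) (uOp k b) = (wCh 0 i * chi i n) • uOp k (b - n) := by
  rw [uOp, ← wExp_zero, cm_mode_vertex, wExp_kap hk0 hk2, uOp, wExp_zero, sub_right_comm]

lemma cm_mode_potential (hk0 : k ≠ 0) (hk2 : k ≠ -2) (ε : ℂ) (i : Fin 3) (n : ℤ) (b : ℂ) :
    cm (mode k i n) (potential k ε b) = (wCh ε i * chi i n) • potential k ε (b - n) := by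
  rw [potential_eq, cm_mode_vertex, wExp_kap hk0 hk2, potential_eq, sub_right_comm]

lemma cm_mode_screening (hk0 : k ≠ 0) (hk2 : k ≠ -2) (i : Fin 3) (n : ℤ) (b : ℂ) :
    cm (mode k i n) (screening k b) = (wCh 0 i * chi i n) • screening k (b - n)
      + (if i = 2 then -2 * k * n * chi i n else 0) • uOp k (b - n) := by
  rw [screening_eq, cm_smul, ← wExp_zero, cm_mode_vertexInsert, wExp_kap hk0 hk2, screening_eq, uOp,
    wExp_zero, sub_right_comm b _ (2 / (k + 2)), smul_add, smul_comm (1 / 2 : ℂ), smul_smul (1 / 2 : ℂ)]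
  congr 2
  split_ifs with h
  · subst h; simp [kap]; ring
  · simp

lemma cm_mode_xOp (hk0 : k ≠ 0) (i : Fin 3) (n a : ℤ) :
    cm (mode k i n) (xOp k a) = (xCh i * chi i n) • xOp k (a - n)
      + (![0, 2 * (k + 2), -2 * k] i * n * chi i n) • vOp k (a - n) := by
  rw [xOp_eq, cm_smul, cm_add, cm_mode_vertexInsert, cm_mode_vertexInsert, xExp_kap hk0, xOp_eq, vOp,
    Int.cast_sub]
  fin_cases i <;> simp [kap, xCh] <;> module

/-! ### Vacuum two-point functions of the exponentials -/

open Classical in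
/-- The vacuum expectation values of `ζ^{2/(k+2)} :exp (-φ_1(ζ)/(k+2)):`. -/
def uVac (k j c : ℂ) : ℂ := if c = (-2 * j + 2) / (k + 2) then 1 else 0

lemma coord_potential (hk2 : k ≠ -2) (j ε b : ℂ) :
    coord (j + -2) 0 (potential k ε b (vac j)) = uVac k j b := by
  have := coord_vertex_vac k (wExp k ε) (b - 2 / (k + 2)) j
  rw [show wExp k ε 1 = -1 / (k + 2) from rfl, shift_sExp hk2] at this
  rw [potential_eq, this, uVac]
  have hk' : k + 2 ≠ 0 := fun h => hk2 (eq_neg_of_add_eq_zero_left h)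
  congr 1
  rw [eq_iff_iff, sub_eq_iff_eq_add]
  constructor <;> intro h <;> rw [h] <;> field_simp

/-- The exponent of `x` lives on `φ_0` and `φ_2`, that of `S` on `φ_1`, so the two exponentials do
not contract. -/
lemma pairing_xs : pairing k (xExp k) (sExp k) = 0 := by
  funext n; simp [pairing, Fin.sum_univ_three]

lemma pairing_sx : pairing k (sExp k) (xExp k) = 0 := by
  funext n; simp [pairing, Fin.sum_univ_three]

open Classical in
lemma coord_vOp_uOp (hk2 : k ≠ -2) (j b : ℂ) (a : ℤ) :
    coord (j + -2) 0 (vOp k a (uOp k b (vac j))) = if a = 0 then uVac k j b else 0 := by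
  have := coord_vertex_vertex_vac k (pairing_xs (k := k)) a (b - 2 / (k + 2)) j
  rw [show xExp k 1 = 0 from rfl, show sExp k 1 = -1 / (k + 2) from rfl, shift_sExp hk2] at this
  rw [mul_zero, add_zero, zero_mul] at this
  rw [vOp, uOp, this, uVac]
  have hk' : k + 2 ≠ 0 := fun h => hk2 (eq_neg_of_add_eq_zero_left h)
  have h : b - 2 / (k + 2) = -1 / (k + 2) * (2 * j) ↔ b = (-2 * j + 2) / (k + 2) := by
    rw [sub_eq_iff_eq_add]
    constructor <;> intro h <;> rw [h] <;> field_simp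
  simp only [h, Int.cast_eq_zero]
  split_ifs <;> simp_all

open Classical in
lemma coord_uOp_vOp (hk2 : k ≠ -2) (j b : ℂ) (a : ℤ) :
    coord (j + -2) 0 (uOp k b (vOp k a (vac j))) = if a = 0 then uVac k j b else 0 := by
  have := coord_vertex_vertex_vac k (pairing_sx (k := k)) (b - 2 / (k + 2)) a j
  rw [show xExp k 1 = 0 from rfl, show sExp k 1 = -1 / (k + 2) from rfl, mul_zero, add_zero,
    shift_sExp hk2, zero_mul] at this
  rw [vOp, uOp, this, uVac]
  have hk' : k + 2 ≠ 0 := fun h => hk2 (eq_neg_of_add_eq_zero_left h)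
  have h : b - 2 / (k + 2) = -1 / (k + 2) * (2 * j) ↔ b = (-2 * j + 2) / (k + 2) := by
    rw [sub_eq_iff_eq_add]
    constructor <;> intro h <;> rw [h] <;> field_simp
  simp only [h, Int.cast_eq_zero]
  split_ifs <;> simp_all

lemma cm_cm {R : Type*} [Ring R] (A B C : R) : cm A (cm B C) = cm (cm A B) C + cm B (cm A C) := by
  simp only [cm, mul_sub, sub_mul, mul_assoc]; abel

lemma add_cm {R : Type*} [Ring R] (A B C : R) : cm (A + B) C = cm A C + cm B C := by
  simp only [cm, mul_add, add_mul]; abel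

lemma cm_mem_shiftOps {s : ℂ} {T U : Op} (hT : T ∈ shiftOps 0) (hU : U ∈ shiftOps s) :
    cm T U ∈ shiftOps s := by
  have h : cm T U = T * U + (-1 : ℂ) • (U * T) := by
    refine LinearMap.ext fun v => ?_
    simp [cm_apply, sub_eq_add_neg]
  rw [h]
  exact Submodule.add_mem _ (mul_mem_shiftOps_zero hT hU)
    (Submodule.smul_mem _ _ (by simpa using mul_mem_shiftOps hU hT))

/-- This is the bottom of the hierarchy of commutators. There are no insertions, so modes only
multiply by charges, and both orderings have the same vacuum expectation values. -/
theorem cm_vOp_uOp (hk0 : k ≠ 0) (hk2 : k ≠ -2) (a : ℤ) (b : ℂ) : cm (vOp k a) (uOp k b) = 0 := by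
  refine family_eq_zero hk0 hk2 (Y := fun x : ℤ × ℂ => cm (vOp k x.1) (uOp k x.2)) (s := -2)
    (fun x => cm_mem_shiftOps (vOp_mem k _) (uOp_mem hk2 _)) ?_ ?_ (a, b)
  · rintro ⟨a, b⟩ i n -
    rw [cm_cm, cm_mode_vOp hk0, cm_mode_uOp hk0 hk2, smul_cm, cm_smul]
    exact Submodule.add_mem _ (Submodule.smul_mem _ _ (Submodule.subset_span ⟨(a - n, b), rfl⟩))
      (Submodule.smul_mem _ _ (Submodule.subset_span ⟨(a, b - n), rfl⟩))
  · rintro ⟨a, b⟩ j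
    rw [cm_apply, map_sub, coord_vOp_uOp hk2, coord_uOp_vOp hk2, sub_self]

end

section
variable {k : ℂ}

/-! ### Signs and parities -/

/-- The sign `(-1)^a`. -/
def sg (a : ℤ) : ℂ := (-1) ^ a

lemma sg_even {a : ℤ} (h : Even a) : sg a = 1 := h.neg_one_zpow

lemma sg_odd {a : ℤ} (h : Odd a) : sg a = -1 := h.neg_one_zpow

lemma sg_sub (a n : ℤ) : sg (a - n) = sg a * sg n := by
  rcases Int.even_or_odd a with ha | ha <;> rcases Int.even_or_odd n with hn | hn
  · rw [sg_even ha, sg_even hn, sg_even (ha.sub hn), mul_one]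
  · rw [sg_even ha, sg_odd hn, sg_odd (ha.sub_odd hn), one_mul]
  · rw [sg_odd ha, sg_even hn, sg_odd (ha.sub_even hn), mul_one]
  · rw [sg_odd ha, sg_odd hn, sg_even (ha.sub_odd hn)]; norm_num

lemma chi_one {n : ℤ} : chi 1 n = (1 + sg n) / 2 := by
  rcases Int.even_or_odd n with h | h
  · rw [sg_even h]; simp [chi, h]
  · rw [sg_odd h]; simp [chi, Int.not_even_iff_odd.mpr h]

lemma chi_of_ne {i : Fin 3} (hi : i ≠ 1) {n : ℤ} : chi i n = (1 - sg n) / 2 := by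
  rcases Int.even_or_odd n with h | h
  · rw [sg_even h]; simp [chi, h, hi]
  · rw [sg_odd h]; simp [chi, Int.not_even_iff_odd.mpr h, hi]

/-! ### Vacuum expectation values of the commutators -/

lemma coord_cm_vac (i : Fin 3) {n : ℤ} (hn : n < 0) (T : Op) (j : ℂ) (v : FockSum) :
    coord j 0 (T (mode k i n v)) = -coord j 0 (cm (mode k i n) T v) := by
  rw [cm_apply, map_sub, coord_mode_neg k i hn, zero_sub, neg_neg]

lemma mode_vac_cm (i : Fin 3) {n : ℤ} (hn : 0 < n) (T : Op) (j : ℂ) :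
    mode k i n (T (vac j)) = cm (mode k i n) T (vac j) := by
  rw [cm_apply, mode_vac k i hn, map_zero, sub_zero]

/-- The contribution of the negative modes to `:Dφ_i V:` on the vacuum. -/
lemma map_vertexInsert_vac (ℓ : FockSum →ₗ[ℂ] ℂ) (i : Fin 3) (α : Fin 3 → ℂ) (a j : ℂ) :
    ℓ (vertexInsert k i α a (vac j)) = ∑ᶠ n : ℤ, if n < 0 then
      ℓ (mode k i n (vertex k α (a + n) (vac j)))
      else if n = 0 ∧ i = 1 then 2 * j * ℓ (vertex k α a (vac j)) else 0 := by
  rw [vertexInsert_apply, map_finsum _ (insertTerm_locFin k i α a _)]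
  refine finsum_congr fun n => ?_
  unfold insertTerm
  split_ifs with h1 h2
  · rfl
  · obtain ⟨rfl, rfl⟩ := h2
    rw [Module.End.mul_apply, mode_zero_vac, map_smul, map_smul]
    simp
  · rw [Module.End.mul_apply]
    rcases eq_or_lt_of_le (not_lt.mp h1) with h | h
    · rw [← h, mode_zero_of_ne k fun h' => h2 ⟨h.symm, h'⟩]
      simp
    · rw [mode_vac k i h, map_zero, map_zero]

lemma coord_vertexInsert (i : Fin 3) (α : Fin 3 → ℂ) (a j : ℂ) (v : FockSum) :
    coord j 0 (vertexInsert k i α a v) = ∑ᶠ n : ℤ, if n < 0 then 0 else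
      coord j 0 (vertex k α (a + n) (mode k i n v)) := by
  rw [vertexInsert_apply, map_finsum _ (insertTerm_locFin k i α a _)]
  refine finsum_congr fun n => ?_
  unfold insertTerm
  split_ifs with h1
  · rw [Module.End.mul_apply, coord_mode_neg k i h1]
  · rfl

lemma add_sub_shift (b c : ℂ) (n : ℤ) : b - c + n = b + n - c := by ring

lemma uVac_shift (j b : ℂ) (a n : ℤ) (h : a = n) : uVac k j (b + n) = uVac k j (a + b) := by
  rw [h, add_comm]

/-- A negative mode `φ_{2,n}` of the insertion can only contract with `V`, leaving `V_{a-n}` next to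
`U`. That expectation value requires `n = a`, so one mode survives. -/
lemma coord_vOp_screening (hk0 : k ≠ 0) (hk2 : k ≠ -2) (a : ℤ) (b j : ℂ) :
    coord (j + -2) 0 (vOp k a (screening k b (vac j))) =
      if a < 0 then 2 * chi 2 a * uVac k j (a + b) else 0 := by
  have h := map_vertexInsert_vac (k := k) (coord (j + -2) 0 ∘ₗ vOp k a) 2 (sExp k)
    (b - 2 / (k + 2)) j
  simp only [LinearMap.comp_apply] at h
  rw [screening_eq, LinearMap.smul_apply, map_smul, map_smul, h, finsum_eq_single _ a]
  · split_ifs with h1 h2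
    · rw [coord_cm_vac _ h1, cm_mode_vOp hk0, LinearMap.smul_apply, map_smul, add_sub_shift]
      have := coord_vOp_uOp hk2 j (b + a) (a - a)
      rw [uOp] at this
      rw [this, if_pos (sub_self a), uVac_shift j b a a rfl]
      simp [xCh]; ring
    · exact absurd h2.2 (by decide)
    · simp
  · intro n hn
    split_ifs with h1 h2
    · rw [coord_cm_vac _ h1, cm_mode_vOp hk0, LinearMap.smul_apply, map_smul, add_sub_shift]
      have := coord_vOp_uOp hk2 j (b + n) (a - n)
      rw [uOp] at this
      rw [this, if_neg (by omega)]
      simp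
    · exact absurd h2.2 (by decide)
    · rfl

lemma coord_screening_vOp (hk0 : k ≠ 0) (hk2 : k ≠ -2) (a : ℤ) (b j : ℂ) :
    coord (j + -2) 0 (screening k b (vOp k a (vac j))) =
      if 0 < a then -2 * chi 2 a * uVac k j (a + b) else 0 := by
  rw [screening_eq, LinearMap.smul_apply, map_smul, coord_vertexInsert, finsum_eq_single _ a]
  · rcases lt_trichotomy a 0 with h1 | rfl | h1
    · rw [if_pos h1, if_neg h1.not_gt, smul_zero]
    · rw [mode_zero_of_ne k (by decide)]
      simp
    · rw [if_neg h1.not_gt, if_pos h1, mode_vac_cm _ h1, cm_mode_vOp hk0, LinearMap.smul_apply,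
        map_smul, map_smul, add_sub_shift]
      have := coord_uOp_vOp hk2 j (b + a) (a - a)
      rw [uOp] at this
      rw [this, if_pos (sub_self a), uVac_shift j b a a rfl]
      simp [xCh]; ring
  · intro n hn
    split_ifs with h1
    · rfl
    · rcases eq_or_lt_of_le (not_lt.mp h1) with h | h
      · rw [← h, mode_zero_of_ne k (by decide)]
        simp
      · rw [mode_vac_cm _ h, cm_mode_vOp hk0, LinearMap.smul_apply, map_smul, map_smul, add_sub_shift]
        have := coord_uOp_vOp hk2 j (b + n) (a - n)
        rw [uOp] at this
        rw [this, if_neg (by omega)]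
        simp

/-- The part `Dφ_2` of `x` does not contract with `U`. The part `Dφ_1` does, and its zero mode sees
`j - 2` because `U` has already acted. -/
lemma coord_xOp_uOp (hk0 : k ≠ 0) (hk2 : k ≠ -2) (a : ℤ) (b j : ℂ) :
    coord (j + -2) 0 (xOp k a (uOp k b (vac j))) =
      (if a < 0 then -2 * chi 1 a else if a = 0 then j - 2 else 0) * uVac k j (a + b) := by
  have h2 : coord (j + -2) 0 (vertexInsert k 2 (xExp k) a (uOp k b (vac j))) = 0 := by
    rw [coord_vertexInsert]
    refine finsum_eq_zero_of_forall_eq_zero fun n => ?_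
    split_ifs with h1
    · rfl
    · rcases eq_or_lt_of_le (not_lt.mp h1) with h | h
      · rw [← h, mode_zero_of_ne k (by decide)]
        simp
      · rw [mode_vac_cm _ h, cm_mode_uOp hk0 hk2]
        simp [wCh]
  rw [xOp_eq, LinearMap.smul_apply, LinearMap.add_apply, map_smul, map_add, h2, add_zero,
    coord_vertexInsert, finsum_eq_single _ (-a)]
  · rcases lt_trichotomy a 0 with h1 | rfl | h1
    · rw [if_neg (by omega), if_pos h1, mode_vac_cm _ (by omega), cm_mode_uOp hk0 hk2,
        LinearMap.smul_apply, map_smul, map_smul]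
      have := coord_vOp_uOp hk2 j (b - (-a : ℤ)) (a + -a)
      rw [vOp] at this
      push_cast at this ⊢
      rw [this, if_pos (by ring), chi_neg, sub_neg_eq_add, add_comm b]
      simp [wCh]; ring
    · have h3 : mode k 1 0 (uOp k b (vac j)) = (2 * j - 4) • uOp k b (vac j) := by
        have h4 := congrArg (fun T : Op => T (vac j)) (cm_mode_uOp hk0 hk2 1 0 b)
        simp only [cm_apply, mode_zero_vac, map_smul, sub_eq_iff_eq_add] at h4
        rw [h4]
        simp [wCh, chi]
        module
      have := coord_vOp_uOp hk2 j b 0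
      rw [vOp] at this
      simp only [Int.cast_zero] at this
      simp [h3, this]
      ring
    · rw [if_pos (by omega), if_neg (by omega), if_neg (by omega)]
      simp
  · intro n hn
    have h5 : ∀ b', coord (j + -2) 0 (vertex k (xExp k) (a + n) (uOp k b' (vac j))) = 0 := by
      intro b'
      have := coord_vOp_uOp hk2 j b' (a + n)
      rw [vOp] at this
      push_cast at this
      rw [this, if_neg (by omega)]
    split_ifs with h1
    · rfl
    · rcases eq_or_lt_of_le (not_lt.mp h1) with h | h
      · subst h
        have h3 : mode k 1 0 (uOp k b (vac j)) = (2 * j - 4) • uOp k b (vac j) := by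
          have h4 := congrArg (fun T : Op => T (vac j)) (cm_mode_uOp hk0 hk2 1 0 b)
          simp only [cm_apply, mode_zero_vac, map_smul, sub_eq_iff_eq_add] at h4
          rw [h4]
          simp [wCh, chi]
          module
        rw [h3, map_smul, map_smul, h5, smul_zero]
      · rw [mode_vac_cm _ h, cm_mode_uOp hk0 hk2, LinearMap.smul_apply, map_smul, map_smul, h5,
          smul_zero]

lemma coord_uOp_xOp (hk0 : k ≠ 0) (hk2 : k ≠ -2) (a : ℤ) (b j : ℂ) :
    coord (j + -2) 0 (uOp k b (xOp k a (vac j))) =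
      (if 0 < a then 2 * chi 1 a else if a = 0 then j else 0) * uVac k j (a + b) := by
  have e := fun i => map_vertexInsert_vac (k := k) (coord (j + -2) 0 ∘ₗ uOp k b) i (xExp k) a j
  simp only [LinearMap.comp_apply] at e
  have h2 : coord (j + -2) 0 (uOp k b (vertexInsert k 2 (xExp k) a (vac j))) = 0 := by
    rw [e]
    refine finsum_eq_zero_of_forall_eq_zero fun n => ?_
    split_ifs with h1 h2
    · rw [coord_cm_vac _ h1, cm_mode_uOp hk0 hk2]
      simp [wCh]
    · exact absurd h2.2 (by decide)
    · rfl
  rw [xOp_eq, LinearMap.smul_apply, LinearMap.add_apply, map_smul, map_add, map_smul, map_add, h2,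
    add_zero, e, finsum_eq_single _ (-a)]
  · rcases lt_trichotomy a 0 with h1 | rfl | h1
    · rw [if_neg (by omega), if_neg (by omega), if_neg (by omega), if_neg (by omega)]
      simp
    · have := coord_uOp_vOp hk2 j b 0
      rw [vOp] at this
      simp only [Int.cast_zero] at this
      simp [this]
      ring
    · rw [if_pos (by omega), if_pos h1, coord_cm_vac _ (by omega), cm_mode_uOp hk0 hk2,
        LinearMap.smul_apply, map_smul]
      have := coord_uOp_vOp hk2 j (b - (-a : ℤ)) (a + -a)
      rw [vOp] at this
      push_cast at this ⊢
      rw [this, if_pos (by ring), chi_neg, sub_neg_eq_add, add_comm b]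
      simp [wCh]; ring
  · intro n hn
    have h5 : ∀ b', coord (j + -2) 0 (uOp k b' (vertex k (xExp k) (a + n) (vac j))) = 0 := by
      intro b'
      have := coord_uOp_vOp hk2 j b' (a + n)
      rw [vOp] at this
      push_cast at this
      rw [this, if_neg (by omega)]
    split_ifs with h1 h2
    · rw [coord_cm_vac _ h1, cm_mode_uOp hk0 hk2, LinearMap.smul_apply, map_smul, h5, smul_zero,
        neg_zero]
    · obtain ⟨rfl, -⟩ := h2
      have := h5 b
      simp only [Int.cast_zero, add_zero] at this
      rw [this, mul_zero]
    · rfl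

/-! ### The commutators -/

/-- Removing the insertion of `S` leaves `[V,U] = 0`, so only charges matter. The sign in front of
the second potential changes under shifts by odd `n`, which matches its charges under `φ_0` and
`φ_2`, opposite to those of the first. -/
theorem cm_vOp_screening (hk0 : k ≠ 0) (hk2 : k ≠ -2) (a : ℤ) (b : ℂ) :
    cm (vOp k a) (screening k b) + (-1 : ℂ) • potential k 1 (a + b)
      + sg a • potential k (-1) (a + b) = 0 := by
  refine family_eq_zero hk0 hk2 (Y := fun x : ℤ × ℂ => cm (vOp k x.1) (screening k x.2)
    + (-1 : ℂ) • potential k 1 (x.1 + x.2) + sg x.1 • potential k (-1) (x.1 + x.2)) (s := -2)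
    (fun x => ?_) ?_ ?_ (a, b)
  · exact Submodule.add_mem _ (Submodule.add_mem _
      (cm_mem_shiftOps (vOp_mem k _) (screening_mem hk2 _))
      (Submodule.smul_mem _ _ (potential_mem hk2 _ _)))
      (Submodule.smul_mem _ _ (potential_mem hk2 _ _))
  · rintro ⟨a, b⟩ i n -
    let Y := fun x : ℤ × ℂ => cm (vOp k x.1) (screening k x.2)
      + (-1 : ℂ) • potential k 1 (x.1 + x.2) + sg x.1 • potential k (-1) (x.1 + x.2)
    have hs1 : ∀ y, Y y ∈ Submodule.span ℂ (range Y) := fun y => Submodule.subset_span ⟨y, rfl⟩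
    have e1 : ((a - n : ℤ) : ℂ) + b = a + b - n := by push_cast; ring
    have e2 : (a : ℂ) + (b - n) = a + b - n := by ring
    suffices h : cm (mode k i n) (Y (a, b)) = (xCh i * chi i n) • Y (a - n, b) +
        (wCh 0 i * chi i n) • Y (a, b - n) by
      change cm (mode k i n) (Y (a, b)) ∈ _
      rw [h]
      exact Submodule.add_mem _ (Submodule.smul_mem _ _ (hs1 _)) (Submodule.smul_mem _ _ (hs1 _))
    simp only [Y, cm_add, cm_smul, cm_mode_potential hk0 hk2, cm_cm, cm_mode_vOp hk0,
      cm_mode_screening hk0 hk2, smul_cm, cm_vOp_uOp hk0 hk2, e1, e2, sg_sub, smul_zero, add_zero]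
    fin_cases i
    · simp only [xCh, wCh, chi_of_ne (show (0 : Fin 3) ≠ 1 by decide), Fin.zero_eta, Matrix.cons_val_zero]
      rcases Int.even_or_odd n with hn | hn <;> simp only [sg_even, sg_odd, hn] <;> module
    · simp only [xCh, wCh, chi_one, Fin.mk_one, Matrix.cons_val_one, Matrix.cons_val_zero]
      rcases Int.even_or_odd n with hn | hn <;> simp only [sg_even, sg_odd, hn] <;> module
    · simp only [xCh, wCh, chi_of_ne (show (2 : Fin 3) ≠ 1 by decide), Fin.reduceFinMk, Matrix.cons_val]
      rcases Int.even_or_odd n with hn | hn <;> simp only [sg_even, sg_odd, hn] <;> module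
  · rintro ⟨a, b⟩ j
    simp only [LinearMap.add_apply, LinearMap.smul_apply, map_add, map_smul, cm_apply, map_sub,
      coord_vOp_screening hk0 hk2, coord_screening_vOp hk0 hk2, coord_potential hk2, smul_eq_mul,
      chi_of_ne (show (2 : Fin 3) ≠ 1 by decide)]
    rcases lt_trichotomy a 0 with h | rfl | h
    · rw [if_pos h, if_neg (by omega)]; ring
    · simp [sg_even]
    · rw [if_pos h, if_neg (by omega)]; ring

/-- Here too the insertions in `x`, once removed, leave `[V,U] = 0`. The zero mode of `Dφ_1`, whose
value depends on the ordering, gives the value at `a = 0`. -/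
theorem cm_xOp_uOp (hk0 : k ≠ 0) (hk2 : k ≠ -2) (a : ℤ) (b : ℂ) :
    cm (xOp k a) (uOp k b) + potential k 1 (a + b) + sg a • potential k (-1) (a + b) = 0 := by
  refine family_eq_zero hk0 hk2 (Y := fun x : ℤ × ℂ => cm (xOp k x.1) (uOp k x.2)
    + potential k 1 (x.1 + x.2) + sg x.1 • potential k (-1) (x.1 + x.2)) (s := -2)
    (fun x => ?_) ?_ ?_ (a, b)
  · exact Submodule.add_mem _ (Submodule.add_mem _
      (cm_mem_shiftOps (xOp_mem k _) (uOp_mem hk2 _)) (potential_mem hk2 _ _))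
      (Submodule.smul_mem _ _ (potential_mem hk2 _ _))
  · rintro ⟨a, b⟩ i n -
    let Y := fun x : ℤ × ℂ => cm (xOp k x.1) (uOp k x.2)
      + potential k 1 (x.1 + x.2) + sg x.1 • potential k (-1) (x.1 + x.2)
    have hs1 : ∀ y, Y y ∈ Submodule.span ℂ (range Y) := fun y => Submodule.subset_span ⟨y, rfl⟩
    have e1 : ((a - n : ℤ) : ℂ) + b = a + b - n := by push_cast; ring
    have e2 : (a : ℂ) + (b - n) = a + b - n := by ring
    suffices h : cm (mode k i n) (Y (a, b)) = (xCh i * chi i n) • Y (a - n, b) +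
        (wCh 0 i * chi i n) • Y (a, b - n) by
      change cm (mode k i n) (Y (a, b)) ∈ _
      rw [h]
      exact Submodule.add_mem _ (Submodule.smul_mem _ _ (hs1 _)) (Submodule.smul_mem _ _ (hs1 _))
    simp only [Y, cm_add, cm_smul, cm_mode_potential hk0 hk2, cm_cm, cm_mode_xOp hk0, add_cm,
      cm_mode_uOp hk0 hk2, smul_cm, cm_vOp_uOp hk0 hk2, e1, e2, sg_sub, smul_zero, add_zero]
    fin_cases i
    · simp only [xCh, wCh, chi_of_ne (show (0 : Fin 3) ≠ 1 by decide), Fin.zero_eta, Matrix.cons_val_zero]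
      rcases Int.even_or_odd n with hn | hn <;> simp only [sg_even, sg_odd, hn] <;> module
    · simp only [xCh, wCh, chi_one, Fin.mk_one, Matrix.cons_val_one, Matrix.cons_val_zero]
      rcases Int.even_or_odd n with hn | hn <;> simp only [sg_even, sg_odd, hn] <;> module
    · simp only [xCh, wCh, chi_of_ne (show (2 : Fin 3) ≠ 1 by decide), Fin.reduceFinMk, Matrix.cons_val]
      rcases Int.even_or_odd n with hn | hn <;> simp only [sg_even, sg_odd, hn] <;> module
  · rintro ⟨a, b⟩ j
    simp only [LinearMap.add_apply, LinearMap.smul_apply, map_add, map_smul, cm_apply, map_sub,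
      coord_xOp_uOp hk0 hk2, coord_uOp_xOp hk0 hk2, coord_potential hk2, smul_eq_mul, chi_one]
    rcases lt_trichotomy a 0 with h | rfl | h
    · rw [if_pos h, if_neg (by omega), if_neg (by omega)]; ring
    · simp [sg_even]; ring
    · rw [if_pos h, if_neg (by omega), if_neg (by omega)]; ring

end

section
variable {k : ℂ}

/-! ### The commutator of `x` with the screening current -/

lemma sum_chi (N : ℕ) : ∑ m ∈ Finset.range N, chi 2 (m + 1) = (2 * N + 1 - sg N) / 4 := by
  induction N with
  | zero => simp [sg]
  | succ N ih =>
    rw [Finset.sum_range_succ, ih, chi_of_ne (by decide)]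
    have : sg ((N : ℤ) + 1) = -sg N := by
      have := sg_sub N (-1)
      rw [sg_odd (show Odd (-1 : ℤ) by decide), sub_neg_eq_add] at this
      rw [this]; ring
    push_cast
    rw [this]
    ring

/-- For odd `n`, the difference `a - n` is even exactly if `a` is odd. -/
lemma chi_two_mul_chi_one (a n : ℤ) : chi 2 n * chi 1 (a - n) = chi 2 a * chi 2 n := by
  rw [chi_one, chi_of_ne (by decide), chi_of_ne (by decide), sg_sub]
  have : sg n * sg n = 1 := by
    rcases Int.even_or_odd n with h | h
    · rw [sg_even h]; ring
    · rw [sg_odd h]; ring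
  linear_combination (1 / 4 * sg a - 0) * (-this)

lemma chi_two_mul_sg (a : ℤ) : chi 2 a * sg a = -chi 2 a := by
  rw [chi_of_ne (by decide)]
  rcases Int.even_or_odd a with h | h
  · rw [sg_even h]; ring
  · rw [sg_odd h]; ring

/-- A sum over modes of one sign in the two-point functions of `x` and `S`. -/
lemma finsum_contraction (a : ℤ) (p q : ℂ) :
    (∑ᶠ n : ℤ, if 0 < n then chi 2 n * ((if 0 < a - n then p * chi 1 (a - n) else 0)
      + if a = n then q else 0) else 0) =
      if 0 < a then chi 2 a * (p * (a - 1) / 2 + q) else 0 := by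
  rw [finsum_of_injective (e := fun m : ℕ => (m : ℤ) + 1)]
  · split_ifs with ha
    · obtain ⟨N, rfl⟩ : ∃ N : ℕ, a = N + 1 := ⟨(a - 1).natAbs, by omega⟩
      rw [finsum_eq_sum_of_support_subset (s := Finset.range (N + 1))]
      · rw [Finset.sum_range_succ, if_pos (by omega), if_neg (by omega), if_pos rfl]
        have : ∀ m ∈ Finset.range N, (if 0 < (m : ℤ) + 1 then chi 2 (m + 1) *
            ((if 0 < (N : ℤ) + 1 - (m + 1) then p * chi 1 (N + 1 - (m + 1)) else 0)
            + if (N : ℤ) + 1 = m + 1 then q else 0) else 0) = (p * chi 2 (N + 1)) * chi 2 (m + 1) := by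
          intro m hm
          have hm := Finset.mem_range.mp hm
          rw [if_pos (by omega), if_pos (by omega), if_neg (by omega), add_zero, mul_left_comm,
            chi_two_mul_chi_one, mul_assoc]
        rw [Finset.sum_congr rfl this, ← Finset.mul_sum, sum_chi]
        have h1 : sg (N : ℤ) = -sg ((N : ℤ) + 1) := by
          have := sg_sub (N + 1) 1
          rw [sg_odd (show Odd (1 : ℤ) by decide), add_sub_cancel_right] at this
          rw [this]; ring
        have h2 := chi_two_mul_sg (N + 1)
        rw [h1]
        push_cast
        linear_combination (p / 4) * h2
      · intro m hm
        simp only [Finset.coe_range, mem_Iio]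
        by_contra h
        apply hm
        beta_reduce
        rw [if_neg (show ¬ 0 < (N : ℤ) + 1 - (m + 1) by omega),
          if_neg (show ¬ (N : ℤ) + 1 = m + 1 by omega)]
        simp
    · refine finsum_eq_zero_of_forall_eq_zero fun m => ?_
      rw [if_neg (show ¬ 0 < a - (m + 1) by omega), if_neg (show ¬ a = m + 1 by omega)]
      simp
  · intro m m' h
    simpa using h
  · intro n hn
    rw [if_neg]
    intro h
    exact hn ⟨(n - 1).natAbs, by simp only []; omega⟩

lemma coord_screening_xOp (hk0 : k ≠ 0) (hk2 : k ≠ -2) (a : ℤ) (b j : ℂ) :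
    coord (j + -2) 0 (screening k b (xOp k a (vac j))) =
      if 0 < a then chi 2 a * (2 - 2 * j - (k + 2) * a) * uVac k j (a + b) else 0 := by
  -- The mode `φ_{2,n}` of `S` contracts with the exponential of `x`, after which `Dφ_1` contracts
  -- with `U` (the term `-8`) or acts by its zero mode (`-4j`). Alternatively it contracts with
  -- `Dφ_2` in `x` (`-2ka`).
  have key : ∀ n : ℤ, (if n < 0 then 0 else
      coord (j + -2) 0 (vertex k (sExp k) (b - 2 / (k + 2) + n) (mode k 2 n (xOp k a (vac j))))) =
      uVac k j (a + b) * (if 0 < n then chi 2 n * ((if 0 < a - n then -8 * chi 1 (a - n) else 0)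
        + if a = n then -4 * j - 2 * k * a else 0) else 0) := by
    intro n
    rcases lt_trichotomy n 0 with h | rfl | h
    · rw [if_pos h, if_neg (by omega), mul_zero]
    · rw [mode_zero_of_ne k (by decide)]
      simp
    · rw [if_neg (by omega), if_pos h, mode_vac_cm _ h, cm_mode_xOp hk0, add_sub_shift,
        show vertex k (sExp k) (b + n - 2 / (k + 2)) = uOp k (b + n) from rfl]
      rw [LinearMap.add_apply, LinearMap.smul_apply, LinearMap.smul_apply, map_add, map_smul,
        map_smul, map_add, map_smul, map_smul, coord_uOp_xOp hk0 hk2, coord_uOp_vOp hk2]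
      have e : ((a - n : ℤ) : ℂ) + (b + n) = a + b := by push_cast; ring
      rw [e]
      rcases lt_trichotomy a n with h1 | rfl | h1
      · rw [if_neg (by omega), if_neg (by omega), if_neg (by omega), if_neg (by omega),
          if_neg (by omega)]
        simp
      · rw [if_neg (by omega), if_pos (sub_self a), if_pos (sub_self a), if_neg (by omega), if_pos rfl,
          uVac_shift j b a a rfl]
        simp [xCh]; ring
      · rw [if_pos (by omega), if_neg (by omega), if_pos (by omega), if_neg (by omega)]
        simp [xCh]; ring
  rw [screening_eq, LinearMap.smul_apply, map_smul, coord_vertexInsert]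
  simp only [key]
  rw [← mul_finsum', finsum_contraction]
  · split_ifs <;> simp; ring
  · refine (finite_Icc 0 a).subset fun n hn => ?_
    by_contra hc
    apply hn
    simp only [mem_Icc, not_and_or, not_le] at hc
    beta_reduce
    split_ifs <;> first | rfl | omega | simp

lemma coord_xOp_screening (hk0 : k ≠ 0) (hk2 : k ≠ -2) (a : ℤ) (b j : ℂ) :
    coord (j + -2) 0 (xOp k a (screening k b (vac j))) =
      if a < 0 then chi 2 a * ((k + 2) * a - 2 + 2 * j) * uVac k j (a + b) else 0 := by
  -- These are the same contractions in the opposite order. The zero mode of `Dφ_1` now acts after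
  -- `U`, hence `j - 2` instead of `j`.
  have key : ∀ n : ℤ, (if n < 0 then coord (j + -2) 0 (xOp k a
      (mode k 2 n (vertex k (sExp k) (b - 2 / (k + 2) + n) (vac j))))
      else if n = 0 ∧ (2 : Fin 3) = 1 then
        2 * j * coord (j + -2) 0 (xOp k a (vertex k (sExp k) (b - 2 / (k + 2)) (vac j))) else 0) =
      uVac k j (a + b) * (if 0 < -n then chi 2 (-n) * ((if 0 < -a - -n then -8 * chi 1 (-a - -n) else 0)
        + if -a = -n then 4 * (j - 2) + 2 * k * a else 0) else 0) := by
    intro n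
    rw [if_neg (show ¬ (n = 0 ∧ (2 : Fin 3) = 1) from fun h => absurd h.2 (by decide))]
    by_cases h : n < 0
    · rw [if_pos h, if_pos (by omega), coord_cm_vac _ h, cm_mode_xOp hk0, add_sub_shift,
        show vertex k (sExp k) (b + n - 2 / (k + 2)) = uOp k (b + n) from rfl,
        LinearMap.add_apply, LinearMap.smul_apply, LinearMap.smul_apply]
      rw [map_add, map_smul, map_smul, coord_xOp_uOp hk0 hk2, coord_vOp_uOp hk2]
      have e : ((a - n : ℤ) : ℂ) + (b + n) = a + b := by push_cast; ring
      have e2 : -a - -n = -(a - n) := by ring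
      rw [e, e2, chi_neg, chi_neg]
      rcases lt_trichotomy a n with h1 | rfl | h1
      · rw [if_pos (by omega), if_neg (by omega), if_pos (by omega), if_neg (by omega)]
        simp [xCh]; ring
      · rw [if_neg (by omega), if_pos (sub_self a), if_pos (sub_self a), if_neg (by omega), if_pos rfl,
          uVac_shift j b a a rfl]
        simp [xCh]; ring
      · rw [if_neg (by omega), if_neg (by omega), if_neg (by omega), if_neg (by omega),
          if_neg (by omega)]
        simp
    · rw [if_neg h, if_neg (by omega), mul_zero]
  have e := map_vertexInsert_vac (k := k) (coord (j + -2) 0 ∘ₗ xOp k a) 2 (sExp k)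
    (b - 2 / (k + 2)) j
  simp only [LinearMap.comp_apply] at e
  rw [screening_eq, LinearMap.smul_apply, map_smul, map_smul, e]
  simp only [key]
  rw [finsum_of_injective (e := fun n : ℤ => -n) neg_injective]
  · simp only [neg_neg]
    rw [← mul_finsum', finsum_contraction]
    · split_ifs <;> first | omega | skip
      · rw [chi_neg]; simp; ring
      · simp
    · refine (finite_Icc 0 (-a)).subset fun n hn => ?_
      by_contra hc
      apply hn
      simp only [mem_Icc, not_and_or, not_le] at hc
      beta_reduce
      split_ifs <;> first | rfl | omega | simp
  · intro n hn
    exact absurd ⟨-n, neg_neg n⟩ hn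

/-- Under `φ_2` the contributions of `[V,S]` and `[x,U]` that come from removed insertions cancel
each other. Under `φ_1` the contribution of `[V,S]` accounts for the change from `b` to `b - n` in
the coefficient of the potentials. That coefficient is the trace of `D_ξ`. -/
theorem cm_xOp_screening (hk0 : k ≠ 0) (hk2 : k ≠ -2) (a : ℤ) (b : ℂ) :
    cm (xOp k a) (screening k b) + ((k + 2) / 2 * b) • potential k 1 (a + b)
      + (-((k + 2) / 2 * b * sg a)) • potential k (-1) (a + b) = 0 := by
  refine family_eq_zero hk0 hk2 (Y := fun x : ℤ × ℂ => cm (xOp k x.1) (screening k x.2)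
    + ((k + 2) / 2 * x.2) • potential k 1 (x.1 + x.2)
    + (-((k + 2) / 2 * x.2 * sg x.1)) • potential k (-1) (x.1 + x.2)) (s := -2)
    (fun x => ?_) ?_ ?_ (a, b)
  · exact Submodule.add_mem _ (Submodule.add_mem _
      (cm_mem_shiftOps (xOp_mem k _) (screening_mem hk2 _))
      (Submodule.smul_mem _ _ (potential_mem hk2 _ _)))
      (Submodule.smul_mem _ _ (potential_mem hk2 _ _))
  · rintro ⟨a, b⟩ i n -
    let Y := fun x : ℤ × ℂ => cm (xOp k x.1) (screening k x.2)
      + ((k + 2) / 2 * x.2) • potential k 1 (x.1 + x.2)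
      + (-((k + 2) / 2 * x.2 * sg x.1)) • potential k (-1) (x.1 + x.2)
    have hs1 : ∀ y, Y y ∈ Submodule.span ℂ (range Y) := fun y => Submodule.subset_span ⟨y, rfl⟩
    have e1 : ((a - n : ℤ) : ℂ) + b = a + b - n := by push_cast; ring
    have e2 : (a : ℂ) + (b - n) = a + b - n := by ring
    suffices h : cm (mode k i n) (Y (a, b)) = (xCh i * chi i n) • Y (a - n, b) +
        (wCh 0 i * chi i n) • Y (a, b - n) by
      change cm (mode k i n) (Y (a, b)) ∈ _
      rw [h]
      exact Submodule.add_mem _ (Submodule.smul_mem _ _ (hs1 _)) (Submodule.smul_mem _ _ (hs1 _))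
    have h1 : ∀ (a : ℤ) b, cm (vOp k a) (screening k b) =
        potential k 1 (a + b) + (-sg a) • potential k (-1) (a + b) := by
      intro a b
      rw [← sub_eq_zero, ← cm_vOp_screening hk0 hk2 a b]
      module
    have h2 : ∀ (a : ℤ) b, cm (xOp k a) (uOp k b) =
        (-1 : ℂ) • potential k 1 (a + b) + (-sg a) • potential k (-1) (a + b) := by
      intro a b
      rw [← sub_eq_zero, ← cm_xOp_uOp hk0 hk2 a b]
      module
    simp only [Y, cm_add, cm_smul, cm_mode_potential hk0 hk2, cm_cm, cm_mode_xOp hk0, add_cm,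
      cm_mode_screening hk0 hk2, smul_cm, h1, h2, e1, e2, sg_sub]
    fin_cases i
    · simp only [xCh, wCh, chi_of_ne (show (0 : Fin 3) ≠ 1 by decide), Fin.zero_eta, Matrix.cons_val_zero]
      rcases Int.even_or_odd n with hn | hn <;> simp only [sg_even, sg_odd, hn] <;>
        simp only [Fin.reduceEq, if_false] <;> module
    · simp only [xCh, wCh, chi_one, Fin.mk_one, Matrix.cons_val_one, Matrix.cons_val_zero]
      rcases Int.even_or_odd n with hn | hn <;> simp only [sg_even, sg_odd, hn] <;>
        simp only [Fin.reduceEq, if_false] <;> module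
    · simp only [xCh, wCh, chi_of_ne (show (2 : Fin 3) ≠ 1 by decide), Fin.reduceFinMk, Matrix.cons_val]
      rcases Int.even_or_odd n with hn | hn <;> simp only [sg_even, sg_odd, hn] <;>
        simp only [if_true] <;> module
  · rintro ⟨a, b⟩ j
    simp only [LinearMap.add_apply, LinearMap.smul_apply, map_add, map_smul, cm_apply, map_sub,
      coord_xOp_screening hk0 hk2, coord_screening_xOp hk0 hk2, coord_potential hk2, smul_eq_mul,
      chi_of_ne (show (2 : Fin 3) ≠ 1 by decide)]
    have hk' : k + 2 ≠ 0 := fun h => hk2 (eq_neg_of_add_eq_zero_left h)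
    -- The expectation value is supported where the zero mode fixes `a + b` in terms of `j`. This
    -- converts the explicit `j` of the two-point functions into the exponent `b`.
    have h3 : uVac k j (a + b) * ((k + 2) * (a + b) - (-2 * j + 2)) = 0 := by
      unfold uVac
      split_ifs with h
      · rw [h]; field_simp; ring
      · ring
    rcases lt_trichotomy a 0 with h | rfl | h
    · rw [if_pos h, if_neg (by omega)]
      linear_combination ((1 - sg a) / 2) * h3
    · simp [sg_even]
    · rw [if_pos h, if_neg (by omega)]
      linear_combination ((1 - sg a) / 2) * h3

/-! ### The commutation relations as identities of formal series -/

lemma ofModes_neg (M : ℤ → Op) (n : ℤ) : ofModes M (-(n : ℂ)) = M n := by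
  rw [ofModes, finsum_eq_single _ n]
  · rw [if_pos rfl]
  · intro m hm
    rw [if_neg]
    intro h
    exact hm (by exact_mod_cast (neg_injective h).symm)

lemma ofModes_of_ne (M : ℤ → Op) {a : ℂ} (h : ∀ n : ℤ, a ≠ -(n : ℂ)) : ofModes M a = 0 :=
  finsum_eq_zero_of_forall_eq_zero fun n => if_neg (h n)

lemma deltaMul_neg (ε : ℂ) (W : Field1) (n : ℤ) (b : ℂ) :
    deltaMul ε W (-(n : ℂ)) b = ε ^ n • W (b - n) := by
  rw [deltaMul, finsum_eq_single _ n]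
  · rw [if_pos rfl]
  · intro m hm
    rw [if_neg]
    intro h
    exact hm (by exact_mod_cast (neg_injective h).symm)

lemma deltaMul_of_ne (ε : ℂ) (W : Field1) {a : ℂ} (h : ∀ n : ℤ, a ≠ -(n : ℂ)) (b : ℂ) :
    deltaMul ε W a b = 0 :=
  finsum_eq_zero_of_forall_eq_zero fun n => if_neg (h n)

/-- Complex powers arise only from `ζ^{α_1 φ_{1,0}}`; without it all exponents are integers. -/
lemma vertex_eq_zero {α : Fin 3 → ℂ} (hα : α 1 = 0) {a : ℂ} (h : ∀ n : ℤ, a ≠ -(n : ℂ)) :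
    vertex k α a = 0 := by
  refine LinearMap.ext fun v => ?_
  rw [vertex_apply]
  refine finsum_eq_zero_of_forall_eq_zero fun p => ?_
  by_contra hne
  obtain ⟨N, hN⟩ := exists_below v
  obtain ⟨-, j, -, h2⟩ := vertexTerm_ne k α a p hN hne
  refine h ((p.2 : ℤ) - p.1) ?_
  rw [hα, zero_mul] at h2
  push_cast
  linear_combination h2

lemma xField_of_ne {a : ℂ} (h : ∀ n : ℤ, a ≠ -(n : ℂ)) : xField k a = 0 := by
  have h1 : ∀ i, vertexInsert k i (xExp k) a = 0 := by
    intro i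
    refine LinearMap.ext fun v => ?_
    rw [vertexInsert_apply]
    refine finsum_eq_zero_of_forall_eq_zero fun p => ?_
    have : vertex k (xExp k) (a + p) = 0 := by
      refine vertex_eq_zero rfl fun n hn => h (n + p) ?_
      push_cast
      linear_combination hn
    unfold insertTerm
    split_ifs <;> simp [this]
  change (1 / 2 : ℂ) • (vertexInsert k 1 (xExp k) a + vertexInsert k 2 (xExp k) a) = 0
  rw [h1, h1, add_zero, smul_zero]

lemma cm_mode_zero_screening (hk0 : k ≠ 0) (hk2 : k ≠ -2) (n : ℤ) (b : ℂ) :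
    cm (mode k 0 n) (screening k b) = 0 := by
  rw [cm_mode_screening hk0 hk2]
  simp [wCh]

theorem bracket_betaField_screening (hk0 : k ≠ 0) (hk2 : k ≠ -2) :
    bracket (betaField k) (screening k) = 0 := by
  funext a b
  change cm (betaField k a) (screening k b) = 0
  by_cases h : ∃ n : ℤ, a = -(n : ℂ)
  · obtain ⟨n, rfl⟩ := h
    rw [betaField, ofModes_neg, smul_cm, cm_mode_zero_screening hk0 hk2, smul_zero]
  · push Not at h
    rw [betaField, ofModes_of_ne _ h, zero_cm]

lemma cm_xField_screening (hk0 : k ≠ 0) (hk2 : k ≠ -2) (n : ℤ) (b : ℂ) :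
    cm (xField k (-(n : ℂ))) (screening k b) = ((k + 2) / 2 * b) •
      ((-1 : ℂ) • potential k 1 (b - n) + sg n • potential k (-1) (b - n)) := by
  have h := cm_xOp_screening hk0 hk2 (-n) b
  rw [show xOp k (-n) = xField k (-(n : ℂ)) by rw [xOp]; push_cast; rfl] at h
  have h1 : sg (-n) = sg n := by
    have := sg_sub 0 n
    rw [zero_sub, sg_even (show Even (0 : ℤ) by decide), one_mul] at this
    exact this
  have h2 : ((-n : ℤ) : ℂ) + b = b - n := by push_cast; ring
  rw [h1, h2] at h
  rw [← sub_eq_zero, ← h]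
  module

theorem bracket_xField_screening (hk0 : k ≠ 0) (hk2 : k ≠ -2) :
    bracket (xField k) (screening k) = ((k + 2) / 2) • derivXi
        (-deltaMul 1 (potential k 1) + deltaMul (-1) (potential k (-1))) := by
  funext a b
  change cm (xField k a) (screening k b) = ((k + 2) / 2) • (b •
    (-(deltaMul 1 (potential k 1) a b) + deltaMul (-1) (potential k (-1)) a b))
  by_cases h : ∃ n : ℤ, a = -(n : ℂ)
  · obtain ⟨n, rfl⟩ := h
    rw [cm_xField_screening hk0 hk2, deltaMul_neg, deltaMul_neg, one_zpow, one_smul, neg_op, smul_smul]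
    rfl
  · push Not at h
    rw [xField_of_ne h, deltaMul_of_ne _ _ h, deltaMul_of_ne _ _ h, zero_cm, neg_op]
    simp

end

/-! ### Ordered products -/

/-- The ordered product of a tuple of operators. -/
def prodOp {m : ℕ} (X : Fin m → Op) : Op := (List.ofFn X).prod

lemma prodOp_zero (X : Fin 0 → Op) : prodOp X = 1 := by simp [prodOp]

lemma prodOp_succ {m : ℕ} (X : Fin (m + 1) → Op) : prodOp X = X 0 * prodOp fun i => X i.succ := by
  simp [prodOp, List.ofFn_succ]

lemma prodOp_eq {m : ℕ} (X : Fin m → Op) : prodOp X = MultilinearMap.mkPiAlgebraFin ℂ m Op X := by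
  rw [MultilinearMap.mkPiAlgebraFin_apply, prodOp]

lemma prodOp_update_add {m : ℕ} (X : Fin m → Op) (i : Fin m) (Y Z : Op) :
    prodOp (Function.update X i (Y + Z)) =
      prodOp (Function.update X i Y) + prodOp (Function.update X i Z) := by
  simp only [prodOp_eq, MultilinearMap.map_update_add]

lemma prodOp_update_smul {m : ℕ} (X : Fin m → Op) (i : Fin m) (c : ℂ) (Y : Op) :
    prodOp (Function.update X i (c • Y)) = c • prodOp (Function.update X i Y) := by
  simp only [prodOp_eq, MultilinearMap.map_update_smul]

lemma prodOp_smul {m : ℕ} (X : Fin m → Op) (c : ℂ) :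
    prodOp (fun i => c • X i) = c ^ m • prodOp X := by
  induction m with
  | zero => simp [prodOp_zero]
  | succ m ih => rw [prodOp_succ, prodOp_succ, ih, smul_mul_smul_comm, pow_succ']

lemma update_zero_zero {m : ℕ} (X : Fin (m + 1) → Op) (Y : Op) :
    prodOp (Function.update X 0 Y) = Y * prodOp fun i => X i.succ := by
  rw [prodOp_succ]
  simp

lemma update_succ_succ {m : ℕ} (X : Fin (m + 1) → Op) (i : Fin m) (Y : Op) :
    prodOp (Function.update X i.succ Y) =
      X 0 * prodOp (Function.update (fun i => X i.succ) i Y) := by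
  rw [prodOp_succ, Function.update_of_ne (Fin.succ_ne_zero i).symm]
  congr 2
  funext l
  by_cases h : l = i
  · subst h; simp
  · rw [Function.update_of_ne h, Function.update_of_ne fun h' => h (Fin.succ_injective m h')]

lemma cm_prodOp {m : ℕ} (T : Op) (X : Fin m → Op) :
    cm T (prodOp X) = ∑ l, prodOp (Function.update X l (cm T (X l))) := by
  induction m with
  | zero => simp [prodOp_zero, cm_one]
  | succ m ih =>
    rw [prodOp_succ, cm_mul, ih, Fin.sum_univ_succ, update_zero_zero, Finset.mul_sum]
    simp only [update_succ_succ]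

/-- On its way from the far left to the place `i`, the operator `T` passes the places before `i` and
leaves a commutator at each. The mirror image is `prodOp_update_mul`. -/
lemma mul_prodOp {m : ℕ} (T : Op) (X : Fin m → Op) (i : Fin m) :
    T * prodOp X = prodOp (Function.update X i (T * X i)) +
      ∑ l, if l < i then prodOp (Function.update X l (cm T (X l))) else 0 := by
  induction m with
  | zero => exact i.elim0
  | succ m ih =>
    refine Fin.cases ?_ (fun i => ?_) i
    · rw [update_zero_zero, prodOp_succ, ← mul_assoc]
      simp
    · rw [update_succ_succ, prodOp_succ, ← mul_assoc, mul_eq_add_cm T (X 0), add_mul, mul_assoc,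
        ih _ i, Fin.sum_univ_succ, update_zero_zero, mul_add, if_pos (Fin.succ_pos i), add_assoc,
        add_comm (cm T (X 0) * _), Finset.mul_sum]
      simp only [Fin.succ_lt_succ_iff, update_succ_succ, mul_ite, mul_zero]

lemma prodOp_update_mul {m : ℕ} (T : Op) (X : Fin m → Op) (i : Fin m) :
    prodOp (Function.update X i (X i * T)) = prodOp X * T +
      ∑ l, if i < l then prodOp (Function.update X l (cm T (X l))) else 0 := by
  induction m with
  | zero => exact i.elim0
  | succ m ih =>
    refine Fin.cases ?_ (fun i => ?_) i
    · rw [update_zero_zero, prodOp_succ, mul_assoc, mul_eq_add_cm T, cm_prodOp, mul_add, mul_assoc,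
        Fin.sum_univ_succ, Finset.mul_sum]
      simp [update_succ_succ]
    · rw [update_succ_succ, prodOp_succ, ih _ i, mul_add, mul_assoc, Fin.sum_univ_succ,
        Finset.mul_sum]
      simp only [Fin.succ_lt_succ_iff, update_succ_succ, mul_ite, mul_zero, not_lt.mpr (Fin.zero_le _),
        if_false, zero_add]

/-- Writing the product as `L Y R` lets a locally finite sum at one place be taken out of the
product. -/
lemma exists_prodOp_update {m : ℕ} (X : Fin m → Op) (i : Fin m) :
    ∃ L R : Op, ∀ Y, prodOp (Function.update X i Y) = L * Y * R := by
  induction m with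
  | zero => exact i.elim0
  | succ m ih =>
    refine Fin.cases ?_ (fun i => ?_) i
    · exact ⟨1, prodOp fun i => X i.succ, fun Y => by rw [update_zero_zero, one_mul]⟩
    · obtain ⟨L, R, h⟩ := ih (fun i => X i.succ) i
      exact ⟨X 0 * L, R, fun Y => by rw [update_succ_succ, h]; simp only [mul_assoc]⟩

lemma prodOp_mem_shiftOps {m : ℕ} {s : ℂ} {X : Fin m → Op} (h : ∀ i, X i ∈ shiftOps s) :
    prodOp X ∈ shiftOps (m * s) := by
  induction m with
  | zero => simpa [prodOp_zero] using one_mem_shiftOps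
  | succ m ih =>
    rw [prodOp_succ]
    have := mul_mem_shiftOps (h 0) (ih fun i => h i.succ)
    convert this using 1
    push_cast; ring_nf

/-! ### Products of vertex operators with insertions -/

/-- The coefficients of `ζ^{2/(k+2)} V(ζ)` with `V` a vertex operator, or of
`ζ^{2/(k+2)} :Dφ_2(ζ) V(ζ):`. -/
def slot (k : ℂ) (α : Fin 3 → ℂ) (s : Bool) (a : ℂ) : Op :=
  if s then vertexInsert k 2 α (a - 2 / (k + 2)) else vertex k α (a - 2 / (k + 2))

lemma slot_true (k : ℂ) (α : Fin 3 → ℂ) (a : ℂ) :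
    slot k α true a = vertexInsert k 2 α (a - 2 / (k + 2)) := rfl

lemma slot_false (k : ℂ) (α : Fin 3 → ℂ) (a : ℂ) :
    slot k α false a = vertex k α (a - 2 / (k + 2)) := rfl

open Classical in
lemma cm_mode_slot (k : ℂ) (α : Fin 3 → ℂ) (s : Bool) (a : ℂ) (i : Fin 3) (n : ℤ) :
    cm (mode k i n) (slot k α s a) = (α i * kap k i * chi i n) • slot k α s (a - n)
      + (if i = 2 ∧ s = true then kap k i * n * chi i n else 0) • slot k α false (a - n) := by
  cases s
  · simp only [slot_false]
    rw [cm_mode_vertex, sub_right_comm]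
    simp
  · simp only [slot_true, slot_false]
    rw [cm_mode_vertexInsert, sub_right_comm]
    simp

lemma slot_mem {k : ℂ} (hk2 : k ≠ -2) {α : Fin 3 → ℂ} (hα : α 1 = -1 / (k + 2)) (s : Bool) (a : ℂ) :
    slot k α s a ∈ shiftOps (-2) := by
  rw [← shift_sExp hk2, ← hα]
  cases s
  · exact vertex_mem_shiftOps _ _ _
  · exact vertexInsert_mem_shiftOps _ _ _ _

/-- The coefficients of an ordered product of vertex operators. -/
def prodSlot (k : ℂ) {m : ℕ} (α : Fin m → Fin 3 → ℂ) (s : Fin m → Bool) (a : Fin m → ℂ) : Op :=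
  prodOp fun i => slot k (α i) (s i) (a i)

lemma prodSlot_update (k : ℂ) {m : ℕ} (α : Fin m → Fin 3 → ℂ) (s : Fin m → Bool) (a : Fin m → ℂ)
    (l : Fin m) (t : Bool) (b : ℂ) :
    prodOp (Function.update (fun i => slot k (α i) (s i) (a i)) l (slot k (α l) t b)) =
      prodSlot k α (Function.update s l t) (Function.update a l b) := by
  unfold prodSlot
  congr 1
  funext i
  by_cases h : i = l
  · subst h; simp
  · simp [h]

open Classical in
lemma cm_mode_prodSlot (k : ℂ) {m : ℕ} (α : Fin m → Fin 3 → ℂ) (s : Fin m → Bool) (a : Fin m → ℂ)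
    (i : Fin 3) (n : ℤ) : cm (mode k i n) (prodSlot k α s a) = ∑ l,
      ((α l i * kap k i * chi i n) • prodSlot k α s (Function.update a l (a l - n))
        + (if i = 2 ∧ s l = true then kap k i * n * chi i n else 0) •
          prodSlot k α (Function.update s l false) (Function.update a l (a l - n))) := by
  rw [prodSlot, cm_prodOp]
  refine Finset.sum_congr rfl fun l _ => ?_
  rw [cm_mode_slot, prodOp_update_add, prodOp_update_smul, prodOp_update_smul, prodSlot_update,
    prodSlot_update, Function.update_eq_self]

lemma prodSlot_mem {k : ℂ} (hk2 : k ≠ -2) {m : ℕ} {α : Fin m → Fin 3 → ℂ}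
    (hα : ∀ i, α i 1 = -1 / (k + 2)) (s : Fin m → Bool) (a : Fin m → ℂ) :
    prodSlot k α s a ∈ shiftOps (m * -2) :=
  prodOp_mem_shiftOps fun i => slot_mem hk2 (hα i) _ _

lemma sub_two_mul (j : ℂ) (m : ℕ) : j - 2 * m = j + m * -2 := by ring

/-! ### Products of vertex operators between vacua -/

lemma sum_antidiagonalTuple_succ {M : Type*} [AddCommMonoid M] (m s : ℕ) (f : (Fin (m + 1) → ℕ) → M) :
    ∑ t ∈ Finset.Nat.antidiagonalTuple (m + 1) s, f t =
      ∑ p ∈ Finset.HasAntidiagonal.antidiagonal s, ∑ u ∈ Finset.Nat.antidiagonalTuple m p.2,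
        f (Fin.cons p.1 u) := by
  rw [Finset.sum_sigma']
  refine Finset.sum_nbij' (fun t => ⟨(t 0, ∑ i : Fin m, t i.succ), Fin.tail t⟩)
    (fun x => Fin.cons x.1.1 x.2) ?_ ?_ ?_ ?_ ?_
  · intro t ht
    rw [Finset.Nat.mem_antidiagonalTuple, Fin.sum_univ_succ] at ht
    simp [Finset.Nat.mem_antidiagonalTuple, Fin.tail, ht]
  · rintro ⟨⟨p, q⟩, u⟩ h
    simp only [Finset.mem_sigma, Finset.HasAntidiagonal.mem_antidiagonal,
      Finset.Nat.mem_antidiagonalTuple] at h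
    rw [Finset.Nat.mem_antidiagonalTuple, Fin.sum_univ_succ]
    simp [h]
  · intro t _
    exact Fin.cons_self_tail t
  · rintro ⟨⟨p, q⟩, u⟩ h
    simp only [Finset.mem_sigma, Finset.HasAntidiagonal.mem_antidiagonal,
      Finset.Nat.mem_antidiagonalTuple] at h
    simp [h]
  · intro t _
    exact congrArg f (Fin.cons_self_tail t).symm

/-- The annihilation exponential is exchanged with one factor after another, each absorbing a part
`t_i` of the index `s`. What is left at the end kills the vacuum unless its index is `0`, so the
`t_i` add up to `s`. -/
lemma expAnn_mul_prodSlot (k : ℂ) {m : ℕ} (w : ℕ → ℂ) (β : Fin 3 → ℂ) (α : Fin m → Fin 3 → ℂ)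
    (hw : ∀ i, pairing k β (α i) = w) (s : ℕ) (a : Fin m → ℂ) (j : ℂ) :
    expAnn k β s (prodSlot k α (fun _ => false) a (vac j)) =
      ∑ t ∈ Finset.Nat.antidiagonalTuple m s, (∏ i, exch w (t i)) •
        prodSlot k α (fun _ => false) (fun i => a i - t i) (vac j) := by
  induction m generalizing s with
  | zero =>
    cases s with
    | zero => simp [prodSlot, prodOp_zero, expAnn_zero]
    | succ s => simp [prodSlot, prodOp_zero, expAnn_vac]
  | succ m ih =>
    have h1 : ∀ a : Fin (m + 1) → ℂ, prodSlot k α (fun _ => false) a =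
        slot k (α 0) false (a 0) * prodSlot k (fun i => α i.succ) (fun _ => false)
          fun i => a i.succ := fun a => prodOp_succ _
    rw [h1, Module.End.mul_apply, ← Module.End.mul_apply, slot_false, expAnn_mul_vertex, hw,
      LinearMap.sum_apply, sum_antidiagonalTuple_succ]
    refine Finset.sum_congr rfl fun p _ => ?_
    rw [LinearMap.smul_apply, Module.End.mul_apply, ih _ fun i => hw i.succ, map_sum,
      Finset.smul_sum]
    refine Finset.sum_congr rfl fun u _ => ?_
    rw [h1, Module.End.mul_apply, map_smul, smul_smul, Fin.prod_univ_succ, slot_false,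
      sub_right_comm]
    simp only [Fin.cons_zero, Fin.cons_succ]

/-- The recursion is dominated by that of `(1-z)^{-(K+1)} = exp ((K+1) ∑ z^n / n)`, whose
coefficients are these binomial coefficients. -/
lemma norm_exch_le {w : ℕ → ℂ} {K : ℕ} (hw : ∀ n, ‖w n‖ ≤ K + 1) (s : ℕ) :
    ‖exch w s‖ ≤ ((s + K).choose K : ℝ) := by
  induction s using Nat.strong_induction_on with
  | _ s ih =>
    cases s with
    | zero => simp [exch]
    | succ s =>
      have h1 : ‖exch w (s + 1)‖ * (s + 1) ≤
          ∑ i : Fin (s + 1), (K + 1 : ℝ) * ((i + K).choose K : ℝ) := by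
        have h0 : ((s : ℂ) + 1) ≠ 0 := by exact_mod_cast Nat.succ_ne_zero s
        have h2 : ‖((s : ℂ) + 1)‖ = s + 1 := by
          rw [← Nat.cast_succ, Complex.norm_natCast]; push_cast; rfl
        rw [exch, norm_div, norm_neg, h2, div_mul_cancel₀ _ (by positivity)]
        refine (norm_sum_le _ _).trans (Finset.sum_le_sum fun i _ => ?_)
        rw [norm_mul]
        exact mul_le_mul (hw _) (ih i (by omega)) (norm_nonneg _) (by positivity)
      have h2 : ∑ i : Fin (s + 1), (K + 1 : ℝ) * ((i + K).choose K : ℝ) =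
          ((s + 1 + K).choose K : ℝ) * (s + 1) := by
        rw [← Finset.mul_sum, Fin.sum_univ_eq_sum_range fun i => ((i + K).choose K : ℝ)]
        -- The hockey-stick identity closes the recursion of the majorant.
        have h3 := Nat.sum_range_add_choose s K
        have h4 := Nat.choose_succ_right_eq (s + 1 + K) K
        rw [show s + 1 + K - K = s + 1 by omega] at h4
        rw [← Nat.cast_sum, h3, show s + K + 1 = s + 1 + K by ring]
        have h5 : (((s + 1 + K).choose (K + 1) * (K + 1) : ℕ) : ℝ) =
          ((s + 1 + K).choose K * (s + 1) : ℕ) := by rw [h4]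
        push_cast at h5
        linarith
      rw [h2] at h1
      exact le_of_mul_le_mul_right h1 (by positivity)

lemma summable_exch {w : ℕ → ℂ} {K : ℕ} (hw : ∀ n, ‖w n‖ ≤ K + 1) {z : ℂ} (hz : ‖z‖ < 1) :
    Summable fun s => exch w s * z ^ s := by
  refine Summable.of_norm_bounded (g := fun s => ((s + K).choose K : ℝ) * ‖z‖ ^ s) ?_ fun s => ?_
  · exact summable_choose_mul_geometric_of_norm_lt_one K (by simpa using hz)
  · rw [norm_mul, norm_pow]
    exact mul_le_mul_of_nonneg_right (norm_exch_le hw s) (by positivity)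

lemma summable_prod_tuple {m : ℕ} {f : Fin m → ℕ → ℂ} (h : ∀ i, Summable (f i)) :
    Summable fun t : Fin m → ℕ => ∏ i, f i (t i) := by
  induction m with
  | zero => exact (hasSum_fintype _).summable
  | succ m ih =>
    rw [← (Fin.consEquiv fun _ : Fin (m + 1) => ℕ).summable_iff]
    have := summable_mul_of_summable_norm (h 0).norm (ih fun i => h i.succ).norm
    refine this.congr fun p => ?_
    simp [Fin.consEquiv, Fin.prod_univ_succ]

/-- The exponent of the vertex operator that is applied to a vacuum after `m` others. -/
def vacExp (k j : ℂ) (m : ℕ) : ℂ := (2 - 2 * (j - 2 * m)) / (k + 2)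

/-- The contribution of all ways to write `a` as `(e - ∑ t_i, b + t)`. -/
def contract {m : ℕ} (e : ℂ) (f : ℕ → ℂ) (c : (Fin m → ℂ) → ℂ) (a : Fin (m + 1) → ℂ) : ℂ :=
  open Classical in ∑ᶠ s : ℕ, if a 0 + s = e then
    ∑ t ∈ Finset.Nat.antidiagonalTuple m s, (∏ i, f (t i)) * c (fun i => a i.succ - t i) else 0

/-- The matrix elements of products of `m` vertex operators between vacua, where the contraction of
two vertex operators is given by `w`. -/
def vacCoef (k : ℂ) (w : ℕ → ℂ) (j : ℂ) : (m : ℕ) → (Fin m → ℂ) → ℂ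
  | 0, _ => 1
  | m + 1, a => contract (vacExp k j m) (exch w) (vacCoef k w j m) a

/-- The exponents are those of a product of screening currents or of their total derivatives. -/
structure Admissible (k : ℂ) {m : ℕ} (α : Fin m → Fin 3 → ℂ) : Prop where
  one : ∀ i, α i 1 = -1 / (k + 2)
  pairing : ∀ i l, i ≠ l → ZAlg.pairing k (α i) (α l) = ZAlg.pairing k (sExp k) (sExp k)

lemma Admissible.tail {k : ℂ} {m : ℕ} {α : Fin (m + 1) → Fin 3 → ℂ} (h : Admissible k α) :
    Admissible k fun i => α i.succ :=
  ⟨fun _ => h.one _, fun _ _ hil => h.pairing _ _ fun h' => hil (Fin.succ_injective m h')⟩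

lemma prodSlot_succ (k : ℂ) {m : ℕ} (α : Fin (m + 1) → Fin 3 → ℂ) (s : Fin (m + 1) → Bool)
    (a : Fin (m + 1) → ℂ) : prodSlot k α s a =
      slot k (α 0) (s 0) (a 0) * prodSlot k (fun i => α i.succ) (fun i => s i.succ)
        fun i => a i.succ := prodOp_succ _

lemma prodSlot_vac_mem {k : ℂ} (hk2 : k ≠ -2) {m : ℕ} {α : Fin m → Fin 3 → ℂ}
    (hα : ∀ i, α i 1 = -1 / (k + 2)) (s : Fin m → Bool) (a : Fin m → ℂ) (j : ℂ) :
    prodSlot k α s a (vac j) ∈ fock (j - 2 * m) := by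
  rw [sub_two_mul]
  exact prodSlot_mem hk2 hα s a j _ (vac_mem j)

/-- Only the annihilation part of the leftmost factor survives against the dual vacuum, and
exchanging it with the others gives the recursion of `vacCoef`. The exponents enter only through
their `φ_1`-components and the pairings of distinct factors. Admissibility fixes both, so a product
containing a potential has the same expectation value as one without. -/
theorem coord_prodSlot_vac {k : ℂ} (hk2 : k ≠ -2) {m : ℕ} {α : Fin m → Fin 3 → ℂ}
    (hα : Admissible k α) (j : ℂ) (a : Fin m → ℂ) :
    coord (j - 2 * m) 0 (prodSlot k α (fun _ => false) a (vac j)) =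
      vacCoef k (pairing k (sExp k) (sExp k)) j m a := by
  induction m with
  | zero => simp [prodSlot, prodOp_zero, vacCoef, coord_apply, vac]
  | succ m ih =>
    have hk' : k + 2 ≠ 0 := fun h => hk2 (eq_neg_of_add_eq_zero_left h)
    have e : j - 2 * ((m + 1 : ℕ) : ℂ) = j - 2 * m + 2 * (k + 2) * α 0 1 := by
      rw [hα.one, shift_sExp hk2]; push_cast; ring
    rw [prodSlot_succ, Module.End.mul_apply, slot_false, e, coord_vertex k _ _ _
      (prodSlot_vac_mem hk2 hα.tail.one _ _ j), vacCoef, contract]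
    refine finsum_congr fun s => ?_
    have e2 : a 0 - 2 / (k + 2) + s = α 0 1 * (2 * (j - 2 * m)) ↔ a 0 + s = vacExp k j m := by
      rw [hα.one, vacExp]
      constructor
      · intro h; field_simp at h ⊢; linear_combination h
      · intro h; field_simp at h ⊢; linear_combination h
    simp only [e2]
    refine if_congr Iff.rfl ?_ rfl
    rw [expAnn_mul_prodSlot k _ (α 0) _ fun i => hα.pairing 0 i.succ (Fin.succ_ne_zero i).symm,
      map_sum]
    refine Finset.sum_congr rfl fun t _ => ?_
    rw [map_smul, smul_eq_mul, ih hα.tail]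

lemma radialRegion_tail {m : ℕ} {ξ : Fin (m + 1) → ℂ} (h : ξ ∈ radialRegion (m + 1)) :
    (fun i : Fin m => ξ i.succ) ∈ radialRegion m :=
  ⟨fun _ => h.1 _, fun _ _ hil => h.2 (Fin.succ_lt_succ_iff.mpr hil)⟩

/-- The exponent to which `(t, b)` contributes. -/
def contractExp {m : ℕ} (e : ℂ) (p : (Fin m → ℕ) × (Fin m → ℂ)) : Fin (m + 1) → ℂ :=
  Fin.cons (e - ((∑ i, p.1 i : ℕ) : ℂ)) fun i => p.2 i + p.1 i

/-- For a given exponent `a` the total `s` of the tuple is determined by `a 0` and `e`, and then `b`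
is determined by the tuple. So the fibres of `contractExp` are finite and the sums over them are the
coefficients `contract`. -/
lemma tsum_contract {m : ℕ} (e : ℂ) (f : ℕ → ℂ) (c : (Fin m → ℂ) → ℂ) (a : Fin (m + 1) → ℂ) :
    ∑' p : contractExp e ⁻¹' {a}, (∏ i, f (p.1.1 i)) * c p.1.2 = contract e f c a := by
  classical
  by_cases hs : ∃ s : ℕ, a 0 + s = e
  · obtain ⟨s, hs⟩ := hs
    have h4 : contractExp e ⁻¹' {a} = ((Finset.Nat.antidiagonalTuple m s).image fun t =>
        (t, fun i => a i.succ - t i) : Finset ((Fin m → ℕ) × (Fin m → ℂ))) := by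
      ext p
      simp only [mem_preimage, mem_singleton_iff, Finset.coe_image, mem_image, Finset.mem_coe,
        Finset.Nat.mem_antidiagonalTuple, contractExp]
      constructor
      · rintro rfl
        refine ⟨p.1, ?_, by simp⟩
        rw [Fin.cons_zero, ← eq_sub_iff_add_eq, sub_right_inj] at hs
        exact (Nat.cast_injective hs)
      · rintro ⟨t, rfl, rfl⟩
        refine funext fun i => Fin.cases ?_ (fun i => ?_) i
        · rw [Fin.cons_zero, ← hs]; simp
        · rw [Fin.cons_succ]; simp
    rw [h4, Finset.tsum_subtype' _ fun p : (Fin m → ℕ) × (Fin m → ℂ) =>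
      (∏ i, f (p.1 i)) * c p.2, Finset.sum_image]
    · rw [contract, finsum_eq_single _ s, if_pos hs]
      intro s' h'
      rw [if_neg]
      intro h''
      exact h' (by exact_mod_cast add_left_cancel (h''.trans hs.symm))
    · intro t _ t' _ h
      exact congrArg Prod.fst h
  · have h4 : contractExp e ⁻¹' {a} = ∅ := by
      refine eq_empty_of_forall_notMem ?_
      rintro p rfl
      exact hs ⟨∑ i, p.1 i, by simp [contractExp]⟩
    rw [h4, tsum_empty, contract, finsum_eq_zero_of_forall_eq_zero]
    intro s
    rw [if_neg fun h => hs ⟨s, h⟩]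

lemma prod_cpow_contractExp {m : ℕ} {ξ : Fin (m + 1) → ℂ} (hξ : ∀ i, ξ i ≠ 0) (e : ℂ)
    (p : (Fin m → ℕ) × (Fin m → ℂ)) : ∏ i, ξ i ^ contractExp e p i =
      ξ 0 ^ e * ((∏ i, (ξ (Fin.succ i) / ξ 0) ^ p.1 i) * ∏ i, ξ (Fin.succ i) ^ p.2 i) := by
  rw [Fin.prod_univ_succ, contractExp, Fin.cons_zero, Complex.cpow_sub _ _ (hξ 0),
    Complex.cpow_natCast]
  have : ∀ i : Fin m, ξ i.succ ^ (p.2 i + (p.1 i : ℂ)) = ξ i.succ ^ p.2 i * ξ i.succ ^ p.1 i :=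
    fun i => by rw [Complex.cpow_add _ _ (hξ _), Complex.cpow_natCast]
  simp only [Fin.cons_succ, this, Finset.prod_mul_distrib, div_pow, Finset.prod_div_distrib,
    Finset.prod_pow_eq_pow_sum]
  ring

/-- The series in the ratios `ξ_{i+1}/ξ_0` and the series with coefficients `c` are multiplied and
regrouped by their total exponent. Absolute convergence permits this. -/
lemma summable_contract {m : ℕ} (e : ℂ) {f : ℕ → ℂ} {c : (Fin m → ℂ) → ℂ} {ξ : Fin (m + 1) → ℂ}
    (hξ : ∀ i, ξ i ≠ 0) (hf : ∀ i : Fin m, Summable fun s => f s * (ξ i.succ / ξ 0) ^ s)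
    (hc : Summable fun a => c a * ∏ i, ξ (Fin.succ i) ^ a i) :
    Summable fun a => contract e f c a * ∏ i, ξ i ^ a i := by
  have h2 := (summable_mul_of_summable_norm (summable_prod_tuple hf).norm hc.norm).mul_left (ξ 0 ^ e)
  have h3 := (h2.hasSum.tsum_fiberwise (contractExp e)).summable
  refine h3.congr fun a => ?_
  rw [← tsum_contract, ← tsum_mul_right]
  refine tsum_congr fun p => ?_
  have h4 : ∏ i, ξ i ^ a i = ∏ i, ξ i ^ contractExp e p.1 i := by
    rw [show contractExp e p.1 = a from p.2]
  rw [h4, prod_cpow_contractExp hξ, Finset.prod_mul_distrib]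
  ring

theorem summable_vacCoef (k j : ℂ) {w : ℕ → ℂ} {K : ℕ} (hw : ∀ n, ‖w n‖ ≤ K + 1) {m : ℕ}
    {ξ : Fin m → ℂ} (hξ : ξ ∈ radialRegion m) :
    Summable fun a => vacCoef k w j m a * ∏ i, ξ i ^ a i := by
  induction m with
  | zero => exact (hasSum_fintype _).summable
  | succ m ih =>
    refine summable_contract (vacExp k j m) hξ.1 (fun i => summable_exch hw ?_)
      (ih (radialRegion_tail hξ))
    rw [norm_div, div_lt_one (norm_pos_iff.mpr (hξ.1 0))]
    exact hξ.2 (Fin.succ_pos i)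

/-! ### Series that represent analytic multiples of a given function -/

/-- The coefficients of the series in complex powers whose sum in the domain `|ξ_1| > ⋯ > |ξ_m|` is
`Φ R` with a function `R` that is analytic in the configuration space. -/
def goodSeries {m : ℕ} (Φ : (Fin m → ℂ) → ℂ) : Submodule ℂ ((Fin m → ℂ) → ℂ) where
  carrier := {c | ∃ R : (Fin m → ℂ) → ℂ, AnalyticOnNhd ℂ R (confSpace m) ∧
    ∀ ξ ∈ radialRegion m, HasSum (fun a => c a * ∏ i, ξ i ^ a i) (Φ ξ * R ξ)}
  zero_mem' := ⟨fun _ => 0, fun _ _ => analyticAt_const, fun ξ _ => by simp⟩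
  add_mem' := by
    rintro c c' ⟨R, hR, h⟩ ⟨R', hR', h'⟩
    refine ⟨R + R', hR.add hR', fun ξ hξ => ?_⟩
    have := (h ξ hξ).add (h' ξ hξ)
    simpa only [Pi.add_apply, add_mul, mul_add] using this
  smul_mem' := by
    rintro r c ⟨R, hR, h⟩
    refine ⟨fun ξ => r * R ξ, fun ξ hξ => analyticAt_const.mul (hR ξ hξ), fun ξ hξ => ?_⟩
    have := (h ξ hξ).mul_left r
    simpa only [Pi.smul_apply, smul_eq_mul, mul_assoc, mul_left_comm r] using this

lemma radialRegion_subset_confSpace (m : ℕ) : radialRegion m ⊆ confSpace m := by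
  refine fun ξ hξ => ⟨hξ.1, fun i l hil => ?_⟩
  have h : ‖ξ i‖ ≠ ‖ξ l‖ := fun h => hil (hξ.2.injective h)
  exact ⟨fun h' => h (by rw [h']), fun h' => h (by rw [h', norm_neg])⟩

lemma radialRegion_nonempty (m : ℕ) : (radialRegion m).Nonempty := by
  refine ⟨fun i => ((m - i : ℕ) : ℂ), fun i => ?_, fun i l h => ?_⟩
  · have := i.2
    exact Nat.cast_ne_zero.mpr (by omega)
  · simp only [Complex.norm_natCast, Nat.cast_lt]
    have := l.2
    have : (i : ℕ) < l := h
    omega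

lemma analyticAt_apply {m : ℕ} (i : Fin m) (ξ : Fin m → ℂ) :
    AnalyticAt ℂ (fun ξ : Fin m → ℂ => ξ i) ξ :=
  (ContinuousLinearMap.proj i : (Fin m → ℂ) →L[ℂ] ℂ).analyticAt ξ

lemma prod_cpow_add_intCast {m : ℕ} {ξ : Fin m → ℂ} (hξ : ∀ i, ξ i ≠ 0) (a : Fin m → ℂ)
    (p : Fin m → ℤ) : ∏ i, ξ i ^ (a i + p i) = (∏ i, ξ i ^ a i) * ∏ i, ξ i ^ p i := by
  rw [← Finset.prod_mul_distrib]
  refine Finset.prod_congr rfl fun i _ => ?_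
  rw [Complex.cpow_add _ _ (hξ i), Complex.cpow_intCast]

/-- A shift of the exponents divides the sum by the Laurent monomial `∏ ξ_i^{p_i}`. Since the `p_i`
are integers, this is single-valued and without zeros on the configuration space. -/
lemma goodSeries_shift {m : ℕ} {Φ : (Fin m → ℂ) → ℂ} {c : (Fin m → ℂ) → ℂ} (hc : c ∈ goodSeries Φ)
    (p : Fin m → ℤ) : (fun a => c fun i => a i + p i) ∈ goodSeries Φ := by
  obtain ⟨R, hR, h⟩ := hc
  refine ⟨fun ξ => R ξ * (∏ i, ξ i ^ p i)⁻¹, fun ξ hξ => (hR ξ hξ).mul (AnalyticAt.inv ?_ ?_),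
    fun ξ hξ => ?_⟩
  · exact Finset.analyticAt_fun_prod _ fun i _ => (analyticAt_apply i ξ).zpow (hξ.1 i)
  · exact Finset.prod_ne_zero_iff.mpr fun i _ => zpow_ne_zero _ (hξ.1 i)
  · have h1 := (h ξ hξ).mul_right (∏ i, ξ i ^ p i)⁻¹
    have h2 : (∏ i, ξ i ^ p i) ≠ 0 := Finset.prod_ne_zero_iff.mpr fun i _ => zpow_ne_zero _ (hξ.1 i)
    rw [← (Equiv.addRight fun i => (p i : ℂ)).hasSum_iff, mul_assoc] at h1
    convert! h1 using 1
    funext a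
    simp only [Function.comp_apply, Equiv.coe_addRight, Pi.add_apply]
    rw [prod_cpow_add_intCast hξ.1, ← mul_assoc, mul_assoc, mul_inv_cancel₀ h2, mul_one]
    rfl

/-- The exponents `a`, with `n` moved from the place `l` to the place `i`. -/
def transfer {m : ℕ} (i l : Fin m) (n : ℤ) (a : Fin m → ℂ) : Fin m → ℂ := fun q =>
  a q + ((Pi.single i n - Pi.single l n : Fin m → ℤ) q : ℂ)

lemma prod_cpow_transfer {m : ℕ} {ξ : Fin m → ℂ} (hξ : ∀ i, ξ i ≠ 0) (i l : Fin m) (n : ℤ)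
    (a : Fin m → ℂ) :
    (ξ l / ξ i) ^ n * ∏ q, ξ q ^ transfer i l n a q = ∏ q, ξ q ^ a q := by
  have h : ∀ (i : Fin m) , ∏ q, ξ q ^ (Pi.single i n : Fin m → ℤ) q = ξ i ^ n := fun i => by
    rw [Finset.prod_eq_single i]
    · simp
    · intro q _ hq; simp [hq]
    · simp
  simp only [transfer]
  rw [prod_cpow_add_intCast hξ]
  simp only [Pi.sub_apply, zpow_sub₀ (hξ _), Finset.prod_div_distrib, h]
  have := zpow_ne_zero n (hξ i)
  have := zpow_ne_zero n (hξ l)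
  rw [div_zpow]
  field_simp

lemma transfer_transfer {m : ℕ} (i l : Fin m) (n : ℤ) (a : Fin m → ℂ) :
    transfer i l (-n) (transfer i l n a) = a := by
  funext q
  simp only [transfer, Pi.single_neg, Pi.sub_apply, Pi.neg_apply]
  push_cast
  ring

lemma hasSum_transfer {m : ℕ} {c : (Fin m → ℂ) → ℂ} {ξ : Fin m → ℂ} (hξ : ξ ∈ radialRegion m)
    {x y : ℂ} {i l : Fin m} {b : ℕ → ℂ}
    (hb : HasSum (fun n => b n * (ξ l / ξ i) ^ n) y) (hc : HasSum (fun a => c a * ∏ i, ξ i ^ a i) x) :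
    HasSum (fun p : (Fin m → ℂ) × ℕ => b p.2 * c (transfer i l p.2 p.1) * ∏ i, ξ i ^ p.1 i)
      (y * x) := by
  have h0 := summable_mul_of_summable_norm hb.summable.norm hc.summable.norm
  have h1 := HasSum.mul hb hc h0
  let e : (Fin m → ℂ) × ℕ ≃ ℕ × (Fin m → ℂ) :=
    { toFun := fun p => (p.2, transfer i l p.2 p.1)
      invFun := fun p => (transfer i l (-p.1) p.2, p.1)
      left_inv := fun p => by simp [transfer_transfer]
      right_inv := fun p => by
        have := transfer_transfer i l (-p.1) p.2
        rw [neg_neg] at this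
        simp [this] }
  rw [← e.hasSum_iff] at h1
  convert! h1 using 1
  funext p
  simp only [Function.comp_apply, e, Equiv.coe_fn_mk]
  rw [← prod_cpow_transfer hξ.1 i l p.2 p.1, zpow_natCast]
  ring

/-- The double series converges absolutely at a point of the domain. Its part with fixed `a` is the
asserted series times a nonzero monomial. -/
lemma summable_transfer {m : ℕ} {Φ : (Fin m → ℂ) → ℂ} {c : (Fin m → ℂ) → ℂ} (hc : c ∈ goodSeries Φ)
    {i l : Fin m} (hil : i < l) {b : ℕ → ℂ} {B : ℂ → ℂ}
    (hb : ∀ z, ‖z‖ < 1 → HasSum (fun n => b n * z ^ n) (B z)) (a : Fin m → ℂ) :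
    Summable fun n : ℕ => b n * c (transfer i l n a) := by
  obtain ⟨R, _, h⟩ := hc
  obtain ⟨ξ, hξ⟩ := radialRegion_nonempty m
  have hz : ‖ξ l / ξ i‖ < 1 := by
    rw [norm_div, div_lt_one (norm_pos_iff.mpr (hξ.1 i))]
    exact hξ.2 hil
  have h0 := (hasSum_transfer hξ (hb _ hz) (h ξ hξ)).summable
  have h1 : Summable fun n : ℕ => b n * c (transfer i l n a) * ∏ i, ξ i ^ a i := h0.prod_factor a
  refine (summable_mul_right_iff ?_).mp h1
  exact Finset.prod_ne_zero_iff.mpr fun q _ => by simp [Complex.cpow_eq_zero_iff, hξ.1 q]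

/-- In terms of sums this is multiplication by `B(ξ_l/ξ_i)`. The order `i < l` puts the ratio inside
the unit disc, and the possible singularities of `B` at `±1` lie outside the configuration space. -/
theorem goodSeries_transfer {m : ℕ} {Φ : (Fin m → ℂ) → ℂ} {c : (Fin m → ℂ) → ℂ}
    (hc : c ∈ goodSeries Φ) {i l : Fin m} (hil : i < l) {b : ℕ → ℂ} {B : ℂ → ℂ}
    (hb : ∀ z, ‖z‖ < 1 → HasSum (fun n => b n * z ^ n) (B z))
    (hB : ∀ z, z ≠ 1 → z ≠ -1 → AnalyticAt ℂ B z) :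
    (fun a => ∑' n : ℕ, b n * c (transfer i l n a)) ∈ goodSeries Φ := by
  have hs := summable_transfer hc hil hb
  obtain ⟨R, hR, h⟩ := hc
  refine ⟨fun ξ => B (ξ l / ξ i) * R ξ, fun ξ hξ => AnalyticAt.mul ?_ (hR ξ hξ), fun ξ hξ => ?_⟩
  · refine (hB _ ?_ ?_).comp_of_eq
      ((analyticAt_apply l ξ).div (analyticAt_apply i ξ) (hξ.1 i)) rfl
    · rw [Ne, div_eq_one_iff_eq (hξ.1 i)]
      exact (hξ.2 l i hil.ne').1
    · rw [Ne, div_eq_iff (hξ.1 i), neg_one_mul]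
      exact (hξ.2 l i hil.ne').2
  · have hz : ‖ξ l / ξ i‖ < 1 := by
      rw [norm_div, div_lt_one (norm_pos_iff.mpr (hξ.1 i))]
      exact hξ.2 hil
    have h0 := hasSum_transfer hξ (hb _ hz) (h ξ hξ)
    have h2 : ∀ a, HasSum (fun n : ℕ => b n * c (transfer i l n a) * ∏ i, ξ i ^ a i)
        ((∑' n : ℕ, b n * c (transfer i l n a)) * ∏ i, ξ i ^ a i) :=
      fun a => (hs a).hasSum.mul_right _
    have h1 := h0.prod_fiberwise h2
    convert! h1 using 1
    ring

/-! The generating functions of the contractions. -/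

lemma one_sub_sq_ne_zero {z : ℂ} (h1 : z ≠ 1) (h2 : z ≠ -1) : 1 - z ^ 2 ≠ 0 := by
  intro h
  have : (1 - z) * (1 + z) = 0 := by linear_combination h
  rcases mul_eq_zero.mp this with h | h
  · exact h1 (by linear_combination -h)
  · exact h2 (by linear_combination h)

lemma chi_two (n : ℕ) : chi 2 n = (1 - (-1) ^ n) / 2 := by
  rcases Nat.even_or_odd n with h | h
  · simp [chi, h.neg_one_pow, h]
  · rw [h.neg_one_pow, chi, if_pos]
    · norm_num
    · simpa using h

lemma hasSum_odd {z : ℂ} (hz : ‖z‖ < 1) : HasSum (fun n : ℕ => chi 2 n * z ^ n) (z / (1 - z ^ 2)) := by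
  have hz' : ‖-z‖ < 1 := by rwa [norm_neg]
  have h1 : 1 - z ≠ 0 := fun h => by rw [← sub_eq_zero.mp h, norm_one] at hz; exact lt_irrefl _ hz
  have h2 : 1 - -z ≠ 0 := fun h => by rw [← sub_eq_zero.mp h, norm_one] at hz'; exact lt_irrefl _ hz'
  have h := ((hasSum_geometric_of_norm_lt_one hz).sub (hasSum_geometric_of_norm_lt_one hz')).div_const 2
  convert! h using 1
  · funext n
    rw [chi_two, neg_pow]; ring
  · rw [show 1 - z ^ 2 = (1 - z) * (1 - -z) by ring]
    field_simp
    ring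

lemma hasSum_odd_mul {z : ℂ} (hz : ‖z‖ < 1) :
    HasSum (fun n : ℕ => (n * chi 2 n) * z ^ n) (z * (1 + z ^ 2) / (1 - z ^ 2) ^ 2) := by
  have hz' : ‖-z‖ < 1 := by rwa [norm_neg]
  have h1 : 1 - z ≠ 0 := fun h => by rw [← sub_eq_zero.mp h, norm_one] at hz; exact lt_irrefl _ hz
  have h2 : 1 - -z ≠ 0 := fun h => by rw [← sub_eq_zero.mp h, norm_one] at hz'; exact lt_irrefl _ hz'
  have h := ((hasSum_coe_mul_geometric_of_norm_lt_one hz).sub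
    (hasSum_coe_mul_geometric_of_norm_lt_one hz')).div_const 2
  convert! h using 1
  · funext n
    rw [chi_two, neg_pow]; ring
  · rw [show 1 - z ^ 2 = (1 - z) * (1 - -z) by ring]
    field_simp
    ring

lemma analyticAt_odd {z : ℂ} (h1 : z ≠ 1) (h2 : z ≠ -1) :
    AnalyticAt ℂ (fun z : ℂ => z / (1 - z ^ 2)) z :=
  analyticAt_id.div (analyticAt_const.sub (analyticAt_id.pow 2)) (one_sub_sq_ne_zero h1 h2)

lemma analyticAt_odd_mul {z : ℂ} (h1 : z ≠ 1) (h2 : z ≠ -1) :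
    AnalyticAt ℂ (fun z : ℂ => z * (1 + z ^ 2) / (1 - z ^ 2) ^ 2) z :=
  (analyticAt_id.mul (analyticAt_const.add (analyticAt_id.pow 2))).div
    ((analyticAt_const.sub (analyticAt_id.pow 2)).pow 2) (pow_ne_zero _ (one_sub_sq_ne_zero h1 h2))

/-! ### Matrix elements of products of vertex operators with insertions -/

/-- The matrix element between vacua of a product of vertex operators with insertions. -/
def vacSlot (k j : ℂ) {m : ℕ} (α : Fin m → Fin 3 → ℂ) (s : Fin m → Bool) (a : Fin m → ℂ) : ℂ :=
  coord (j - 2 * m) 0 (prodSlot k α s a (vac j))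

open Classical in
/-- The contraction of the mode `φ_{2,n}` of the insertion at the place `i` with the place `l`. -/
def slotContraction (k j : ℂ) {m : ℕ} (α : Fin m → Fin 3 → ℂ) (s : Fin m → Bool) (i l : Fin m)
    (a : Fin m → ℂ) (n : ℤ) : ℂ :=
  α l 2 * kap k 2 * (chi 2 n * vacSlot k j α (Function.update s i false) (transfer i l n a)) +
    (if s l = true then kap k 2 else 0) * (n * chi 2 n *
      vacSlot k j α (Function.update (Function.update s i false) l false) (transfer i l n a))

lemma update_transfer {m : ℕ} {i l : Fin m} (h : l ≠ i) (a : Fin m → ℂ) (n : ℤ) :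
    Function.update (Function.update a i (a i + n)) l (a l - n) = transfer i l n a := by
  funext q
  by_cases h1 : q = l
  · subst h1
    simp [transfer, h]; ring
  · rw [Function.update_of_ne h1]
    by_cases h2 : q = i
    · subst h2
      simp [transfer, h1]
    · simp [transfer, h1, h2]

lemma coord_update_cm (k j : ℂ) {m : ℕ} (α : Fin m → Fin 3 → ℂ) (s : Fin m → Bool) {i l : Fin m}
    (h : l ≠ i) (a : Fin m → ℂ) (n : ℤ) :
    coord (j - 2 * m) 0 (prodOp (Function.update (fun q => slot k (α q) (Function.update s i false q)
      (Function.update a i (a i + n) q)) l (cm (mode k 2 n) (slot k (α l)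
        (Function.update s i false l) (Function.update a i (a i + n) l)))) (vac j)) =
      slotContraction k j α s i l a n := by
  classical
  rw [cm_mode_slot, prodOp_update_add, prodOp_update_smul, prodOp_update_smul, prodSlot_update,
    prodSlot_update, Function.update_eq_self, Function.update_of_ne h, Function.update_of_ne h,
    update_transfer h, LinearMap.add_apply, map_add, LinearMap.smul_apply, map_smul,
    LinearMap.smul_apply, map_smul, slotContraction, vacSlot, vacSlot, smul_eq_mul, smul_eq_mul]
  simp only [true_and]
  split_ifs <;> ring

/-- The insertion at `i` is expanded into modes inside the product. Only finitely many modes matter,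
since the expansion is locally finite on the vector produced by the factors to the right of `i`. -/
lemma exists_vacSlot_insert (k j : ℂ) {m : ℕ} (α : Fin m → Fin 3 → ℂ) {s : Fin m → Bool} {i : Fin m}
    (hs : s i = true) (a : Fin m → ℂ) :
    vacSlot k j α s a = ∑ᶠ n : ℤ, coord (j - 2 * m) 0 (prodOp (Function.update
        (fun q => slot k (α q) (s q) (a q)) i
          (insertTerm k 2 (α i) (a i - 2 / (k + 2)) n)) (vac j)) ∧
    {n : ℤ | coord (j - 2 * m) 0 (prodOp (Function.update (fun q => slot k (α q) (s q) (a q)) i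
          (insertTerm k 2 (α i) (a i - 2 / (k + 2)) n)) (vac j)) ≠ 0}.Finite := by
  obtain ⟨L, R, h⟩ := exists_prodOp_update (fun q => slot k (α q) (s q) (a q)) i
  have hf := insertTerm_locFin k 2 (α i) (a i - 2 / (k + 2)) (R (vac j))
  have h0 : prodSlot k α s a = L * vertexInsert k 2 (α i) (a i - 2 / (k + 2)) * R := by
    rw [← h, ← slot_true, ← hs, Function.update_eq_self, prodSlot]
  simp only [h, Module.End.mul_apply]
  constructor
  · rw [vacSlot, h0, Module.End.mul_apply, Module.End.mul_apply, vertexInsert_apply,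
      ← LinearMap.comp_apply, map_finsum _ hf]
    rfl
  · refine hf.subset fun n hn h0 => hn ?_
    rw [h0, map_zero, map_zero]

lemma chi_two_zero : chi 2 (0 : ℤ) = 0 := by simp [chi]

lemma slotContraction_zero (k j : ℂ) {m : ℕ} (α : Fin m → Fin 3 → ℂ) (s : Fin m → Bool) (i l : Fin m)
    (a : Fin m → ℂ) : slotContraction k j α s i l a 0 = 0 := by
  simp [slotContraction, chi_two_zero]

/-- The contribution of `φ_{2,n}` in the insertion at the place `i`. -/
lemma coord_update_insertTerm (k j : ℂ) {m : ℕ} (α : Fin m → Fin 3 → ℂ) {s : Fin m → Bool} (i : Fin m)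
    (a : Fin m → ℂ) (n : ℤ) :
    coord (j - 2 * m) 0 (prodOp (Function.update (fun q => slot k (α q) (s q) (a q)) i
      (insertTerm k 2 (α i) (a i - 2 / (k + 2)) n)) (vac j)) =
    ∑ l, if n < 0 then (if l < i then -slotContraction k j α s i l a n else 0)
      else if i < l then slotContraction k j α s i l a n else 0 := by
  let X := fun q => slot k (α q) (Function.update s i false q) (Function.update a i (a i + n) q)
  have hX : ∀ Y, Function.update (fun q => slot k (α q) (s q) (a q)) i Y = Function.update X i Y := by
    intro Y
    funext q
    by_cases h : q = i
    · subst h; simp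
    · simp [X, h]
  have hi : vertex k (α i) (a i - 2 / (k + 2) + n) = X i := by
    simp only [X, Function.update_self, slot_false]
    rw [add_sub_shift]
  rw [hX, insertTerm, hi]
  have hl : ∀ l, l ≠ i → coord (j - 2 * m) 0 (prodOp (Function.update X l
      (cm (mode k 2 n) (X l))) (vac j)) = slotContraction k j α s i l a n :=
    fun l h => coord_update_cm k j α s h a n
  split_ifs with hn
  -- A negative mode is moved to the far left, where the dual vacuum kills it. Minus the commutators
  -- with the places before `i` remain.
  · have h1 := congrArg (fun T : Op => coord (j - 2 * m) 0 (T (vac j))) (mul_prodOp (mode k 2 n) X i)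
    simp only [Module.End.mul_apply, coord_mode_neg k 2 hn, LinearMap.add_apply, map_add,
      LinearMap.sum_apply, map_sum] at h1
    rw [eq_neg_of_add_eq_zero_left h1.symm, ← Finset.sum_neg_distrib]
    refine Finset.sum_congr rfl fun l _ => ?_
    split_ifs with h2
    · rw [hl l h2.ne]
    · simp
  -- A mode with `n ≥ 0` is moved to the far right and kills the vacuum, as `φ_2` has no zero mode.
  -- The commutators with the places after `i` remain.
  · have h1 := congrArg (fun T : Op => coord (j - 2 * m) 0 (T (vac j)))
      (prodOp_update_mul (mode k 2 n) X i)
    have h2 : mode k 2 n (vac j) = 0 := by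
      rcases (not_lt.mp hn).lt_or_eq with h | h
      · exact mode_vac k 2 h j
      · rw [← h, mode_zero_of_ne k (by decide), LinearMap.zero_apply]
    simp only [LinearMap.add_apply, map_add, LinearMap.sum_apply, map_sum] at h1
    rw [Module.End.mul_apply, h2, map_zero, map_zero, zero_add] at h1
    rw [h1]
    refine Finset.sum_congr rfl fun l _ => ?_
    split_ifs with h2
    · rw [hl l h2.ne']
    · simp

lemma transfer_neg {m : ℕ} (i l : Fin m) (n : ℤ) (a : Fin m → ℂ) :
    transfer i l (-n) a = transfer l i n a := by
  funext q
  simp only [transfer, Pi.single_neg, Pi.sub_apply, Pi.neg_apply]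
  push_cast
  ring

lemma neg_natCast_injective : Function.Injective fun p : ℕ => -(p : ℤ) := fun p q h => by
  simpa using h

open Classical in
/-- The sum over `n` of the contractions of the insertion at `i` with the place `l`. -/
def contractionSum (k j : ℂ) {m : ℕ} (α : Fin m → Fin 3 → ℂ) (s : Fin m → Bool) (i l : Fin m)
    (a : Fin m → ℂ) : ℂ :=
  if l < i then -(α l 2 * kap k 2) *
      ∑' n : ℕ, chi 2 n * vacSlot k j α (Function.update s i false) (transfer l i n a) +
    (if s l = true then kap k 2 else 0) * ∑' n : ℕ, n * chi 2 n *
      vacSlot k j α (Function.update (Function.update s i false) l false) (transfer l i n a)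
  else if i < l then (α l 2 * kap k 2) *
      ∑' n : ℕ, chi 2 n * vacSlot k j α (Function.update s i false) (transfer i l n a) +
    (if s l = true then kap k 2 else 0) * ∑' n : ℕ, n * chi 2 n *
      vacSlot k j α (Function.update (Function.update s i false) l false) (transfer i l n a)
  else 0

section

variable {k j : ℂ} {m : ℕ} {α : Fin m → Fin 3 → ℂ} {s : Fin m → Bool} {i : Fin m}
  {Φ : (Fin m → ℂ) → ℂ}

/-- The place `l` meets only the negative modes if it precedes `i` and only the others if it
follows. Either way the powers of the smaller coordinate over the larger one appear, and
`summable_transfer` applies. -/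
lemma hasSum_contraction (h1 : vacSlot k j α (Function.update s i false) ∈ goodSeries Φ)
    (h2 : ∀ l, vacSlot k j α (Function.update (Function.update s i false) l false) ∈ goodSeries Φ)
    (l : Fin m) (a : Fin m → ℂ) :
    HasSum (fun n : ℤ => if n < 0 then (if l < i then -slotContraction k j α s i l a n else 0)
      else if i < l then slotContraction k j α s i l a n else 0) (contractionSum k j α s i l a) := by
  rcases lt_trichotomy l i with h | h | h
  · simp only [if_pos h, if_neg h.not_gt, contractionSum]
    have e1 := (summable_transfer h1 h (b := fun n => chi 2 n) (fun z hz => hasSum_odd hz) a).hasSum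
    have e2 := (summable_transfer (h2 l) h (b := fun n => n * chi 2 n)
      (fun z hz => hasSum_odd_mul hz) a).hasSum
    -- With `n = -p` the transfer from `l` to `i` becomes a transfer by `p` from `i` to `l`. In the
    -- double contraction the sign of `n` cancels the minus sign, which is why only the first term
    -- of `contractionSum` changes sign.
    rw [← neg_natCast_injective.hasSum_iff]
    · convert! (e1.mul_left (-(α l 2 * kap k 2))).add
        (e2.mul_left (if s l = true then kap k 2 else 0)) using 1
      funext n
      simp only [Function.comp_apply]
      have h0 : (if -(n : ℤ) < 0 then -slotContraction k j α s i l a (-n) else 0) =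
          -slotContraction k j α s i l a (-n) := by
        split_ifs with h
        · rfl
        · obtain rfl : n = 0 := by omega
          rw [Nat.cast_zero, neg_zero, slotContraction_zero, neg_zero]
      rw [h0, slotContraction, transfer_neg, chi_neg]
      push_cast
      ring
    · intro n hn
      rw [if_neg]
      intro h
      exact hn ⟨n.natAbs, by simp only; omega⟩
  · subst h
    simp [contractionSum]
  · simp only [if_pos h, if_neg h.not_gt, contractionSum]
    have e1 := (summable_transfer h1 h (b := fun n => chi 2 n) (fun z hz => hasSum_odd hz) a).hasSum
    have e2 := (summable_transfer (h2 l) h (b := fun n => n * chi 2 n)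
      (fun z hz => hasSum_odd_mul hz) a).hasSum
    rw [← (Nat.cast_injective (R := ℤ)).hasSum_iff]
    · convert! (e1.mul_left (α l 2 * kap k 2)).add
        (e2.mul_left (if s l = true then kap k 2 else 0)) using 1
    · intro n hn
      rw [if_pos]
      by_contra h
      exact hn ⟨n.natAbs, by omega⟩

/-- This is Wick's theorem for the insertion at `i`: the expectation value is the sum of its
contractions with the other places. -/
lemma vacSlot_eq_sum (hs : s i = true)
    (h1 : vacSlot k j α (Function.update s i false) ∈ goodSeries Φ)
    (h2 : ∀ l, vacSlot k j α (Function.update (Function.update s i false) l false) ∈ goodSeries Φ) :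
    vacSlot k j α s = ∑ l, contractionSum k j α s i l := by
  funext a
  obtain ⟨e1, e2⟩ := exists_vacSlot_insert k j α hs a
  -- The sum over the modes is finite as a whole but need not be so for each place `l`. To exchange
  -- it with the sum over `l` it is rewritten as an unconditional sum.
  rw [e1, ← tsum_eq_finsum (L := SummationFilter.unconditional ℤ) e2, Finset.sum_apply]
  simp only [coord_update_insertTerm]
  exact (hasSum_sum fun l _ => hasSum_contraction h1 h2 l a).tsum_eq

/-- The contractions have the generating functions `z/(1-z²)` and `z(1+z²)/(1-z²)²` in a ratio of
two coordinates. Their only poles are at `z = ±1`. -/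
lemma contractionSum_mem (h1 : vacSlot k j α (Function.update s i false) ∈ goodSeries Φ)
    (h2 : ∀ l, vacSlot k j α (Function.update (Function.update s i false) l false) ∈ goodSeries Φ)
    (l : Fin m) : contractionSum k j α s i l ∈ goodSeries Φ := by
  have key : ∀ {p q : Fin m}, p < q → ∀ x y : ℂ, (fun a => x *
      ∑' n : ℕ, chi 2 n * vacSlot k j α (Function.update s i false) (transfer p q n a) +
    y * ∑' n : ℕ, n * chi 2 n * vacSlot k j α (Function.update (Function.update s i false) l false)
      (transfer p q n a)) ∈ goodSeries Φ := fun h x y =>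
    (goodSeries Φ).add_mem ((goodSeries Φ).smul_mem x (goodSeries_transfer h1 h
      (b := fun n => chi 2 n) (fun z hz => hasSum_odd hz) fun z => analyticAt_odd))
      ((goodSeries Φ).smul_mem y (goodSeries_transfer (h2 l) h (b := fun n => n * chi 2 n)
        (fun z hz => hasSum_odd_mul hz) fun z => analyticAt_odd_mul))
  unfold contractionSum
  rcases lt_trichotomy l i with h | h | h
  · simp only [if_pos h]
    exact key h _ _
  · subst h
    simp only [lt_irrefl, if_false]
    exact (goodSeries Φ).zero_mem
  · simp only [if_pos h, if_neg h.not_gt]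
    exact key h _ _

end

/-- If the matrix element without insertions is represented by an analytic multiple of `Φ`, so are
those with insertions. -/
theorem vacSlot_mem {k j : ℂ} {m : ℕ} {α : Fin m → Fin 3 → ℂ} {Φ : (Fin m → ℂ) → ℂ}
    (h : vacSlot k j α (fun _ => false) ∈ goodSeries Φ) (s : Fin m → Bool) :
    vacSlot k j α s ∈ goodSeries Φ := by
  -- The induction is on a bound for the number of insertions, not on the number itself: a
  -- contraction removes one insertion or two.
  suffices ∀ N : ℕ, ∀ s : Fin m → Bool, (Finset.univ.filter fun i => s i = true).card ≤ N →
      vacSlot k j α s ∈ goodSeries Φ from this _ s le_rfl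
  intro N
  have hup : ∀ (s : Fin m → Bool) (i : Fin m), (Finset.univ.filter fun q =>
      Function.update s i false q = true) = (Finset.univ.filter fun q => s q = true).erase i := by
    intro s i
    ext q
    by_cases hq : q = i
    · subst hq; simp
    · simp [hq]
  induction N with
  | zero =>
    intro s hs
    convert h
    rename_i i
    have := Finset.card_eq_zero.mp (Nat.le_zero.mp hs)
    have h1 : i ∉ Finset.univ.filter fun i => s i = true := by rw [this]; simp
    simpa using h1
  | succ N ih =>
    intro s hs
    by_cases h0 : ∃ i, s i = true
    · obtain ⟨i, hi⟩ := h0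
      have hc : (Finset.univ.filter fun q => Function.update s i false q = true).card ≤ N := by
        rw [hup, Finset.card_erase_of_mem (by simpa using hi)]
        omega
      have h1 := ih _ hc
      have h2 : ∀ l, vacSlot k j α (Function.update (Function.update s i false) l false) ∈
          goodSeries Φ := fun l => ih _ (by
        rw [hup]
        exact (Finset.card_erase_le).trans hc)
      rw [vacSlot_eq_sum hi h1 h2]
      exact Submodule.sum_mem _ fun l _ => contractionSum_mem h1 h2 l
    · convert h
      rename_i i
      push Not at h0
      simpa using h0 i

/-! ### The common multivalued factor of all matrix elements -/

/-- The matrix element of a product of `m` vertex operators between vacua. -/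
def corrBase (k j : ℂ) (m : ℕ) (ξ : Fin m → ℂ) : ℂ :=
  ∑' a, vacCoef k (pairing k (sExp k) (sExp k)) j m a * ∏ i, ξ i ^ a i

lemma exists_pairing_bound (k : ℂ) (α β : Fin 3 → ℂ) : ∃ K : ℕ, ∀ n, ‖pairing k α β n‖ ≤ K + 1 := by
  obtain ⟨K, hK⟩ := exists_nat_ge (∑ c, ‖α c * β c * kap k c‖)
  refine ⟨K, fun n => ?_⟩
  refine (norm_sum_le _ _).trans ((Finset.sum_le_sum fun c _ => ?_).trans (hK.trans (by linarith)))
  rw [norm_mul]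
  refine mul_le_of_le_one_right (norm_nonneg _) ?_
  unfold chi
  split_ifs <;> simp

theorem vacSlot_mem_corrBase {k : ℂ} (hk2 : k ≠ -2) (j : ℂ) {m : ℕ} {α : Fin m → Fin 3 → ℂ}
    (hα : Admissible k α) (s : Fin m → Bool) : vacSlot k j α s ∈ goodSeries (corrBase k j m) := by
  refine vacSlot_mem ⟨fun _ => 1, fun _ _ => analyticAt_const, fun ξ hξ => ?_⟩ s
  obtain ⟨K, hK⟩ := exists_pairing_bound k (sExp k) (sExp k)
  simp only [vacSlot, coord_prodSlot_vac hk2 hα, mul_one]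
  exact (summable_vacCoef k j hK hξ).hasSum

/-- All matrix elements of admissible products are represented by analytic multiples of `corrBase`. -/
theorem coord_prodSlot_mem {k : ℂ} (hk0 : k ≠ 0) (hk2 : k ≠ -2) (j : ℂ) {m : ℕ}
    {α : Fin m → Fin 3 → ℂ} (hα : Admissible k α) (s : Fin m → Bool) (d : Osc →₀ ℕ) {v : FockSum}
    (hv : v ∈ fock j) :
    (fun a => coord (j - 2 * m) d (prodSlot k α s a v)) ∈ goodSeries (corrBase k j m) := by
  -- Integer shifts of the exponents are included because a commutator with `φ_{i,n}` lowers one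
  -- exponent by `n`. With them the span is stable under the commutators required by `reduction`.
  let f : (Fin m → Bool) × (Fin m → ℤ) → (Fin m → ℂ) → Op := fun p a =>
    prodSlot k α p.1 fun i => a i + p.2 i
  let S : Submodule ℂ ((Fin m → ℂ) → Op) := Submodule.span ℂ (range f)
  have hf : ∀ p, f p ∈ S := fun p => Submodule.subset_span ⟨p, rfl⟩
  have h := reduction hk0 hk2 (S := S) (N := goodSeries (corrBase k j m)) ?_ (j := j)
    (j' := j - 2 * m) ?_ (f (s, 0)) (hf _) d v hv
  · simpa [f] using h
  · intro Y hY i n _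
    induction hY using Submodule.span_induction with
    | mem Y hY =>
      obtain ⟨p, rfl⟩ := hY
      have e : (fun a => cm (mode k i n) (f p a)) = ∑ l, ((α l i * kap k i * chi i n) •
          f (p.1, p.2 - (Pi.single l n : Fin m → ℤ)) +
          (if i = 2 ∧ p.1 l = true then kap k i * n * chi i n else 0) •
            f (Function.update p.1 l false, p.2 - (Pi.single l n : Fin m → ℤ))) := by
        funext a
        have hu : ∀ l, Function.update (fun q => a q + (p.2 q : ℂ)) l (a l + p.2 l - n) =
            fun q => a q + ((p.2 - (Pi.single l n : Fin m → ℤ)) q : ℂ) := by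
          intro l
          funext q
          by_cases hq : q = l
          · subst hq; simp; ring
          · simp [hq]
        simp only [f, cm_mode_prodSlot, Finset.sum_apply, Pi.add_apply, Pi.smul_apply, hu]
      rw [e]
      exact Submodule.sum_mem _ fun l _ => S.add_mem (S.smul_mem _ (hf _)) (S.smul_mem _ (hf _))
    | zero =>
      simp only [Pi.zero_apply, cm_zero]
      exact S.zero_mem
    | add Y Z _ _ hY hZ =>
      simp only [Pi.add_apply, cm_add]
      exact S.add_mem hY hZ
    | smul c Y _ hY =>
      simp only [Pi.smul_apply, cm_smul]
      exact S.smul_mem c hY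
  · intro Y hY
    induction hY using Submodule.span_induction with
    | mem Y hY =>
      obtain ⟨p, rfl⟩ := hY
      exact goodSeries_shift (vacSlot_mem_corrBase hk2 j hα p.1) p.2
    | zero => 
      simp only [Pi.zero_apply, LinearMap.zero_apply, map_zero]
      exact Submodule.zero_mem _
    | add Y Z _ _ hY hZ =>
      simp only [Pi.add_apply, LinearMap.add_apply, map_add]
      exact Submodule.add_mem _ hY hZ
    | smul c Y _ hY =>
      simp only [Pi.smul_apply, LinearMap.smul_apply, map_smul]
      exact Submodule.smul_mem _ c hY

/-! ### Products of screening currents -/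

/-- The coefficients of `S(ξ_1) ⋯ S(ξ_m)`. -/
def scrProd (k : ℂ) {m : ℕ} (a : Fin m → ℂ) : Op := prodOp fun i => screening k (a i)

lemma scrProd_eq (k : ℂ) {m : ℕ} (a : Fin m → ℂ) :
    scrProd k a = (1 / 2 : ℂ) ^ m • prodSlot k (fun _ => sExp k) (fun _ => true) a :=
  prodOp_smul _ _

lemma admissible_sExp (k : ℂ) (m : ℕ) : Admissible k fun _ : Fin m => sExp k :=
  ⟨fun _ => rfl, fun _ _ _ => rfl⟩

/-- The components of a potential along `φ_0` and `φ_2` are invisible to the factors `S`, whose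
exponents lie along `φ_1`. Therefore one `S` may be replaced by a potential without changing any
contraction of exponentials. -/
lemma pairing_sExp_wExp (k ε : ℂ) : pairing k (sExp k) (wExp k ε) = pairing k (sExp k) (sExp k) := by
  funext n
  simp [pairing, Fin.sum_univ_three, sExp, wExp]

lemma pairing_comm (k : ℂ) (α β : Fin 3 → ℂ) : pairing k α β = pairing k β α := by
  funext n
  exact Finset.sum_congr rfl fun c _ => by ring

lemma admissible_update (k ε : ℂ) {m : ℕ} (i : Fin m) :
    Admissible k (Function.update (fun _ : Fin m => sExp k) i (wExp k ε)) := by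
  constructor
  · intro l
    by_cases h : l = i
    · subst h; simp [wExp]
    · simp [h, sExp]
  · intro l q hlq
    by_cases h : l = i
    · subst h
      rw [Function.update_self, Function.update_of_ne hlq.symm, pairing_comm, pairing_sExp_wExp]
    · rw [Function.update_of_ne h]
      by_cases h' : q = i
      · subst h'; rw [Function.update_self, pairing_sExp_wExp]
      · rw [Function.update_of_ne h']

section

variable {k : ℂ} (hk0 : k ≠ 0) (hk2 : k ≠ -2) (j : ℂ)

include hk0 hk2

theorem coord_scrProd_mem {m : ℕ} (d : Osc →₀ ℕ) {v : FockSum} (hv : v ∈ fock j) :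
    (fun a : Fin m → ℂ => coord (j - 2 * m) d (scrProd k a v)) ∈ goodSeries (corrBase k j m) := by
  simp only [scrProd_eq, LinearMap.smul_apply, map_smul]
  exact (goodSeries _).smul_mem _
    (coord_prodSlot_mem hk0 hk2 j (admissible_sExp k m) (fun _ => true) d hv)

theorem coord_update_potential_mem {m : ℕ} (ε : ℂ) (i : Fin m) (n : ℤ) (d : Osc →₀ ℕ) {v : FockSum}
    (hv : v ∈ fock j) : (fun a : Fin m → ℂ => coord (j - 2 * m) d
      (prodOp (Function.update (fun l => screening k (a l)) i (potential k ε (a i - n))) v)) ∈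
      goodSeries (corrBase k j m) := by
  have h := goodSeries_shift (coord_prodSlot_mem hk0 hk2 j (admissible_update k ε i)
    (Function.update (fun _ => true) i false) d hv) (Pi.single i (-n))
  -- Every factor `S` contributes `1/2`, but the potential at the place `i` does not; the factor `2`
  -- corrects this.
  have h2 := (goodSeries (corrBase k j m)).smul_mem ((1 / 2 : ℂ) ^ m * 2) h
  convert h2 using 1
  funext a
  have e : prodOp (Function.update (fun l => screening k (a l)) i (potential k ε (a i - n))) =
      ((1 / 2 : ℂ) ^ m * 2) • prodSlot k (Function.update (fun _ => sExp k) i (wExp k ε))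
        (Function.update (fun _ => true) i false)
          (fun l => a l + ((Pi.single i (-n) : Fin m → ℤ) l : ℂ)) := by
    let Y : Fin m → Op := fun q => slot k (Function.update (fun _ => sExp k) i (wExp k ε) q)
      (Function.update (fun _ => true) i false q) (a q + ((Pi.single i (-n) : Fin m → ℤ) q : ℂ))
    have hY : (2 : ℂ) • prodOp Y = prodOp (Function.update Y i ((2 : ℂ) • Y i)) := by
      rw [prodOp_update_smul, Function.update_eq_self]
    rw [mul_smul]
    change _ = (1 / 2 : ℂ) ^ m • (2 : ℂ) • prodOp Y
    rw [hY, ← prodOp_smul]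
    congr 1
    funext q
    by_cases hq : q = i
    · subst hq
      rw [Function.update_self, Function.update_self, smul_smul]
      simp only [Y, Function.update_self, slot_false, Pi.single_eq_same, potential_eq]
      norm_num
      rfl
    · rw [Function.update_of_ne hq, Function.update_of_ne hq]
      simp only [Y, Function.update_of_ne hq, Pi.single_eq_of_ne hq, Int.cast_zero, add_zero]
      rfl
  rw [e]
  simp only [LinearMap.smul_apply, map_smul, Pi.smul_apply]

end

/-! ### Exactness of the commutators with the currents -/

/-- The commutator of `T` with `S(ξ_1) ⋯ S(ξ_m)` is a sum of total derivatives of series that are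
represented by analytic multiples of `corrBase`. -/
def IsExact (k j : ℂ) (m : ℕ) (T : Op) : Prop :=
  ∀ d, ∀ v ∈ fock j, ∃ c : Fin m → (Fin m → ℂ) → ℂ, (∀ i, c i ∈ goodSeries (corrBase k j m)) ∧
    ∀ a, coord (j - 2 * m) d (cm T (scrProd k a) v) = ∑ i, a i * c i a

lemma coord_cm_scrProd (k j : ℂ) {m : ℕ} (T : Op) (d : Osc →₀ ℕ) (a : Fin m → ℂ) (v : FockSum) :
    coord (j - 2 * m) d (cm T (scrProd k a) v) = ∑ i, coord (j - 2 * m) d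
      (prodOp (Function.update (fun l => screening k (a l)) i (cm T (screening k (a i)))) v) := by
  rw [scrProd, cm_prodOp, LinearMap.sum_apply, map_sum]

section

variable {k : ℂ} (hk0 : k ≠ 0) (hk2 : k ≠ -2) (j : ℂ) (m : ℕ)

include hk0 hk2

theorem isExact_betaField (n : ℤ) : IsExact k j m (coeffMode (betaField k) n) := by
  intro d v _
  refine ⟨0, fun i => (goodSeries _).zero_mem, fun a => ?_⟩
  rw [coord_cm_scrProd]
  refine Finset.sum_congr rfl fun i _ => ?_
  have h : cm (coeffMode (betaField k) n) (screening k (a i)) = (0 : ℂ) • 0 := by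
    rw [smul_zero]
    exact congrFun (congrFun (bracket_betaField_screening hk0 hk2) _) _
  rw [h, prodOp_update_smul, zero_smul]
  simp

/-- Each `[x_n, S_{a_i}]` contains the factor `a_i` from the total derivative, and the remaining
product with a potential at the place `i` is represented by an analytic multiple of `corrBase`. -/
theorem isExact_xField (n : ℤ) : IsExact k j m (coeffMode (xField k) n) := by
  intro d v hv
  refine ⟨fun i => ((k + 2) / 2) • ((-1 : ℂ) • (fun a => coord (j - 2 * m) d
      (prodOp (Function.update (fun l => screening k (a l)) i (potential k 1 (a i - n))) v)) +
    sg n • fun a => coord (j - 2 * m) d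
      (prodOp (Function.update (fun l => screening k (a l)) i (potential k (-1) (a i - n))) v)),
    fun i => ?_, fun a => ?_⟩
  · exact (goodSeries _).smul_mem _ ((goodSeries _).add_mem
      ((goodSeries _).smul_mem _ (coord_update_potential_mem hk0 hk2 j 1 i n d hv))
      ((goodSeries _).smul_mem _ (coord_update_potential_mem hk0 hk2 j (-1) i n d hv)))
  · rw [coord_cm_scrProd]
    refine Finset.sum_congr rfl fun i _ => ?_
    rw [coeffMode, cm_xField_screening hk0 hk2, prodOp_update_smul, prodOp_update_add,
      prodOp_update_smul, prodOp_update_smul]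
    simp only [LinearMap.smul_apply, LinearMap.add_apply, map_smul, map_add, Pi.smul_apply,
      Pi.add_apply, smul_eq_mul]
    ring

/-- The prefactor `ξ^{2/(k+2)}` compensates the weight `2(k+2)α_1² = 2/(k+2)` of the exponential.
Thus `d` acts on the current as `D_ξ` without any constant. -/
theorem isExact_grading : IsExact k j m (grading k) := by
  intro d v hv
  refine ⟨fun i a => coord (j - 2 * m) d (scrProd k a v),
    fun i => coord_scrProd_mem hk0 hk2 j d hv, fun a => ?_⟩
  rw [coord_cm_scrProd]
  refine Finset.sum_congr rfl fun i _ => ?_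
  have hk' : k + 2 ≠ 0 := fun h => hk2 (eq_neg_of_add_eq_zero_left h)
  have h : cm (grading k) (screening k (a i)) = a i • screening k (a i) := by
    rw [screening_eq, cm_smul, cm_grading_vertexInsert hk2, smul_comm]
    congr 1
    simp only [sExp]
    simp
    field_simp
    ring
  rw [h, prodOp_update_smul, Function.update_eq_self]
  rfl

end

/-! ### A nonvanishing matrix element -/

/-- The oscillator `φ_{2,-1}`. -/
def oscTwo : Osc := ⟨(2, 1), by decide⟩

/-- The exponent of `S` has no `φ_2`-component, so `φ_{2,1}` commutes with the exponentials and each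
application removes one insertion, lowering its exponent by one. Testing against as many `φ_{2,-1}`
as there are insertions removes all of them and leaves no contraction between insertions. -/
lemma coord_prodSlot_oscTwo {k : ℂ} (hk0 : k ≠ 0) (hk2 : k ≠ -2) (j : ℂ) {m : ℕ} (M : ℕ) :
    ∀ (s : Fin m → Bool) (a : Fin m → ℂ), (Finset.univ.filter fun i => s i = true).card = M →
      coord (j - 2 * m) (Finsupp.single oscTwo M) (prodSlot k (fun _ => sExp k) s a (vac j)) =
        vacSlot k j (fun _ => sExp k) (fun _ => false) fun i => a i - if s i = true then 1 else 0 := by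
  induction M with
  | zero =>
    intro s a hs
    have h : s = fun _ => false := by
      funext i
      have h0 := Finset.card_eq_zero.mp hs
      have h1 : i ∉ Finset.univ.filter fun i => s i = true := by rw [h0]; simp
      simpa using h1
    subst h
    simp [vacSlot]
  | succ M ih =>
    intro s a hs
    have h1 := coord_mode_pos k oscTwo (j - 2 * m) (Finsupp.single oscTwo M)
      (prodSlot k (fun _ => sExp k) s a (vac j))
    rw [← Finsupp.single_add] at h1
    have hk := kap_ne_zero hk0 hk2 2
    have hM : ((M : ℂ) + 1) ≠ 0 := by exact_mod_cast Nat.succ_ne_zero M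
    have h2 : mode k oscTwo.1.1 oscTwo.1.2 (prodSlot k (fun _ => sExp k) s a (vac j)) =
        cm (mode k 2 1) (prodSlot k (fun _ => sExp k) s a) (vac j) := by
      rw [cm_apply, mode_vac k 2 one_pos, map_zero, sub_zero]
      rfl
    have h3 : ∀ l, coord (j - 2 * m) (Finsupp.single oscTwo M) (((sExp k 2 * kap k 2 * chi 2 1) •
        prodSlot k (fun _ => sExp k) s (Function.update a l (a l - (1 : ℤ))) +
        (if (2 : Fin 3) = 2 ∧ s l = true then kap k 2 * (1 : ℤ) * chi 2 1 else 0) •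
          prodSlot k (fun _ => sExp k) (Function.update s l false)
            (Function.update a l (a l - (1 : ℤ)))) (vac j)) = if s l = true then kap k 2 *
          vacSlot k j (fun _ => sExp k) (fun _ => false) (fun i => a i - if s i = true then 1 else 0)
            else 0 := by
      intro l
      have h4 : sExp k 2 = 0 := by simp [sExp]
      have h5 : chi 2 1 = 1 := by simp [chi]
      rw [h4, zero_mul, zero_mul, zero_smul, zero_add, h5, LinearMap.smul_apply, map_smul]
      by_cases hl : s l = true
      · rw [if_pos ⟨rfl, hl⟩, if_pos hl, ih]
        · rw [Int.cast_one, mul_one, mul_one, smul_eq_mul]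
          congr 2
          funext i
          by_cases hi : i = l
          · subst hi; simp [hl]
          · simp [hi]
        · have : (Finset.univ.filter fun q => Function.update s l false q = true) =
              (Finset.univ.filter fun q => s q = true).erase l := by
            ext q
            by_cases hq : q = l
            · subst hq; simp
            · simp [hq]
          rw [this, Finset.card_erase_of_mem (by simpa using hl), hs]
          rfl
      · rw [if_neg fun h => hl h.2, if_neg hl, zero_smul]
    -- The `M + 1` insertions contribute equally. Their number cancels the factor from
    -- differentiating the power `φ_{2,-1}^{M+1}`.
    rw [h2, cm_mode_prodSlot, LinearMap.sum_apply, map_sum, Finset.sum_congr rfl fun l _ => h3 l,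
      ← Finset.sum_filter, Finset.sum_const, hs] at h1
    simp only [Finsupp.single_eq_same, nsmul_eq_mul] at h1
    have h6 : kap k oscTwo.1.1 * oscTwo.1.2 * (M + 1) ≠ 0 := by
      refine mul_ne_zero (mul_ne_zero hk ?_) hM
      simp [oscTwo]
    refine mul_left_cancel₀ h6 (h1.symm.trans ?_)
    simp only [oscTwo]
    push_cast
    ring

/-- The matrix element of `S(ξ_1) ⋯ S(ξ_m)` between the vacuum and `φ_{2,-1}^m |j-2m,k⟩`. -/
theorem hasSum_oscTwo {k : ℂ} (hk0 : k ≠ 0) (hk2 : k ≠ -2) (j : ℂ) {m : ℕ} {ξ : Fin m → ℂ}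
    (hξ : ξ ∈ radialRegion m) :
    HasSum (fun a => coord (j - 2 * m) (Finsupp.single oscTwo m) (scrProd k a (vac j)) *
      ∏ i, ξ i ^ a i) (corrBase k j m ξ * ((1 / 2) ^ m * ∏ i, ξ i)) := by
  obtain ⟨K, hK⟩ := exists_pairing_bound k (sExp k) (sExp k)
  have h := (summable_vacCoef k j hK hξ).hasSum
  -- Each `φ_{2,-1}` comes with a factor `ξ_i`, that is, with a shift of the exponent by one.
  rw [← (Equiv.addRight fun _ => (-1 : ℂ)).hasSum_iff] at h
  convert! h.mul_right ((1 / 2) ^ m * ∏ i, ξ i) using 1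
  funext a
  have h1 : ∏ i, ξ i ^ (a i + (-1 : ℂ)) = (∏ i, ξ i ^ a i) * (∏ i, ξ i)⁻¹ := by
    rw [← Finset.prod_inv_distrib, ← Finset.prod_mul_distrib]
    refine Finset.prod_congr rfl fun i _ => ?_
    rw [Complex.cpow_add _ _ (hξ.1 i), Complex.cpow_neg_one]
  have h2 : (∏ i, ξ i) ≠ 0 := Finset.prod_ne_zero_iff.mpr fun i _ => hξ.1 i
  rw [scrProd_eq, LinearMap.smul_apply, map_smul, coord_prodSlot_oscTwo hk0 hk2 j m _ _ (by simp),
    vacSlot, coord_prodSlot_vac hk2 (admissible_sExp k m)]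
  simp only [Function.comp_apply, Equiv.coe_addRight, Pi.add_apply, h1, if_true, smul_eq_mul]
  field_simp
  simp only [sub_eq_add_neg]
  rw [mul_comm]
  rfl

/-! ### Termwise differentiation -/

lemma isOpen_radialRegion (m : ℕ) : IsOpen (radialRegion m) := by
  rw [isOpen_iff_eventually]
  rintro ξ ⟨h1, h2⟩
  have e1 : ∀ᶠ η : Fin m → ℂ in 𝓝 ξ, ∀ i, η i ≠ 0 :=
    Filter.eventually_all.mpr fun i => (continuous_apply i).continuousAt.eventually_ne (h1 i)
  have e2 : ∀ᶠ η : Fin m → ℂ in 𝓝 ξ, ∀ i l, i < l → ‖η l‖ < ‖η i‖ :=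
    Filter.eventually_all.mpr fun i => Filter.eventually_all.mpr fun l => by
      by_cases h : i < l
      · have := (continuous_apply (A := fun _ : Fin m => ℂ) l).norm.continuousAt.eventually_lt
          (continuous_apply (A := fun _ : Fin m => ℂ) i).norm.continuousAt (h2 h)
        filter_upwards [this] with η hη _ using hη
      · exact Filter.Eventually.of_forall fun _ h' => absurd h' h
  filter_upwards [e1, e2] with η h1 h2
  exact ⟨h1, fun i l h => h2 i l h⟩

/-- The corners of a square. -/
def corner (w : ℂ) (r : ℝ) (p : Bool × Bool) : ℂ :=
  w + ((if p.1 then r else -r : ℝ) : ℂ) + ((if p.2 then r else -r : ℝ) : ℂ) * Complex.I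

lemma exists_re_le_corner {w z : ℂ} {r : ℝ} (h1 : |(z - w).re| ≤ r) (h2 : |(z - w).im| ≤ r) (a : ℂ) :
    ∃ p, (z * a).re ≤ (corner w r p * a).re := by
  rw [abs_le, Complex.sub_re] at h1
  rw [abs_le, Complex.sub_im] at h2
  refine ⟨(decide (0 ≤ a.re), decide (a.im ≤ 0)), ?_⟩
  have e1 : z.re * a.re ≤ (w.re + if 0 ≤ a.re then r else -r) * a.re := by
    split_ifs with h
    · exact mul_le_mul_of_nonneg_right (by linarith) h
    · exact mul_le_mul_of_nonpos_right (by linarith) (le_of_not_ge h)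
  have e2 : (w.im + if a.im ≤ 0 then r else -r) * a.im ≤ z.im * a.im := by
    split_ifs with h
    · exact mul_le_mul_of_nonpos_right (by linarith) h
    · exact mul_le_mul_of_nonneg_right (by linarith) (le_of_not_ge h)
  simp only [corner, Complex.mul_re, Complex.add_re, Complex.add_im, Complex.ofReal_re,
    Complex.ofReal_im, Complex.mul_im, Complex.I_re, Complex.I_im, decide_eq_true_eq]
  linarith

lemma norm_corner_sub_le (w : ℂ) {r : ℝ} (hr : 0 ≤ r) (p : Bool × Bool) :
    ‖corner w r p - w‖ ≤ 2 * r := by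
  have h : ∀ b : Bool, ‖(((if b then r else -r : ℝ)) : ℂ)‖ ≤ r := by
    intro b
    rw [Complex.norm_real]
    split_ifs <;> simp [abs_of_nonneg hr]
  have e : corner w r p - w = ((if p.1 then r else -r : ℝ) : ℂ) +
    ((if p.2 then r else -r : ℝ) : ℂ) * Complex.I := by rw [corner]; ring
  rw [e]
  refine (norm_add_le _ _).trans ?_
  rw [norm_mul, Complex.norm_I, mul_one]
  linarith [h p.1, h p.2]

/-- Near a point off the cut, the powers are bounded by those at four points close to it. -/
lemma exists_cpow_bound {z : ℂ} (hz : z ∈ Complex.slitPlane) {V : Set ℂ} (hV : V ∈ 𝓝 z) :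
    ∃ y : Bool × Bool → ℂ, (∀ p, y p ∈ V) ∧ ∀ᶠ x in 𝓝 z, ∀ a : ℂ, ∃ p, ‖x ^ a‖ ≤ ‖y p ^ a‖ := by
  have hz0 := Complex.slitPlane_ne_zero hz
  have h1 : ∀ᶠ w in 𝓝 (Complex.log z), Complex.exp w ∈ V ∧ w.im ∈ Ioo (-Real.pi) Real.pi := by
    refine Filter.Eventually.and ?_ ?_
    · refine Complex.continuous_exp.continuousAt.eventually_mem ?_
      rwa [Complex.exp_log hz0]
    · refine Complex.continuous_im.continuousAt.eventually_mem (Ioo_mem_nhds ?_ ?_)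
      · rw [Complex.log_im]; exact Complex.neg_pi_lt_arg z
      · rw [Complex.log_im]
        exact lt_of_le_of_ne (Complex.arg_le_pi z) (Complex.slitPlane_arg_ne_pi hz)
  obtain ⟨ρ, hρ, h2⟩ := Metric.eventually_nhds_iff.mp h1
  have hr : 0 < ρ / 3 := by positivity
  have hc : ∀ p, dist (corner (Complex.log z) (ρ / 3) p) (Complex.log z) < ρ := fun p => by
    rw [dist_eq_norm]
    have := norm_corner_sub_le (Complex.log z) hr.le p
    linarith
  refine ⟨fun p => Complex.exp (corner (Complex.log z) (ρ / 3) p), fun p => (h2 (hc p)).1, ?_⟩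
  have h3 : ∀ᶠ x in 𝓝 z, dist (Complex.log x) (Complex.log z) < ρ / 3 :=
    (continuousAt_clog hz).eventually (Metric.ball_mem_nhds _ hr)
  filter_upwards [h3, Complex.isOpen_slitPlane.mem_nhds hz] with x hx hxs a
  rw [dist_eq_norm] at hx
  obtain ⟨p, hp⟩ := exists_re_le_corner ((Complex.abs_re_le_norm _).trans hx.le)
    ((Complex.abs_im_le_norm _).trans hx.le) a
  refine ⟨p, ?_⟩
  rw [Complex.cpow_def_of_ne_zero (Complex.slitPlane_ne_zero hxs),
    Complex.cpow_def_of_ne_zero (Complex.exp_ne_zero _), Complex.log_exp (h2 (hc p)).2.1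
      (h2 (hc p)).2.2.le, Complex.norm_exp, Complex.norm_exp]
  exact Real.exp_le_exp.mpr hp

lemma prod_update_cpow {m : ℕ} (ξ : Fin m → ℂ) (i : Fin m) (z : ℂ) (a : Fin m → ℂ) :
    ∏ q, Function.update ξ i z q ^ a q = z ^ a i * ∏ q ∈ Finset.univ.erase i, ξ q ^ a q := by
  rw [← Finset.mul_prod_erase _ _ (Finset.mem_univ i), Function.update_self]
  congr 1
  refine Finset.prod_congr rfl fun q hq => ?_
  rw [Function.update_of_ne (Finset.ne_of_mem_erase hq)]

/-- With complex exponents no single radius dominates the terms. But `|x^a| = exp (Re (a log x))`,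
and a real-linear function on a square is largest at a corner. The series at four nearby points of
the domain, all convergent, form a majorant, and Weierstrass' theorem allows termwise
differentiation. -/
theorem hasSum_mul_exponent {m : ℕ} {c : (Fin m → ℂ) → ℂ}
    (hc : ∀ ξ ∈ radialRegion m, Summable fun a => c a * ∏ i, ξ i ^ a i) {ξ : Fin m → ℂ}
    (hξ : ξ ∈ radialRegion m) {i : Fin m} (hi : ξ i ∈ Complex.slitPlane) :
    HasSum (fun a => a i * (c a * ∏ q, ξ q ^ a q)) (ξ i * deriv (fun z => ∑' a, c a *
      ∏ q, Function.update ξ i z q ^ a q) (ξ i)) := by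
  have hcont : Continuous fun z => Function.update ξ i z := continuous_const.update i continuous_id
  have hV : {z | Function.update ξ i z ∈ radialRegion m} ∈ 𝓝 (ξ i) := by
    refine hcont.continuousAt.eventually_mem ((isOpen_radialRegion m).mem_nhds ?_)
    rwa [Function.update_eq_self]
  obtain ⟨y, hy, hb⟩ := exists_cpow_bound hi hV
  obtain ⟨U, hU, hUo, hUz⟩ := eventually_nhds_iff.mp
    (hb.and (Complex.isOpen_slitPlane.mem_nhds hi))
  have hs : Summable fun a => ∑ p, ‖c a * ∏ q, Function.update ξ i (y p) q ^ a q‖ :=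
    summable_sum fun p _ => (hc _ (hy p)).norm
  have hd : ∀ a : Fin m → ℂ, ∀ z ∈ U, HasDerivAt (fun z => c a * ∏ q, Function.update ξ i z q ^ a q)
      (c a * (a i * z ^ (a i - 1) * ∏ q ∈ Finset.univ.erase i, ξ q ^ a q)) z := by
    intro a z hz
    simp only [prod_update_cpow]
    have := (hasDerivAt_id z).cpow_const (c := a i) (hU z hz).2
    simp only [id, mul_one] at this
    exact (this.mul_const _).const_mul _
  have key := Complex.hasSum_deriv_of_summable_norm (F := fun (a : Fin m → ℂ) z => c a *
    ∏ q, Function.update ξ i z q ^ a q) hs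
    (fun a z hz => (hd a z hz).differentiableAt.differentiableWithinAt) hUo ?_ hUz
  · have h2 := key.mul_left (ξ i)
    convert! h2 using 1
    funext a
    rw [(hd a _ hUz).deriv, Complex.cpow_sub _ _ (hξ.1 i), Complex.cpow_one]
    have h3 := prod_update_cpow ξ i (ξ i) a
    rw [Function.update_eq_self] at h3
    rw [h3]
    have := hξ.1 i
    field_simp
  · intro a z hz
    obtain ⟨p, hp⟩ := (hU z hz).1 (a i)
    refine le_trans ?_ (Finset.single_le_sum (f := fun p => ‖c a * ∏ q, Function.update ξ i (y p) q ^
      a q‖) (fun _ _ => norm_nonneg _) (Finset.mem_univ p))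
    simp only [prod_update_cpow, norm_mul]
    gcongr

/-- The operator `ξ_i ∂/∂ξ_i`. -/
def eulerD {m : ℕ} (i : Fin m) (h : (Fin m → ℂ) → ℂ) (ξ : Fin m → ℂ) : ℂ :=
  ξ i * fderiv ℂ h ξ (Pi.single i 1)

lemma eulerD_congr {m : ℕ} {i : Fin m} {h h' : (Fin m → ℂ) → ℂ} {ξ : Fin m → ℂ}
    (e : h =ᶠ[𝓝 ξ] h') : eulerD i h ξ = eulerD i h' ξ := by
  rw [eulerD, eulerD, e.fderiv_eq]

lemma analyticAt_eulerD {m : ℕ} (i : Fin m) {h : (Fin m → ℂ) → ℂ} {ξ : Fin m → ℂ}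
    (hh : AnalyticAt ℂ h ξ) : AnalyticAt ℂ (eulerD i h) ξ := by
  refine (analyticAt_apply i ξ).mul ?_
  exact ((ContinuousLinearMap.apply ℂ ℂ (Pi.single i (1 : ℂ) : Fin m → ℂ)).analyticAt _).comp hh.fderiv

/-- The series `∑ a_i c(a) ξ^a` is the termwise derivative. -/
theorem hasSum_eulerD {m : ℕ} {c : (Fin m → ℂ) → ℂ} {h : (Fin m → ℂ) → ℂ}
    (hc : ∀ ξ ∈ radialRegion m, HasSum (fun a => c a * ∏ i, ξ i ^ a i) (h ξ)) {ξ : Fin m → ℂ}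
    (hξ : ξ ∈ radialRegion m) {i : Fin m} (hi : ξ i ∈ Complex.slitPlane) (hh : AnalyticAt ℂ h ξ) :
    HasSum (fun a => a i * (c a * ∏ q, ξ q ^ a q)) (eulerD i h ξ) := by
  have h1 := hasSum_mul_exponent (fun ξ hξ => (hc ξ hξ).summable) hξ hi
  convert! h1 using 1
  rw [eulerD]
  congr 1
  have hcont : Continuous fun z => Function.update ξ i z := continuous_const.update i continuous_id
  have hV : ∀ᶠ z in 𝓝 (ξ i), Function.update ξ i z ∈ radialRegion m := by
    refine hcont.continuousAt.eventually_mem ((isOpen_radialRegion m).mem_nhds ?_)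
    rwa [Function.update_eq_self]
  have e : (fun z => ∑' a, c a * ∏ q, Function.update ξ i z q ^ a q) =ᶠ[𝓝 (ξ i)]
      h ∘ Function.update ξ i := by
    filter_upwards [hV] with z hz using (hc _ hz).tsum_eq
  rw [e.deriv_eq]
  have h2 : HasFDerivAt h (fderiv ℂ h ξ) (Function.update ξ i (ξ i)) := by
    rw [Function.update_eq_self]
    exact hh.differentiableAt.hasFDerivAt
  exact (h2.comp_hasDerivAt (ξ i) (hasDerivAt_update ξ i (ξ i))).deriv.symm

/-! ### Analytic continuation of identities -/

/-- By the identity theorem on a ball of analyticity, the germs at all points of the ball vanish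
together. -/
lemma eventuallyEq_zero_of_analyticAt {E : Type*} [NormedAddCommGroup E] [NormedSpace ℂ E] {f : E → ℂ}
    {p : E} (h : AnalyticAt ℂ f p) :
    ∀ᶠ q in 𝓝 p, (f =ᶠ[𝓝 q] 0 ↔ f =ᶠ[𝓝 p] 0) := by
  obtain ⟨r, hr, h1⟩ := Metric.eventually_nhds_iff_ball.mp h.eventually_analyticAt
  have hb : AnalyticOnNhd ℂ f (Metric.ball p r) := h1
  have hc : IsPreconnected (Metric.ball p r) :=
    ((convex_ball p r).isPreconnected)
  have key : ∀ q ∈ Metric.ball p r, ∀ q' ∈ Metric.ball p r, f =ᶠ[𝓝 q] 0 → f =ᶠ[𝓝 q'] 0 := by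
    intro q hq q' hq' h
    have := hb.eqOn_zero_of_preconnected_of_eventuallyEq_zero hc hq h
    exact this.eventuallyEq_of_mem (Metric.isOpen_ball.mem_nhds hq')
  filter_upwards [Metric.ball_mem_nhds p hr] with q hq
  exact ⟨key q hq p (Metric.mem_ball_self hr), key p (Metric.mem_ball_self hr) q hq⟩

/-- An identity between analytic germs persists under analytic continuation along a path. -/
theorem eventuallyEq_zero_of_path {E : Type*} [NormedAddCommGroup E] [NormedSpace ℂ E] {γ : ℝ → E}
    {f : ℝ → E → ℂ} (hγ : ContinuousOn γ (Icc 0 1)) (hf : ∀ t ∈ Icc (0 : ℝ) 1, AnalyticAt ℂ (f t) (γ t))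
    (hl : ∀ t ∈ Icc (0 : ℝ) 1, ∀ᶠ s in 𝓝[Icc 0 1] t, f s =ᶠ[𝓝 (γ s)] f t)
    (h0 : f 0 =ᶠ[𝓝 (γ 0)] 0) : f 1 =ᶠ[𝓝 (γ 1)] 0 := by
  classical
  -- Whether the germ vanishes is a locally constant function of the parameter, hence constant on
  -- the interval.
  let χ : ℝ → Bool := fun t => decide (f t =ᶠ[𝓝 (γ t)] 0)
  have hχ : ContinuousOn χ (Icc 0 1) := by
    intro t ht
    have h1 : ∀ᶠ s in 𝓝[Icc 0 1] t, χ s = χ t := by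
      filter_upwards [hl t ht, (hγ t ht).eventually (eventuallyEq_zero_of_analyticAt (hf t ht))]
        with s h1 h2
      simp only [χ, decide_eq_decide]
      rw [← h2]
      exact ⟨fun h => h1.symm.trans h, fun h => h1.trans h⟩
    exact (tendsto_const_nhds (x := χ t)).congr' (h1.mono fun _ h => h.symm)
  have h2 := (isPreconnected_Icc (a := (0 : ℝ)) (b := 1)).constant hχ
    (left_mem_Icc.mpr zero_le_one) (right_mem_Icc.mpr zero_le_one)
  have h3 : χ 1 = true := by rw [← h2]; simpa [χ] using h0
  simpa [χ] using h3

/-! ### Branches as multiples of one germ -/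

/-- The vacuum, as an element of its Fock space. -/
def vacFock (j : ℂ) : fock j := ⟨vac j, vac_mem j⟩

/-- The germ of the continuation of `corrBase`. -/
def baseGerm {j : ℂ} {m : ℕ} (B : Germs j m) (ξ : Fin m → ℂ) : ℂ :=
  B (Finsupp.single oscTwo m) (vacFock j) ξ * ((1 / 2) ^ m * ∏ i, ξ i)⁻¹

/-- The matrix element with indices `d` and `v` is `R` times `corrBase`. -/
def Represents (k j : ℂ) {m : ℕ} (d : Osc →₀ ℕ) (v : fock j) (R : (Fin m → ℂ) → ℂ) : Prop :=
  AnalyticOnNhd ℂ R (confSpace m) ∧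
    ∀ ξ ∈ radialRegion m, HasSum (corrTerm k j d v ξ) (corrBase k j m ξ * R ξ)

lemma prod_ne_zero_of_confSpace {m : ℕ} {ξ : Fin m → ℂ} (hξ : ξ ∈ confSpace m) :
    ((1 / 2 : ℂ) ^ m * ∏ i, ξ i) ≠ 0 :=
  mul_ne_zero (pow_ne_zero _ (by norm_num)) (Finset.prod_ne_zero_iff.mpr fun i _ => hξ.1 i)

lemma analyticAt_prod {m : ℕ} (ξ : Fin m → ℂ) : AnalyticAt ℂ (fun ξ : Fin m → ℂ => ∏ i, ξ i) ξ :=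
  Finset.analyticAt_fun_prod _ fun i _ => analyticAt_apply i ξ

lemma analyticAt_normalization {m : ℕ} {ξ : Fin m → ℂ} (hξ : ξ ∈ confSpace m) :
    AnalyticAt ℂ (fun ξ : Fin m → ℂ => ((1 / 2 : ℂ) ^ m * ∏ i, ξ i)⁻¹) ξ :=
  (analyticAt_const.mul (analyticAt_prod ξ)).inv (prod_ne_zero_of_confSpace hξ)

lemma analyticAt_baseGerm {j : ℂ} {m : ℕ} {B : Germs j m} {p : Fin m → ℂ} (hp : p ∈ confSpace m)
    (hB : ∀ d v, AnalyticAt ℂ (B d v) p) : AnalyticAt ℂ (baseGerm B) p :=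
  (hB _ _).mul (analyticAt_normalization hp)

lemma baseGerm_congr {j : ℂ} {m : ℕ} {B B' : Germs j m} {p : Fin m → ℂ}
    (h : ∀ d v, B d v =ᶠ[𝓝 p] B' d v) : baseGerm B =ᶠ[𝓝 p] baseGerm B' := by
  filter_upwards [h (Finsupp.single oscTwo m) (vacFock j)] with ξ hξ
  rw [baseGerm, baseGerm, hξ]

lemma analyticAt_of_isBranchAt {k j : ℂ} {m : ℕ} {p : Fin m → ℂ} {B : Germs j m}
    (hB : IsBranchAt k j p B) (d : Osc →₀ ℕ) (v : fock j) : AnalyticAt ℂ (B d v) p := by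
  obtain ⟨γ, G, -, -, -, -, h5, h6⟩ := hB
  have h := ((h6 d v).2.2 1 (right_mem_Icc.mpr zero_le_one)).1
  rw [h5] at h
  exact h.congr (h6 d v).2.1

section

variable {k : ℂ} (hk0 : k ≠ 0) (hk2 : k ≠ -2) {j : ℂ} {m : ℕ}

include hk0 hk2

theorem exists_represents (d : Osc →₀ ℕ) (v : fock j) :
    ∃ R : (Fin m → ℂ) → ℂ, Represents k j d v R :=
  coord_scrProd_mem hk0 hk2 j d v.2

/-- The identification of `corrBase` with a matrix element, up to an elementary factor. -/
lemma corrSeries_oscTwo {ξ : Fin m → ℂ} (hξ : ξ ∈ radialRegion m) :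
    corrSeries k j (Finsupp.single oscTwo m) (vacFock j) ξ * ((1 / 2) ^ m * ∏ i, ξ i)⁻¹ =
      corrBase k j m ξ := by
  have h : corrSeries k j (Finsupp.single oscTwo m) (vacFock j) ξ = _ :=
    (hasSum_oscTwo hk0 hk2 j hξ).tsum_eq
  rw [h, mul_assoc, mul_inv_cancel₀
    (prod_ne_zero_of_confSpace (radialRegion_subset_confSpace m hξ)), mul_one]

/-- Both sides agree at the start of the path, where the germs are sums of the series, and the
identity is continued. The factor `R` is single-valued and needs no continuation, so the branch of
one matrix element determines all others. -/
theorem eventuallyEq_of_isBranchAt {p : Fin m → ℂ} {B : Germs j m} (hB : IsBranchAt k j p B)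
    {d : Osc →₀ ℕ} {v : fock j} {R : (Fin m → ℂ) → ℂ} (hR : Represents k j d v R) :
    B d v =ᶠ[𝓝 p] fun ξ => baseGerm B ξ * R ξ := by
  obtain ⟨γ, G, h1, h2, h3, -, rfl, h6⟩ := hB
  have h7 := eventuallyEq_zero_of_path (f := fun t ξ => G t d v ξ - baseGerm (G t) ξ * R ξ) h1 ?_ ?_ ?_
  · filter_upwards [h7, (h6 d v).2.1, baseGerm_congr fun d v => (h6 d v).2.1] with ξ e1 e2 e3
    rw [← e2, ← e3]
    exact sub_eq_zero.mp e1
  · intro t ht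
    exact ((h6 d v).2.2 t ht).1.sub
      ((analyticAt_baseGerm (h2 t ht) fun d v => ((h6 d v).2.2 t ht).1).mul (hR.1 _ (h2 t ht)))
  · intro t ht
    filter_upwards [((h6 d v).2.2 t ht).2,
      ((h6 (Finsupp.single oscTwo m) (vacFock j)).2.2 t ht).2] with s e1 e2
    filter_upwards [e1, e2] with ξ e1 e2
    rw [e1, baseGerm, baseGerm, e2]
  · filter_upwards [(h6 d v).1, (h6 (Finsupp.single oscTwo m) (vacFock j)).1,
      (isOpen_radialRegion m).mem_nhds h3] with ξ e1 e2 hξ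
    rw [e1, baseGerm, e2, corrSeries_oscTwo hk0 hk2 hξ, corrSeries, (hR.2 ξ hξ).tsum_eq, sub_self]
    rfl

/-- The differential identity is linear in the base germ with single-valued coefficients. It holds
near the start of the path, which lies off the cuts, and persists under continuation. -/
theorem sum_eulerD_of_isBranchAt {p : Fin m → ℂ} {B : Germs j m} (hB : IsBranchAt k j p B)
    {L : Fin m → (Fin m → ℂ) → ℂ} {N : (Fin m → ℂ) → ℂ}
    (hL : ∀ i, AnalyticOnNhd ℂ (L i) (confSpace m)) (hN : AnalyticOnNhd ℂ N (confSpace m))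
    (h : ∀ ξ ∈ radialRegion m, (∀ i, ξ i ∈ Complex.slitPlane) → AnalyticAt ℂ (corrBase k j m) ξ →
      ∑ i, eulerD i (fun ξ => corrBase k j m ξ * L i ξ) ξ = corrBase k j m ξ * N ξ) :
    (fun ξ => ∑ i, eulerD i (fun ξ => baseGerm B ξ * L i ξ) ξ) =ᶠ[𝓝 p]
      fun ξ => baseGerm B ξ * N ξ := by
  obtain ⟨γ, G, h1, h2, h3, h4, rfl, h6⟩ := hB
  have hl : ∀ {f g : (Fin m → ℂ) → ℂ} {q : Fin m → ℂ}, f =ᶠ[𝓝 q] g →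
      (fun ξ => ∑ i, eulerD i (fun ξ => f ξ * L i ξ) ξ - f ξ * N ξ) =ᶠ[𝓝 q]
        fun ξ => ∑ i, eulerD i (fun ξ => g ξ * L i ξ) ξ - g ξ * N ξ := by
    intro f g q hfg
    filter_upwards [hfg.eventuallyEq_nhds, hfg] with ξ e1 e2
    rw [e2]
    congr 1
    refine Finset.sum_congr rfl fun i _ => eulerD_congr ?_
    filter_upwards [e1] with η hη
    rw [hη]
  have hb : ∀ t ∈ Icc (0 : ℝ) 1, AnalyticAt ℂ (baseGerm (G t)) (γ t) := fun t ht =>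
    analyticAt_baseGerm (h2 t ht) fun d v => ((h6 d v).2.2 t ht).1
  have h7 := eventuallyEq_zero_of_path (f := fun t ξ =>
    ∑ i, eulerD i (fun ξ => baseGerm (G t) ξ * L i ξ) ξ - baseGerm (G t) ξ * N ξ) h1 ?_ ?_ ?_
  · filter_upwards [h7, hl (baseGerm_congr fun d v => (h6 d v).2.1)] with ξ e1 e2
    exact sub_eq_zero.mp (e2.symm.trans e1)
  · intro t ht
    exact (Finset.analyticAt_fun_sum _ fun i _ => analyticAt_eulerD i ((hb t ht).mul (hL i _ (h2 t ht)))).sub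
      ((hb t ht).mul (hN _ (h2 t ht)))
  · intro t ht
    filter_upwards [((h6 (Finsupp.single oscTwo m) (vacFock j)).2.2 t ht).2] with s e1
    refine hl ?_
    filter_upwards [e1] with ξ e1
    rw [baseGerm, baseGerm, e1]
  · have e : baseGerm (G 0) =ᶠ[𝓝 (γ 0)] corrBase k j m := by
      filter_upwards [(h6 (Finsupp.single oscTwo m) (vacFock j)).1,
        (isOpen_radialRegion m).mem_nhds h3] with ξ e1 hξ
      rw [baseGerm, e1, corrSeries_oscTwo hk0 hk2 hξ]
    -- Analyticity of `corrBase` near the start comes from the branch: it coincides there with the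
    -- base germ of the analytic family.
    have ha := ((hb 0 (left_mem_Icc.mpr zero_le_one)).congr e).eventually_analyticAt
    have hs : ∀ᶠ ξ : Fin m → ℂ in 𝓝 (γ 0), ∀ i, ξ i ∈ Complex.slitPlane :=
      Filter.eventually_all.mpr fun i => (continuous_apply i).continuousAt.eventually_mem
        (Complex.isOpen_slitPlane.mem_nhds (h4 i))
    refine (hl e).trans ?_
    filter_upwards [ha, hs, (isOpen_radialRegion m).mem_nhds h3] with ξ e1 e2 e3
    rw [h ξ e3 e2 e1, sub_self]
    rfl

/-- The row of `T` expresses the matrix element of `T S ⋯ S` through finitely many others, and `w`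
gives that of `S ⋯ S T`. Their difference is the commutator. Comparing the series for it in the
domain of convergence gives the identity that is then continued. -/
theorem exists_sum_eulerD {T : Op} (hT : IsExact k j m T) {d : Osc →₀ ℕ} {v w : fock j}
    (hw : (w : FockSum) = T v) {F : Finset (Osc →₀ ℕ)} {t : (Osc →₀ ℕ) → ℂ}
    (ht : ∀ u ∈ fock (j - 2 * m), coord (j - 2 * m) d (T u) = ∑ d' ∈ F, t d' * coord (j - 2 * m) d' u) :
    ∃ L : Fin m → (Fin m → ℂ) → ℂ, (∀ i, AnalyticOnNhd ℂ (L i) (confSpace m)) ∧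
      ∀ p B, IsBranchAt k j p B → (fun ξ => ∑ i, eulerD i (fun ξ => baseGerm B ξ * L i ξ) ξ) =ᶠ[𝓝 p]
        fun ξ => ∑ d' ∈ F, t d' * B d' v ξ - B d w ξ := by
  obtain ⟨c, hc, hc'⟩ := hT d v v.2
  choose L hL hL' using hc
  choose R hR using fun d => exists_represents hk0 hk2 (m := m) d v
  obtain ⟨R', hR'⟩ := exists_represents hk0 hk2 (m := m) d w
  refine ⟨L, hL, fun p B hB => ?_⟩
  have key := sum_eulerD_of_isBranchAt hk0 hk2 hB (L := L)
    (N := fun ξ => ∑ d' ∈ F, t d' * R d' ξ - R' ξ) hL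
    (fun ξ hξ => (Finset.analyticAt_fun_sum _ fun d' _ => analyticAt_const.mul ((hR d').1 ξ hξ)).sub
      (hR'.1 ξ hξ)) ?_
  · refine key.trans ?_
    have e1 : ∀ᶠ ξ in 𝓝 p, ∀ d' ∈ F, B d' v ξ = baseGerm B ξ * R d' ξ :=
      (Filter.eventually_all_finset F).mpr fun d' _ => eventuallyEq_of_isBranchAt hk0 hk2 hB (hR d')
    filter_upwards [e1, eventuallyEq_of_isBranchAt hk0 hk2 hB hR'] with ξ e1 e2
    rw [e2, mul_sub, Finset.mul_sum]
    congr 1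
    refine Finset.sum_congr rfl fun d' hd' => ?_
    rw [e1 d' hd']
    ring
  · intro ξ hξ hs ha
    have h1 : HasSum (fun a => ∑ i, a i * (c i a * ∏ q, ξ q ^ a q))
        (∑ i, eulerD i (fun ξ => corrBase k j m ξ * L i ξ) ξ) := hasSum_sum fun i _ =>
      hasSum_eulerD (hL' i) hξ (hs i) (ha.mul (hL i ξ (radialRegion_subset_confSpace m hξ)))
    have h2 := (hasSum_sum fun d' (_ : d' ∈ F) => ((hR d').2 ξ hξ).mul_left (t d')).sub (hR'.2 ξ hξ)
    have h3 : (fun a => ∑ i, a i * (c i a * ∏ q, ξ q ^ a q)) =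
        fun a => ∑ d' ∈ F, t d' * corrTerm k j d' v ξ a - corrTerm k j d w ξ a := by
      funext a
      have hu : scrProd k a v ∈ fock (j - 2 * m) := by
        rw [sub_two_mul]
        exact prodOp_mem_shiftOps (fun i => screening_mem hk2 (a i)) j v v.2
      have h4 := hc' a
      rw [cm_apply, map_sub, ht _ hu, ← hw] at h4
      simp only [← mul_assoc]
      rw [← Finset.sum_mul, ← h4, sub_mul, Finset.sum_mul]
      simp only [mul_assoc]
      rfl
    rw [h3] at h1
    rw [h1.unique h2, mul_sub, Finset.mul_sum]
    congr 1
    exact Finset.sum_congr rfl fun d' _ => by ring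

/-- Linearity in `v` holds for the series and hence for the single-valued factors `R`, which all
multiply the same base germ. -/
theorem germ_linear {p : Fin m → ℂ} {B : Germs j m} (hB : IsBranchAt k j p B) (d : Osc →₀ ℕ)
    (x : ℂ) (v w : fock j) : B d (x • v + w) =ᶠ[𝓝 p] fun ξ => x * B d v ξ + B d w ξ := by
  obtain ⟨R, hR⟩ := exists_represents hk0 hk2 (m := m) d v
  obtain ⟨R', hR'⟩ := exists_represents hk0 hk2 (m := m) d w
  have h : Represents k j d (x • v + w) fun ξ : Fin m → ℂ => x * R ξ + R' ξ := by
    refine ⟨fun ξ hξ => (analyticAt_const.mul (hR.1 ξ hξ)).add (hR'.1 ξ hξ), fun ξ hξ => ?_⟩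
    have := ((hR.2 ξ hξ).mul_left x).add (hR'.2 ξ hξ)
    convert! this using 1
    · funext a
      simp only [corrTerm, Submodule.coe_add, Submodule.coe_smul, map_add, map_smul, smul_eq_mul]
      ring
    · ring
  filter_upwards [eventuallyEq_of_isBranchAt hk0 hk2 hB hR, eventuallyEq_of_isBranchAt hk0 hk2 hB hR',
    eventuallyEq_of_isBranchAt hk0 hk2 hB h] with ξ e1 e2 e3
  rw [e1, e2, e3]
  ring

end

/-! ### Stokes' theorem for a cube -/

/-- The determinant as a function of the rows of a complex matrix. -/
def detRows (m : ℕ) : ContinuousMultilinearMap ℝ (fun _ : Fin m => Fin m → ℂ) ℂ :=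
  ContinuousMultilinearMap.restrictScalars ℝ
    (⟨Matrix.detRowAlternating.toMultilinearMap, by
      change Continuous fun M : Matrix (Fin m) (Fin m) ℂ => M.det
      exact continuous_id.matrix_det⟩ :
      ContinuousMultilinearMap ℂ (fun _ : Fin m => Fin m → ℂ) ℂ)

lemma detRows_apply {m : ℕ} (v : Fin m → Fin m → ℂ) : detRows m v = (Matrix.of v).det := rfl

lemma detRows_swap {m : ℕ} (v : Fin m → Fin m → ℂ) {i l : Fin m} (h : i ≠ l) :
    detRows m (v ∘ Equiv.swap i l) = -detRows m v :=
  (Matrix.detRowAlternating (R := ℂ) (n := Fin m)).map_swap v h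

lemma detRows_insertNth {n : ℕ} (l : Fin (n + 1)) (x : Fin (n + 1) → ℂ)
    (v : Fin n → Fin (n + 1) → ℂ) :
    detRows (n + 1) (l.insertNth x v) = (-1) ^ (l : ℕ) * detRows (n + 1) (Matrix.vecCons x v) := by
  have := (Matrix.detRowAlternating (R := ℂ) (n := Fin (n + 1))).map_insertNth l x v
  rw [zsmul_eq_mul] at this
  push_cast at this
  exact this

/-- The derivative of the determinant in the direction of a linear transformation. -/
lemma sum_detRows_update {m : ℕ} (A : (Fin m → ℂ) →ₗ[ℂ] (Fin m → ℂ)) (J : Fin m → Fin m → ℂ) :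
    ∑ l, detRows m (Function.update J l (A (J l))) =
      (∑ i, A (Pi.single i 1) i) * detRows m J := by
  let N := LinearMap.toMatrix' A
  -- By Cramer's rule a determinant with a replaced row is an entry of a product with the adjugate,
  -- so the sum over the rows is a trace.
  have h1 : ∀ l, detRows m (Function.update J l (A (J l))) =
      ((Matrix.of J).transpose.adjugate * (N * (Matrix.of J).transpose)) l l := by
    intro l
    have : A (J l) = N.mulVec (J l) := (LinearMap.toMatrix'_mulVec A (J l)).symm
    rw [detRows_apply, this]
    change ((Matrix.of J).updateRow l _).det = _
    rw [← Matrix.cramer_transpose_apply, Matrix.cramer_eq_adjugate_mulVec]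
    rfl
  have h2 : ∑ i, A (Pi.single i 1) i = N.trace := by
    simp [Matrix.trace, N, LinearMap.toMatrix'_apply]
  rw [Finset.sum_congr rfl fun l _ => h1 l, h2]
  change Matrix.trace _ = _
  rw [Matrix.trace_mul_comm, mul_assoc, Matrix.mul_adjugate, Matrix.det_transpose, mul_smul_comm,
    mul_one, Matrix.trace_smul, smul_eq_mul, mul_comm, detRows_apply]

/-- The mixed terms in the divergence of the pulled back field cancel. -/
lemma sum_detRows_mixed {m : ℕ} (J : Fin m → Fin m → ℂ) (x : Fin m → ℂ) {H : Fin m → Fin m → Fin m → ℂ}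
    (hH : ∀ l q, H l q = H q l) :
    ∑ l, ∑ q, (if q = l then 0 else
      detRows m (Function.update (Function.update J l x) q (H l q))) = 0 := by
  -- Exchanging the rows `l` and `q` reverses the sign of the determinant, while `H` is symmetric.
  -- So the double sum equals its negative.
  have h1 : ∀ l q, (if q = l then 0 else
      detRows m (Function.update (Function.update J l x) q (H l q))) =
      -(if l = q then 0 else detRows m (Function.update (Function.update J q x) l (H q l))) := by
    intro l q
    by_cases h : q = l
    · simp [h]
    · rw [if_neg h, if_neg (Ne.symm h), ← detRows_swap _ (Ne.symm h)]
      congr 1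
      funext r
      rw [Function.comp_apply, hH l q]
      by_cases h1 : r = l
      · subst h1
        rw [Equiv.swap_apply_left, Function.update_of_ne (Ne.symm h), Function.update_self,
          Function.update_of_ne h, Function.update_self]
      · by_cases h2 : r = q
        · subst h2
          rw [Equiv.swap_apply_right, Function.update_self, Function.update_self]
        · rw [Equiv.swap_apply_of_ne_of_ne h1 h2, Function.update_of_ne h2, Function.update_of_ne h1,
            Function.update_of_ne h1, Function.update_of_ne h2]
  have h2 : ∑ l, ∑ q, (if q = l then 0 else
      detRows m (Function.update (Function.update J l x) q (H l q))) =
      -∑ l, ∑ q, (if q = l then 0 else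
        detRows m (Function.update (Function.update J l x) q (H l q))) := by
    conv_lhs => rw [Finset.sum_comm]
    rw [← Finset.sum_neg_distrib]
    refine Finset.sum_congr rfl fun l _ => ?_
    rw [← Finset.sum_neg_distrib]
    exact Finset.sum_congr rfl fun q _ => h1 q l
  exact self_eq_neg.mp h2

/-- The partial derivatives of a map. -/
def partials {n : ℕ} {E : Type} [NormedAddCommGroup E] [NormedSpace ℝ E] (f : (Fin n → ℝ) → E)
    (t : Fin n → ℝ) (l : Fin n) : E := fderiv ℝ f t (Pi.single l 1)

section

variable {m : ℕ} {τ : (Fin m → ℝ) → Fin m → ℂ} {K : (Fin m → ℝ) → (Fin m → ℂ) → Fin m → ℂ}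
  (hτ : ContDiff ℝ ∞ τ) (hK : ∀ t ∈ Icc (0 : Fin m → ℝ) 1, AnalyticAt ℂ (K t) (τ t))
  (hl : ∀ t ∈ Icc (0 : Fin m → ℝ) 1, ∀ᶠ s in 𝓝[Icc 0 1] t, K s =ᶠ[𝓝 (τ s)] K t)

/-- The divergence of the field with germs `K` along `τ`. -/
def divAlong (τ : (Fin m → ℝ) → Fin m → ℂ) (K : (Fin m → ℝ) → (Fin m → ℂ) → Fin m → ℂ)
    (t : Fin m → ℝ) : ℂ := ∑ i, fderiv ℂ (K t) (τ t) (Pi.single i 1) i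

/-- The flux of the field through the hypersurfaces on which the `l`-th parameter is constant. -/
def fluxAlong (τ : (Fin m → ℝ) → Fin m → ℂ) (K : (Fin m → ℝ) → (Fin m → ℂ) → Fin m → ℂ) (l : Fin m)
    (t : Fin m → ℝ) : ℂ := detRows m (Function.update (partials τ t) l (K t (τ t)))

/-- The derivative of the flux. -/
def fluxDeriv (τ : (Fin m → ℝ) → Fin m → ℂ) (K : (Fin m → ℝ) → (Fin m → ℂ) → Fin m → ℂ) (l : Fin m)
    (t : Fin m → ℝ) : (Fin m → ℝ) →L[ℝ] ℂ :=
  ((detRows m).linearDeriv (Function.update (partials τ t) l (K t (τ t)))).comp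
    (ContinuousLinearMap.pi fun q => if q = l then
      ((fderiv ℂ (K t) (τ t)).restrictScalars ℝ).comp (fderiv ℝ τ t)
      else (fderiv ℝ (fderiv ℝ τ) t).flip (Pi.single q 1))

include hτ

lemma continuous_partials : Continuous (partials τ) := by
  refine continuous_pi fun l => ?_
  exact (hτ.continuous_fderiv (by simp)).clm_apply continuous_const

lemma hasFDerivAt_partials (t : Fin m → ℝ) (l : Fin m) : HasFDerivAt (fun t => partials τ t l)
    ((fderiv ℝ (fderiv ℝ τ) t).flip (Pi.single l 1)) t := by
  have h : HasFDerivAt (fderiv ℝ τ) (fderiv ℝ (fderiv ℝ τ) t) t :=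
    ((hτ.fderiv_right (m := 1) (by norm_cast)).differentiable one_ne_zero t).hasFDerivAt
  have := h.clm_apply (hasFDerivAt_const (Pi.single l (1 : ℝ) : Fin m → ℝ) t)
  refine this.congr_fderiv ?_
  ext u
  simp

/-- Differentiating the replaced row gives the divergence of the field times the Jacobian.
Differentiating the other rows gives second derivatives of `τ`, which cancel in pairs by their
symmetry. -/
lemma sum_fluxDeriv (t : Fin m → ℝ) : ∑ l, fluxDeriv τ K l t (Pi.single l 1) =
    divAlong τ K t * detRows m (partials τ t) := by
  have hsym : IsSymmSndFDerivAt ℝ τ t :=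
    hτ.contDiffAt.isSymmSndFDerivAt (by
      rw [minSmoothness_of_isRCLikeNormedField]; norm_cast)
  have htr := sum_detRows_update (fderiv ℂ (K t) (τ t) : (Fin m → ℂ) →ₗ[ℂ] (Fin m → ℂ)) (partials τ t)
  simp only [ContinuousLinearMap.coe_coe] at htr
  rw [divAlong, ← htr]
  refine Eq.trans ?_ (add_zero _)
  rw [← sum_detRows_mixed (partials τ t) (K t (τ t))
    (H := fun l q => fderiv ℝ (fderiv ℝ τ) t (Pi.single l 1) (Pi.single q 1))
    (fun l q => hsym.eq _ _), ← Finset.sum_add_distrib]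
  refine Finset.sum_congr rfl fun l _ => ?_
  rw [fluxDeriv, ContinuousLinearMap.comp_apply, ContinuousMultilinearMap.linearDeriv_apply,
    ← Finset.add_sum_erase _ _ (Finset.mem_univ l)]
  congr 1
  · rw [Function.update_idem]
    simp [partials]
  · rw [← Finset.add_sum_erase _ (fun q => if q = l then 0 else _) (Finset.mem_univ l), if_pos rfl,
      zero_add]
    refine Finset.sum_congr rfl fun q hq => ?_
    have h := Finset.ne_of_mem_erase hq
    rw [if_neg h]
    simp [h]

include hK hl

/-- Near a parameter `t` the field may be computed with the single germ `K t`, although the germs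
vary along the cube. The same remark gives the continuity of the divergence and the
differentiability of the flux. -/
lemma continuousOn_field : ContinuousOn (fun t => K t (τ t)) (Icc 0 1) := by
  intro t ht
  have h1 : ContinuousWithinAt (fun s => K t (τ s)) (Icc 0 1) t :=
    ((hK t ht).continuousAt.comp hτ.continuous.continuousAt).continuousWithinAt
  refine h1.congr_of_eventuallyEq ?_ rfl
  filter_upwards [hl t ht] with s hs using hs.eq_of_nhds

lemma continuousOn_divAlong : ContinuousOn (divAlong τ K) (Icc 0 1) := by
  intro t ht
  have h0 : AnalyticAt ℂ (fun ξ => ∑ i, fderiv ℂ (K t) ξ (Pi.single i 1) i) (τ t) := by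
    refine Finset.analyticAt_fun_sum _ fun i _ => ?_
    have h1 : AnalyticAt ℂ (fun ξ => fderiv ℂ (K t) ξ (Pi.single i 1)) (τ t) :=
      ((ContinuousLinearMap.apply ℂ (Fin m → ℂ) (Pi.single i (1 : ℂ) : Fin m → ℂ)).analyticAt _).comp
        (hK t ht).fderiv
    exact ((ContinuousLinearMap.proj i : (Fin m → ℂ) →L[ℂ] ℂ).analyticAt _).comp h1
  have h1 : ContinuousWithinAt (fun s => ∑ i, fderiv ℂ (K t) (τ s) (Pi.single i 1) i) (Icc 0 1) t :=
    (ContinuousAt.comp (f := τ) h0.continuousAt hτ.continuous.continuousAt).continuousWithinAt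
  refine h1.congr_of_eventuallyEq ?_ rfl
  filter_upwards [hl t ht] with s hs
  rw [divAlong, hs.fderiv_eq]

lemma continuousOn_fluxAlong (l : Fin m) : ContinuousOn (fluxAlong τ K l) (Icc 0 1) := by
  refine (detRows m).cont.comp_continuousOn ?_
  refine continuousOn_pi.mpr fun q => ?_
  by_cases h : q = l
  · subst h
    simpa using continuousOn_field hτ hK hl
  · simp only [Function.update_of_ne h]
    exact ((continuous_apply q).comp (continuous_partials hτ)).continuousOn

lemma hasFDerivAt_fluxAlong (l : Fin m) {t : Fin m → ℝ} (ht : Icc 0 1 ∈ 𝓝 t) :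
    HasFDerivAt (fluxAlong τ K l) (fluxDeriv τ K l t) t := by
  refine HasFDerivAt.comp t ((detRows m).hasFDerivAt _) ?_
  refine hasFDerivAt_pi.mpr fun q => ?_
  by_cases h : q = l
  · subst h
    simp only [Function.update_self, if_true]
    have h0 := ((hK t (mem_of_mem_nhds ht)).differentiableAt.hasFDerivAt.restrictScalars ℝ).comp t
      (hτ.differentiable (by simp) t).hasFDerivAt
    refine h0.congr_of_eventuallyEq ?_
    have h1 := hl t (mem_of_mem_nhds ht)
    rw [nhdsWithin_eq_nhds.mpr ht] at h1
    filter_upwards [h1] with s hs using hs.eq_of_nhds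
  · simp only [Function.update_of_ne h, if_neg h]
    exact hasFDerivAt_partials hτ t q

end

/-- This is the divergence theorem on the unit cube for the vector of fluxes. It needs continuity on
the closed cube and derivatives in the interior only, so the germs need not be continued beyond the
cube. -/
theorem integral_divAlong {n : ℕ} {τ : (Fin (n + 1) → ℝ) → Fin (n + 1) → ℂ}
    {K : (Fin (n + 1) → ℝ) → (Fin (n + 1) → ℂ) → Fin (n + 1) → ℂ} (hτ : ContDiff ℝ ∞ τ)
    (hK : ∀ t ∈ Icc (0 : Fin (n + 1) → ℝ) 1, AnalyticAt ℂ (K t) (τ t))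
    (hl : ∀ t ∈ Icc (0 : Fin (n + 1) → ℝ) 1, ∀ᶠ s in 𝓝[Icc 0 1] t, K s =ᶠ[𝓝 (τ s)] K t) :
    ∫ t in Icc (0 : Fin (n + 1) → ℝ) 1, divAlong τ K t * detRows (n + 1) (partials τ t) =
      ∑ l, ((∫ t in Icc (0 : Fin n → ℝ) 1, fluxAlong τ K l (faceIncl l true t)) -
        ∫ t in Icc (0 : Fin n → ℝ) 1, fluxAlong τ K l (faceIncl l false t)) := by
  have h := MeasureTheory.integral_divergence_of_hasFDerivAt_off_countable' (0 : Fin (n + 1) → ℝ) 1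
    zero_le_one (fluxAlong τ K) (fluxDeriv τ K) ∅ countable_empty (continuousOn_fluxAlong hτ hK hl)
    ?_ ?_
  · simp only [sum_fluxDeriv hτ] at h
    rw [h]
    rfl
  · intro t ht l
    refine hasFDerivAt_fluxAlong hτ hK hl l ?_
    rw [← pi_univ_Icc]
    exact set_pi_mem_nhds finite_univ fun i _ => Icc_mem_nhds (ht.1 i trivial).1 (ht.1 i trivial).2
  · simp only [sum_fluxDeriv hτ]
    exact ((continuousOn_divAlong hτ hK hl).mul ((detRows (n + 1)).cont.comp
      (continuous_partials hτ)).continuousOn).integrableOn_compact isCompact_Icc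

/-! ### Closed chains -/

lemma BranchCube.analyticAt_germ {k j : ℂ} {m : ℕ} (σ : BranchCube k j m) {t : Fin m → ℝ}
    (ht : t ∈ Icc (0 : Fin m → ℝ) 1) (d : Osc →₀ ℕ) (v : fock j) :
    AnalyticAt ℂ (σ.germ t d v) (σ.map t) := analyticAt_of_isBranchAt (σ.isBranch t ht) d v

lemma BranchCube.continuousOn_germ {k j : ℂ} {m : ℕ} (σ : BranchCube k j m) (d : Osc →₀ ℕ)
    (v : fock j) : ContinuousOn (fun t => σ.germ t d v (σ.map t)) (Icc 0 1) := by
  intro t ht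
  have h1 : ContinuousWithinAt (fun s => σ.germ t d v (σ.map s)) (Icc 0 1) t :=
    ((σ.analyticAt_germ ht d v).continuousAt.comp
      σ.smooth.continuous.continuousAt).continuousWithinAt
  refine h1.congr_of_eventuallyEq ?_ rfl
  filter_upwards [σ.continued t ht d v] with s hs using hs.eq_of_nhds

lemma partials_eq_deriv {n : ℕ} {E : Type} [NormedAddCommGroup E] [NormedSpace ℝ E]
    {f : (Fin n → ℝ) → E} {t : Fin n → ℝ} (hf : DifferentiableAt ℝ f t) (l : Fin n) :
    HasDerivAt (fun z => f (Function.update t l z)) (partials f t l) (t l) := by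
  have h2 : HasFDerivAt f (fderiv ℝ f t) (Function.update t l (t l)) := by
    rw [Function.update_eq_self]
    exact hf.hasFDerivAt
  exact h2.comp_hasDerivAt (t l) (hasDerivAt_update t l (t l))

lemma faceIncl_self {n : ℕ} (l : Fin (n + 1)) (ε : Bool) (t : Fin n → ℝ) :
    faceIncl l ε t l = if ε then 1 else 0 := Fin.insertNth_apply_same _ _ _

lemma faceIncl_succAbove {n : ℕ} (l : Fin (n + 1)) (ε : Bool) (t : Fin n → ℝ) (r : Fin n) :
    faceIncl l ε t (l.succAbove r) = t r := Fin.insertNth_apply_succAbove _ _ _ _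

lemma faceIncl_update {n : ℕ} (l : Fin (n + 1)) (ε : Bool) (t : Fin n → ℝ) (r : Fin n) (z : ℝ) :
    faceIncl l ε (Function.update t r z) =
      Function.update (faceIncl l ε t) (l.succAbove r) z := by
  funext q
  rcases Fin.eq_self_or_eq_succAbove l q with rfl | ⟨q, rfl⟩
  · rw [Function.update_of_ne (Fin.succAbove_ne q r).symm, faceIncl_self, faceIncl_self]
  · rw [faceIncl_succAbove]
    by_cases h : q = r
    · subst h; simp
    · rw [Function.update_of_ne h, Function.update_of_ne fun h' => h (Fin.succAbove_right_injective h'),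
        faceIncl_succAbove]

lemma contDiff_faceIncl {n : ℕ} (l : Fin (n + 1)) (ε : Bool) : ContDiff ℝ ∞ (faceIncl l ε) := by
  refine contDiff_pi.mpr fun q => ?_
  rcases Fin.eq_self_or_eq_succAbove l q with rfl | ⟨q, rfl⟩
  · simp only [faceIncl_self]
    exact contDiff_const
  · simp only [faceIncl_succAbove]
    exact contDiff_apply ℝ ℝ q

lemma faceIncl_mem {n : ℕ} (l : Fin (n + 1)) (ε : Bool) {t : Fin n → ℝ}
    (ht : t ∈ Icc (0 : Fin n → ℝ) 1) : faceIncl l ε t ∈ Icc (0 : Fin (n + 1) → ℝ) 1 := by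
  constructor <;> intro q <;> rcases Fin.eq_self_or_eq_succAbove l q with rfl | ⟨q, rfl⟩
  · rw [faceIncl_self]; split_ifs <;> simp
  · rw [faceIncl_succAbove]; exact ht.1 q
  · rw [faceIncl_self]; split_ifs <;> simp
  · rw [faceIncl_succAbove]; exact ht.2 q

lemma partials_comp_faceIncl {n : ℕ} {τ : (Fin (n + 1) → ℝ) → Fin (n + 1) → ℂ} (hτ : ContDiff ℝ ∞ τ)
    (l : Fin (n + 1)) (ε : Bool) (t : Fin n → ℝ) (r : Fin n) :
    partials (fun t => τ (faceIncl l ε t)) t r = partials τ (faceIncl l ε t) (l.succAbove r) := by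
  have h1 := partials_eq_deriv ((hτ.comp (contDiff_faceIncl l ε)).differentiable (by simp) t) r
  have h2 := partials_eq_deriv (hτ.differentiable (by simp) (faceIncl l ε t)) (l.succAbove r)
  rw [faceIncl_succAbove] at h2
  simp only [Function.comp_apply, faceIncl_update] at h1
  exact h1.unique h2

/-- Moving the `l`-th row to the top produces `(-1)^l`, the sign of the face in the boundary. The
remaining derivatives are those of the face alone. -/
lemma fluxAlong_faceIncl {n : ℕ} {τ : (Fin (n + 1) → ℝ) → Fin (n + 1) → ℂ} (hτ : ContDiff ℝ ∞ τ)
    (K : (Fin (n + 1) → ℝ) → (Fin (n + 1) → ℂ) → Fin (n + 1) → ℂ) (l : Fin (n + 1)) (ε : Bool)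
    (t : Fin n → ℝ) : fluxAlong τ K l (faceIncl l ε t) = (-1) ^ (l : ℕ) * detRows (n + 1)
      (Matrix.vecCons (K (faceIncl l ε t) (τ (faceIncl l ε t)))
        (partials (fun t => τ (faceIncl l ε t)) t)) := by
  rw [fluxAlong, ← detRows_insertNth, ← Fin.insertNth_removeNth]
  congr 2
  funext r
  rw [partials_comp_faceIncl hτ]
  rfl

lemma detRows_vecCons_smul {n : ℕ} (c : ℂ) (x : Fin (n + 1) → ℂ) (v : Fin n → Fin (n + 1) → ℂ) :
    detRows (n + 1) (Matrix.vecCons (c • x) v) = c * detRows (n + 1) (Matrix.vecCons x v) :=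
  (Matrix.detRowAlternating (R := ℂ) (n := Fin (n + 1))).map_vecCons_smul v c x

lemma uniqueDiffOn_cube (n : ℕ) : UniqueDiffOn ℝ (Icc (0 : Fin n → ℝ) 1) := by
  rw [← pi_univ_Icc]
  exact UniqueDiffOn.univ_pi fun i => uniqueDiffOn_Icc one_pos

/-- The closed cube has unique differentials, so derivatives at its points, including the boundary,
depend only on the restriction to it. This matters because faces are identified only on the cube. -/
lemma partials_congr {n : ℕ} {E : Type} [NormedAddCommGroup E] [NormedSpace ℝ E]
    {f g : (Fin n → ℝ) → E} (hf : Differentiable ℝ f) (hg : Differentiable ℝ g)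
    (h : EqOn f g (Icc 0 1)) {t : Fin n → ℝ} (ht : t ∈ Icc (0 : Fin n → ℝ) 1) :
    partials f t = partials g t := by
  funext l
  rw [partials, partials, ← (hf t).fderivWithin (uniqueDiffOn_cube n t ht),
    ← (hg t).fderivWithin (uniqueDiffOn_cube n t ht), fderivWithin_congr h (h ht)]

lemma exists_partials_eq_zero {n : ℕ} {E : Type} [NormedAddCommGroup E] [NormedSpace ℝ E]
    {f : (Fin n → ℝ) → E} (hf : Differentiable ℝ f) (h : IsDegenerate f) :
    ∃ l, ∀ t ∈ Icc (0 : Fin n → ℝ) 1, partials f t l = 0 := by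
  obtain ⟨l, hl⟩ := h
  refine ⟨l, fun t ht => ?_⟩
  have htl : t l ∈ Icc (0 : ℝ) 1 := ⟨ht.1 l, ht.2 l⟩
  have h1 := (partials_eq_deriv (hf t) l).hasDerivWithinAt (s := Icc 0 1)
  have h2 : HasDerivWithinAt (fun z => f (Function.update t l z)) 0 (Icc 0 1) (t l) := by
    refine (hasDerivWithinAt_const (t l) (Icc 0 1) (f t)).congr (fun z hz => ?_) (by simp)
    refine hl _ ?_ _ ht fun i hi => Function.update_of_ne hi _ _
    constructor <;> intro q <;> by_cases hq : q = l
    · subst hq; simpa using hz.1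
    · simpa [hq] using ht.1 q
    · subst hq; simpa using hz.2
    · simpa [hq] using ht.2 q
  exact (uniqueDiffOn_Icc one_pos _ htl).eq_deriv _ h1 h2

lemma detRows_vecCons_eq_zero {n : ℕ} (x : Fin (n + 1) → ℂ) {v : Fin n → Fin (n + 1) → ℂ} {l : Fin n}
    (h : v l = 0) : detRows (n + 1) (Matrix.vecCons x v) = 0 :=
  (detRows (n + 1)).map_coord_zero l.succ (by simpa using h)

section

variable {k j : ℂ} {n : ℕ} (Γ : BranchChain k j (n + 1))

lemma BranchChain.contDiff_faceMap (f : Γ.Face) : ContDiff ℝ ∞ (Γ.faceMap f) :=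
  (Γ.cube f.1).smooth.comp (contDiff_faceIncl _ _)

lemma BranchChain.faceMap_mem (f : Γ.Face) {t : Fin n → ℝ} (ht : t ∈ Icc (0 : Fin n → ℝ) 1) :
    Γ.faceMap f t ∈ confSpace (n + 1) := (Γ.cube f.1).mem_confSpace _ (faceIncl_mem _ _ ht)

/-- The integral of a multiple of a matrix element over the boundary of a closed chain vanishes. -/
theorem BranchChain.IsClosed.sum_faces {Γ : BranchChain k j (n + 1)} (hΓ : Γ.IsClosed)
    {κ : (Fin (n + 1) → ℂ) → Fin (n + 1) → ℂ} (hκ : ContinuousOn κ (confSpace (n + 1)))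
    (d : Osc →₀ ℕ) (v : fock j) :
    ∑ f : Γ.Face, Γ.faceCoef f * ∫ t in Icc (0 : Fin n → ℝ) 1, Γ.faceGerm f t d v (Γ.faceMap f t) *
      detRows (n + 1) (Matrix.vecCons (κ (Γ.faceMap f t)) (partials (Γ.faceMap f) t)) = 0 := by
  classical
  let Ψ : Γ.Face → (Fin n → ℝ) → ℂ := fun f t =>
    detRows (n + 1) (Matrix.vecCons (κ (Γ.faceMap f t)) (partials (Γ.faceMap f) t))
  have hdiff : ∀ f, Differentiable ℝ (Γ.faceMap f) := fun f =>
    (Γ.contDiff_faceMap f).differentiable (by simp)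
  have hΨ : ∀ f f₀, EqOn (Γ.faceMap f) (Γ.faceMap f₀) (Icc 0 1) →
      ∀ t ∈ Icc (0 : Fin n → ℝ) 1, Ψ f t = Ψ f₀ t := by
    intro f f₀ h t ht
    simp only [Ψ]
    rw [h ht, partials_congr (hdiff f) (hdiff f₀) h ht]
  have hint : ∀ f, MeasureTheory.IntegrableOn
      (fun t => Γ.faceGerm f t d v (Γ.faceMap f t) * Ψ f t) (Icc (0 : Fin n → ℝ) 1) := by
    intro f
    refine ContinuousOn.integrableOn_compact isCompact_Icc (ContinuousOn.mul ?_ ?_)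
    · exact ((Γ.cube f.1).continuousOn_germ d v).comp
        (contDiff_faceIncl _ _).continuous.continuousOn fun t ht => faceIncl_mem _ _ ht
    · refine (detRows (n + 1)).cont.comp_continuousOn (continuousOn_pi.mpr fun q => ?_)
      refine Fin.cases ?_ (fun r => ?_) q
      · simp only [Matrix.cons_val_zero]
        exact hκ.comp (Γ.contDiff_faceMap f).continuous.continuousOn fun t ht => Γ.faceMap_mem f ht
      · simp only [Matrix.cons_val_succ]
        have h1 : Continuous fun t => fderiv ℝ (Γ.faceMap f) t :=
          (Γ.contDiff_faceMap f).continuous_fderiv (by simp)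
        exact (h1.clm_apply continuous_const).continuousOn
  -- The faces are grouped by their restrictions to the cube.
  have key := Finset.sum_image' (s := (Finset.univ : Finset Γ.Face)) (f := fun _ => (0 : ℂ))
    (g := fun f : Γ.Face => (Icc (0 : Fin n → ℝ) 1).domRestrict (Γ.faceMap f))
    (fun f => Γ.faceCoef f * ∫ t in Icc (0 : Fin n → ℝ) 1,
      Γ.faceGerm f t d v (Γ.faceMap f t) * Ψ f t) ?_
  · rw [← key, Finset.sum_const_zero]
  · intro f₀ _
    have hcl : ∀ f, (Icc (0 : Fin n → ℝ) 1).domRestrict (Γ.faceMap f) =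
        (Icc (0 : Fin n → ℝ) 1).domRestrict (Γ.faceMap f₀) ↔
        EqOn (Γ.faceMap f) (Γ.faceMap f₀) (Icc 0 1) := fun f => domRestrict_eq_domRestrict_iff
    simp only [hcl]
    -- In a degenerate class every determinant has a zero row. In a nondegenerate class the
    -- determinant is common to all faces and the germs cancel pointwise by closedness.
    by_cases hdeg : IsDegenerate (Γ.faceMap f₀)
    · obtain ⟨l, hl⟩ := exists_partials_eq_zero (hdiff f₀) hdeg
      symm
      refine Finset.sum_eq_zero fun f hf => ?_
      rw [MeasureTheory.setIntegral_eq_zero_of_forall_eq_zero, mul_zero]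
      intro t ht
      rw [hΨ f f₀ (Finset.mem_filter.mp hf).2 t ht]
      simp only [Ψ]
      rw [detRows_vecCons_eq_zero _ (hl t ht), mul_zero]
    · have h1 : ∀ t ∈ Icc (0 : Fin n → ℝ) 1, _ := hΓ f₀ hdeg
      symm
      simp only [← MeasureTheory.integral_const_mul]
      rw [← MeasureTheory.integral_finsetSum _ fun f _ => (hint f).const_mul _]
      refine MeasureTheory.setIntegral_eq_zero_of_forall_eq_zero fun t ht => ?_
      have h2 := (h1 t ht d v).eq_of_nhds
      simp only [Pi.zero_apply] at h2
      have h3 : ∀ f ∈ Finset.univ.filter fun f => EqOn (Γ.faceMap f) (Γ.faceMap f₀) (Icc 0 1),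
          Γ.faceCoef f * (Γ.faceGerm f t d v (Γ.faceMap f t) * Ψ f t) =
          Γ.faceCoef f * Γ.faceGerm f t d v (Γ.faceMap f₀ t) * Ψ f₀ t := by
        intro f hf
        have hf := (Finset.mem_filter.mp hf).2
        rw [hΨ f f₀ hf t ht, hf ht, mul_assoc]
      rw [Finset.sum_congr rfl h3, ← Finset.sum_mul, h2, zero_mul]

end

/-! ### Integrals of total derivatives over closed chains -/

/-- The field whose divergence is the sum of the derivatives of the `h_i` times `∏ dξ_i / ξ_i`. -/
def logField {m : ℕ} (h : Fin m → (Fin m → ℂ) → ℂ) (ξ : Fin m → ℂ) : Fin m → ℂ :=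
  fun i => ξ i * (∏ q, ξ q)⁻¹ * h i ξ

lemma analyticAt_logField {m : ℕ} {h : Fin m → (Fin m → ℂ) → ℂ} {ξ : Fin m → ℂ}
    (hξ : ∀ i, ξ i ≠ 0) (hh : ∀ i, AnalyticAt ℂ (h i) ξ) : AnalyticAt ℂ (logField h) ξ :=
  AnalyticAt.pi fun i => ((analyticAt_apply i ξ).mul ((analyticAt_prod ξ).inv
    (Finset.prod_ne_zero_iff.mpr fun i _ => hξ i))).mul (hh i)

/-- In the `i`-th component the factor `ξ_i` cancels against the product. It therefore depends on
`ξ_i` through `h i` only, and differentiation gives `D_{ξ_i} h_i` over `∏ ξ_q`. -/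
lemma div_logField {m : ℕ} {h : Fin m → (Fin m → ℂ) → ℂ} {ξ : Fin m → ℂ}
    (hξ : ∀ i, ξ i ≠ 0) (hh : ∀ i, AnalyticAt ℂ (h i) ξ) :
    ∑ i, fderiv ℂ (logField h) ξ (Pi.single i 1) i = (∑ i, eulerD i (h i) ξ) * (∏ i, ξ i)⁻¹ := by
  rw [Finset.sum_mul]
  refine Finset.sum_congr rfl fun i _ => ?_
  have h1 : HasFDerivAt (logField h) (fderiv ℂ (logField h) ξ) (Function.update ξ i (ξ i)) := by
    rw [Function.update_eq_self]
    exact (analyticAt_logField hξ hh).differentiableAt.hasFDerivAt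
  have h2 := (hasDerivAt_pi.mp (h1.comp_hasDerivAt (ξ i) (hasDerivAt_update ξ i (ξ i)))) i
  have h3 : HasFDerivAt (h i) (fderiv ℂ (h i) ξ) (Function.update ξ i (ξ i)) := by
    rw [Function.update_eq_self]
    exact (hh i).differentiableAt.hasFDerivAt
  have h4 := (h3.comp_hasDerivAt (ξ i) (hasDerivAt_update ξ i (ξ i))).const_mul
    (∏ q ∈ Finset.univ.erase i, ξ q)⁻¹
  have hp : ∀ z : ℂ, ∏ q, Function.update ξ i z q = z * ∏ q ∈ Finset.univ.erase i, ξ q := by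
    intro z
    rw [← Finset.mul_prod_erase _ _ (Finset.mem_univ i), Function.update_self]
    congr 1
    exact Finset.prod_congr rfl fun q hq => Function.update_of_ne (Finset.ne_of_mem_erase hq) _ _
  have h5 := h4.congr_of_eventuallyEq (f₁ := fun z => logField h (Function.update ξ i z) i) (by
    filter_upwards [eventually_ne_nhds (hξ i)] with z hz
    simp only [logField, Function.update_self, hp, Function.comp_apply]
    rw [mul_inv, ← mul_assoc z, mul_inv_cancel₀ hz, one_mul])
  rw [h2.unique h5, eulerD]
  have := hp (ξ i)
  rw [Function.update_eq_self] at this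
  rw [this, mul_inv]
  have := hξ i
  field_simp

/-- The integral of a total derivative over a closed chain vanishes. -/
theorem BranchChain.IsClosed.sum_integral_eulerD {k j : ℂ} {m : ℕ} {Γ : BranchChain k j m}
    (hΓ : Γ.IsClosed) {L : Fin m → (Fin m → ℂ) → ℂ} (hL : ∀ i, AnalyticOnNhd ℂ (L i) (confSpace m)) :
    ∑ q, Γ.coef q * ∫ t in Icc (0 : Fin m → ℝ) 1,
      (∑ i, eulerD i (fun ξ => baseGerm ((Γ.cube q).germ t) ξ * L i ξ) ((Γ.cube q).map t)) *
        (Matrix.of fun i l => fderiv ℝ (Γ.cube q).map t (Pi.single l 1) i).det /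
          ∏ i, (Γ.cube q).map t i = 0 := by
  cases m with
  | zero => simp
  | succ n =>
    let K : Fin Γ.size → (Fin (n + 1) → ℝ) → (Fin (n + 1) → ℂ) → Fin (n + 1) → ℂ := fun q t =>
      logField fun i ξ => baseGerm ((Γ.cube q).germ t) ξ * L i ξ
    have ha : ∀ q, ∀ t ∈ Icc (0 : Fin (n + 1) → ℝ) 1, ∀ i, AnalyticAt ℂ
        (fun ξ => baseGerm ((Γ.cube q).germ t) ξ * L i ξ) ((Γ.cube q).map t) := fun q t ht i =>
      (analyticAt_baseGerm ((Γ.cube q).mem_confSpace t ht) fun d v =>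
        (Γ.cube q).analyticAt_germ ht d v).mul (hL i _ ((Γ.cube q).mem_confSpace t ht))
    have hKa : ∀ q, ∀ t ∈ Icc (0 : Fin (n + 1) → ℝ) 1, AnalyticAt ℂ (K q t) ((Γ.cube q).map t) :=
      fun q t ht => analyticAt_logField ((Γ.cube q).mem_confSpace t ht).1 (ha q t ht)
    have hKl : ∀ q, ∀ t ∈ Icc (0 : Fin (n + 1) → ℝ) 1, ∀ᶠ s in 𝓝[Icc 0 1] t,
        K q s =ᶠ[𝓝 ((Γ.cube q).map s)] K q t := by
      intro q t ht
      filter_upwards [(Γ.cube q).continued t ht (Finsupp.single oscTwo (n + 1)) (vacFock j)] with s hs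
      filter_upwards [hs] with ξ hξ
      funext i
      simp only [K, logField, baseGerm, hξ]
    -- The field is a multivalued scalar, one matrix element of the branch, times a single-valued
    -- field `κ`. Closedness speaks about the germs of matrix elements, so it applies to the first
    -- factor.
    let κ : (Fin (n + 1) → ℂ) → Fin (n + 1) → ℂ := logField fun i ξ =>
      ((1 / 2) ^ (n + 1) * ∏ i, ξ i)⁻¹ * L i ξ
    have hκ : ContinuousOn κ (confSpace (n + 1)) := fun ξ hξ =>
      (analyticAt_logField hξ.1 fun i =>
        (analyticAt_normalization hξ).mul (hL i ξ hξ)).continuousAt.continuousWithinAt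
    have hKκ : ∀ q t ξ, K q t ξ =
        (Γ.cube q).germ t (Finsupp.single oscTwo (n + 1)) (vacFock j) ξ • κ ξ := by
      intro q t ξ
      funext i
      simp only [K, κ, logField, baseGerm, Pi.smul_apply, smul_eq_mul]
      ring
    have h1 : ∀ q, (∫ t in Icc (0 : Fin (n + 1) → ℝ) 1,
        (∑ i, eulerD i (fun ξ => baseGerm ((Γ.cube q).germ t) ξ * L i ξ) ((Γ.cube q).map t)) *
          (Matrix.of fun i l => fderiv ℝ (Γ.cube q).map t (Pi.single l 1) i).det /
            ∏ i, (Γ.cube q).map t i) =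
        ∫ t in Icc (0 : Fin (n + 1) → ℝ) 1,
          divAlong (Γ.cube q).map (K q) t * detRows (n + 1) (partials (Γ.cube q).map t) := by
      intro q
      refine MeasureTheory.setIntegral_congr_fun measurableSet_Icc fun t ht => ?_
      have e : divAlong (Γ.cube q).map (K q) t = _ :=
        div_logField ((Γ.cube q).mem_confSpace t ht).1 (ha q t ht)
      -- The partial derivatives are columns in the integral over the cube but rows in `detRows`.
      have e2 : (Matrix.of fun i l => fderiv ℝ (Γ.cube q).map t (Pi.single l 1) i).det =
          detRows (n + 1) (partials (Γ.cube q).map t) := by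
        rw [detRows_apply, ← Matrix.det_transpose]
        rfl
      rw [e, e2]
      ring
    have h2 : ∀ q l ε, (∫ t in Icc (0 : Fin n → ℝ) 1,
        fluxAlong (Γ.cube q).map (K q) l (faceIncl l ε t)) = (-1) ^ (l : ℕ) *
        ∫ t in Icc (0 : Fin n → ℝ) 1, Γ.faceGerm (q, l, ε) t (Finsupp.single oscTwo (n + 1))
          (vacFock j) (Γ.faceMap (q, l, ε) t) * detRows (n + 1)
            (Matrix.vecCons (κ (Γ.faceMap (q, l, ε) t)) (partials (Γ.faceMap (q, l, ε)) t)) := by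
      intro q l ε
      rw [← MeasureTheory.integral_const_mul]
      congr 1
      funext t
      rw [fluxAlong_faceIncl (Γ.cube q).smooth, hKκ, detRows_vecCons_smul]
      rfl
    rw [← hΓ.sum_faces hκ (Finsupp.single oscTwo (n + 1)) (vacFock j), Fintype.sum_prod_type]
    refine Finset.sum_congr rfl fun q _ => ?_
    rw [h1, integral_divAlong (Γ.cube q).smooth (hKa q) (hKl q), Fintype.sum_prod_type,
      Finset.mul_sum]
    refine Finset.sum_congr rfl fun l _ => ?_
    rw [Fintype.sum_bool, h2, h2]
    simp only [BranchChain.faceCoef, if_true, Bool.false_eq_true, if_false]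
    ring

/-! ### Matrix elements of homogeneous operators -/

/-- The degree of a monomial in the creation operators. -/
def wt (d : Osc →₀ ℕ) : ℕ := d.sum fun o n => n * o.1.2

lemma finite_osc_le (N : ℕ) : {o : Osc | o.1.2 ≤ N}.Finite := by
  have h : (univ ×ˢ Iic N : Set (Fin 3 × ℕ)).Finite := finite_univ.prod (finite_Iic N)
  refine (h.preimage (f := fun o : Osc => o.1) Subtype.val_injective.injOn).subset ?_
  intro o ho
  exact ⟨trivial, ho⟩

lemma mul_le_wt (d : Osc →₀ ℕ) (o : Osc) : d o * o.1.2 ≤ wt d := by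
  by_cases h : o ∈ d.support
  · exact Finset.single_le_sum (f := fun o : Osc => d o * o.1.2) (fun _ _ => Nat.zero_le _) h
  · rw [Finsupp.notMem_support_iff.mp h, zero_mul]
    exact Nat.zero_le _

/-- Every oscillator has positive degree. A bound on the total degree therefore bounds both the
degrees of the oscillators that occur and their multiplicities. -/
lemma finite_wt_le (N : ℕ) : {d : Osc →₀ ℕ | wt d ≤ N}.Finite := by
  classical
  refine (Finset.finite_toSet ((finite_osc_le N).toFinset.finsupp fun _ => Finset.range (N + 1))).subset
    fun d hd => ?_
  have hd : wt d ≤ N := hd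
  rw [Finset.mem_coe, Finset.mem_finsupp_iff]
  have h0 : ∀ o ∈ d.support, d o ≤ N ∧ o.1.2 ≤ N := by
    intro o ho
    have h1 := (mul_le_wt d o).trans hd
    have h2 : 0 < d o := Nat.pos_of_ne_zero (Finsupp.mem_support_iff.mp ho)
    have h3 := o.2.1
    exact ⟨(Nat.le_mul_of_pos_right _ h3).trans h1, (Nat.le_mul_of_pos_left _ h2).trans h1⟩
  refine ⟨fun o ho => (finite_osc_le N).mem_toFinset.mpr (h0 o ho).2, fun o _ => ?_⟩
  rw [Finset.mem_range, Nat.lt_succ_iff]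
  exact (Nat.le_mul_of_pos_right _ o.2.1).trans ((mul_le_wt d o).trans hd)

lemma finite_wt_eq (c : ℂ) : {d : Osc →₀ ℕ | (wt d : ℂ) = c}.Finite := by
  by_cases h : ∃ N : ℕ, (N : ℂ) = c
  · obtain ⟨N, rfl⟩ := h
    refine (finite_wt_le N).subset fun d hd => ?_
    exact (Nat.cast_injective (R := ℂ) hd).le
  · convert finite_empty
    exact eq_empty_of_forall_notMem fun d hd => h ⟨wt d, hd⟩

lemma degDer_monomial (d : Osc →₀ ℕ) (c : ℂ) :
    degDer (MvPolynomial.monomial d c) = (wt d : ℂ) • MvPolynomial.monomial d c := by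
  rw [degDer, MvPolynomial.mkDerivation_monomial, wt, Finsupp.sum, Finsupp.sum, Nat.cast_sum,
    Finset.sum_smul, Finset.smul_sum]
  refine Finset.sum_congr rfl fun o ho => ?_
  have h : Finsupp.single o 1 ≤ d := by
    rw [Finsupp.single_le_iff]
    exact Nat.one_le_iff_ne_zero.mpr (Finsupp.mem_support_iff.mp ho)
  have hX : (MvPolynomial.X o : MvPolynomial Osc ℂ) = MvPolynomial.monomial (Finsupp.single o 1) 1 := rfl
  rw [hX]
  simp only [smul_eq_mul, MvPolynomial.monomial_mul, MvPolynomial.smul_monomial,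
    tsub_add_cancel_of_le h]
  congr 1
  push_cast
  ring

lemma coeff_degDer (d : Osc →₀ ℕ) (p : MvPolynomial Osc ℂ) :
    (degDer p).coeff d = wt d * p.coeff d := by
  classical
  induction p using MvPolynomial.induction_on' with
  | monomial d' c =>
    rw [degDer_monomial, MvPolynomial.coeff_smul, MvPolynomial.coeff_monomial, smul_eq_mul]
    split_ifs with h
    · rw [h]
    · simp
  | add p q hp hq => rw [map_add, MvPolynomial.coeff_add, hp, hq, MvPolynomial.coeff_add, mul_add]

/-- The eigenvalue of the grading operator on a monomial. -/
def gradeEig (k j : ℂ) (d : Osc →₀ ℕ) : ℂ := wt d + vacGrade k j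

lemma coord_grading (k j : ℂ) (d : Osc →₀ ℕ) (u : FockSum) :
    coord j d (grading k u) = gradeEig k j d * coord j d u := by
  rw [coord_apply, coord_apply, grading_apply, MvPolynomial.coeff_add, coeff_degDer,
    MvPolynomial.coeff_smul, gradeEig, smul_eq_mul, add_mul]

/-- The element of the Fock space `F_{j,k}` given by a polynomial in the creation operators. -/
def ofPoly (j : ℂ) : MvPolynomial Osc ℂ →ₗ[ℂ] fock j :=
  (Finsupp.lsingle j).codRestrict (fock j) fun p => ⟨p, rfl⟩

lemma exists_ofPoly {j : ℂ} (v : fock j) : ∃ p, ofPoly j p = v := by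
  obtain ⟨p, hp⟩ := v.2
  exact ⟨p, Subtype.ext hp⟩

lemma coord_ofPoly (j : ℂ) (d : Osc →₀ ℕ) (p : MvPolynomial Osc ℂ) :
    coord j d (ofPoly j p) = p.coeff d := by
  rw [coord_apply]
  change ((Finsupp.single j p : FockSum) j).coeff d = _
  rw [Finsupp.single_eq_same]

lemma fock_ext {j : ℂ} {u v : FockSum} (hu : u ∈ fock j) (hv : v ∈ fock j)
    (h : ∀ d, coord j d u = coord j d v) : u = v := by
  obtain ⟨p, hp⟩ := exists_ofPoly ⟨u, hu⟩
  obtain ⟨q, hq⟩ := exists_ofPoly ⟨v, hv⟩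
  have hp : (ofPoly j p : FockSum) = u := congrArg Subtype.val hp
  have hq : (ofPoly j q : FockSum) = v := congrArg Subtype.val hq
  rw [← hp, ← hq] at h ⊢
  simp only [coord_ofPoly] at h
  rw [MvPolynomial.ext p q h]

lemma grading_ofPoly_monomial (k j : ℂ) (d : Osc →₀ ℕ) (c : ℂ) :
    grading k (ofPoly j (MvPolynomial.monomial d c)) =
      gradeEig k j d • (ofPoly j (MvPolynomial.monomial d c) : FockSum) := by
  classical
  have hm := (ofPoly j (MvPolynomial.monomial d c)).2
  refine fock_ext ?_ ((fock j).smul_mem _ hm) fun d' => ?_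
  · simpa using grading_mem_shiftOps k j _ hm
  · rw [coord_grading, map_smul, coord_ofPoly, MvPolynomial.coeff_monomial, smul_eq_mul]
    split_ifs with h
    · rw [h]
    · simp

/-- The rows of the matrix of a homogeneous operator are finite. -/
theorem exists_row {k μ : ℂ} {T : Op} (hT : cm (grading k) T = μ • T) (j : ℂ) (d : Osc →₀ ℕ) :
    ∃ (F : Finset (Osc →₀ ℕ)) (t : (Osc →₀ ℕ) → ℂ), ∀ u ∈ fock j,
      coord j d (T u) = ∑ d' ∈ F, t d' * coord j d' u := by
  classical
  let t : (Osc →₀ ℕ) → ℂ := fun d' => coord j d (T (ofPoly j (MvPolynomial.monomial d' 1)))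
  -- Homogeneity forces a nonzero entry to connect degrees that differ by `μ`, and there are
  -- finitely many monomials of a given degree.
  have ht : ∀ d', t d' ≠ 0 → (wt d' : ℂ) = wt d - μ := by
    intro d' h
    have h1 := congrArg (fun A : Op => coord j d (A (ofPoly j (MvPolynomial.monomial d' 1)))) hT
    simp only [cm_apply, map_sub, coord_grading, grading_ofPoly_monomial, map_smul,
      LinearMap.smul_apply, smul_eq_mul, gradeEig] at h1
    have h2 : ((wt d : ℂ) - wt d' - μ) * t d' = 0 := by simp only [t]; linear_combination h1
    rcases mul_eq_zero.mp h2 with h3 | h3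
    · linear_combination -h3
    · exact absurd h3 h
  refine ⟨(finite_wt_eq (wt d - μ)).toFinset, t, fun u hu => ?_⟩
  obtain ⟨p, hp⟩ := exists_ofPoly ⟨u, hu⟩
  have hp : (ofPoly j p : FockSum) = u := congrArg Subtype.val hp
  let ψ : MvPolynomial Osc ℂ →ₗ[ℂ] ℂ := coord j d ∘ₗ T ∘ₗ (fock j).subtype ∘ₗ ofPoly j
  have h1 : coord j d (T u) = ∑ d' ∈ p.support, t d' * p.coeff d' := by
    rw [← hp]
    change ψ p = _
    conv_lhs => rw [p.as_sum]
    rw [map_sum]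
    refine Finset.sum_congr rfl fun d' _ => ?_
    have : MvPolynomial.monomial d' (p.coeff d') = p.coeff d' • MvPolynomial.monomial d' (1 : ℂ) := by
      rw [MvPolynomial.smul_monomial, smul_eq_mul, mul_one]
    rw [this, map_smul, smul_eq_mul, mul_comm]
    rfl
  rw [h1, ← hp]
  simp only [coord_ofPoly]
  have hsub : ∑ d' ∈ p.support, t d' * p.coeff d' =
      ∑ d' ∈ p.support ∪ (finite_wt_eq (wt d - μ)).toFinset, t d' * p.coeff d' := by
    refine Finset.sum_subset Finset.subset_union_left fun d' _ h => ?_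
    rw [MvPolynomial.notMem_support_iff.mp h, mul_zero]
  rw [hsub]
  symm
  refine Finset.sum_subset Finset.subset_union_right fun d' _ h => ?_
  have : t d' = 0 := by
    by_contra hne
    exact h ((finite_wt_eq _).mem_toFinset.mpr (ht d' hne))
  rw [this, zero_mul]

/-! ### Screening charges -/

section

variable {k : ℂ} (hk0 : k ≠ 0) (hk2 : k ≠ -2) {j : ℂ} {m : ℕ}

lemma BranchCube.integrableOn (σ : BranchCube k j m) (d : Osc →₀ ℕ) (v : fock j) :
    MeasureTheory.IntegrableOn (fun t => σ.germ t d v (σ.map t) *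
      (Matrix.of fun i l => fderiv ℝ σ.map t (Pi.single l 1) i).det / ∏ i, σ.map t i)
      (Icc (0 : Fin m → ℝ) 1) := by
  refine ContinuousOn.integrableOn_compact isCompact_Icc (ContinuousOn.div ?_ ?_ ?_)
  · refine (σ.continuousOn_germ d v).mul (Continuous.continuousOn ?_)
    refine Continuous.matrix_det (continuous_matrix fun i l => ?_)
    exact (continuous_apply i).comp
      ((σ.smooth.continuous_fderiv (by simp)).clm_apply continuous_const)
  · exact (continuous_finsetProd _ fun i _ =>
      (continuous_apply i).comp σ.smooth.continuous).continuousOn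
  · intro t ht
    exact Finset.prod_ne_zero_iff.mpr fun i _ => (σ.mem_confSpace t ht).1 i

include hk0 hk2

lemma BranchCube.integral_linear (σ : BranchCube k j m) (d : Osc →₀ ℕ) (x : ℂ) (v w : fock j) :
    σ.integral d (x • v + w) = x * σ.integral d v + σ.integral d w := by
  simp only [BranchCube.integral]
  rw [← MeasureTheory.integral_const_mul,
    ← MeasureTheory.integral_add ((σ.integrableOn d v).const_mul x) (σ.integrableOn d w)]
  refine MeasureTheory.setIntegral_congr_fun measurableSet_Icc fun t ht => ?_
  have := (germ_linear hk0 hk2 (σ.isBranch t ht) d x v w).eq_of_nhds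
  simp only [this]
  ring

lemma BranchChain.integral_linear (Γ : BranchChain k j m) (d : Osc →₀ ℕ) (x : ℂ) (v w : fock j) :
    Γ.integral d (x • v + w) = x * Γ.integral d v + Γ.integral d w := by
  simp only [BranchChain.integral, BranchCube.integral_linear hk0 hk2]
  rw [Finset.mul_sum, ← Finset.sum_add_distrib]
  exact Finset.sum_congr rfl fun q _ => by ring

/-- The matrix elements of the integral over a chain, as linear functionals. -/
def BranchChain.integralₗ (Γ : BranchChain k j m) (d : Osc →₀ ℕ) : fock j →ₗ[ℂ] ℂ where
  toFun := Γ.integral d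
  map_add' v w := by
    have := Γ.integral_linear hk0 hk2 d 1 v w
    rwa [one_smul, one_mul] at this
  map_smul' x v := by
    have h0 := Γ.integral_linear hk0 hk2 d 1 0 0
    rw [smul_zero, add_zero, one_mul, left_eq_add] at h0
    have := Γ.integral_linear hk0 hk2 d x v 0
    rw [add_zero, h0, add_zero] at this
    exact this

/-- The integral over a closed chain intertwines every operator whose commutator with the product of
the screening currents is exact. -/
theorem BranchChain.IsClosed.integral_row {Γ : BranchChain k j m} (hΓ : Γ.IsClosed) {T : Op}
    (hT : IsExact k j m T) {d : Osc →₀ ℕ} {v w : fock j} (hw : (w : FockSum) = T v)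
    {F : Finset (Osc →₀ ℕ)} {t : (Osc →₀ ℕ) → ℂ} (ht : ∀ u ∈ fock (j - 2 * m),
      coord (j - 2 * m) d (T u) = ∑ d' ∈ F, t d' * coord (j - 2 * m) d' u) :
    Γ.integral d w = ∑ d' ∈ F, t d' * Γ.integral d' v := by
  -- On each cube the integrand of the difference of the two sides is a total derivative; its
  -- integral over the closed chain is zero.
  obtain ⟨L, hL, h⟩ := exists_sum_eulerD hk0 hk2 hT hw ht
  have h1 := hΓ.sum_integral_eulerD hL
  have h2 : ∀ q, (∫ s in Icc (0 : Fin m → ℝ) 1,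
      (∑ i, eulerD i (fun ξ => baseGerm ((Γ.cube q).germ s) ξ * L i ξ) ((Γ.cube q).map s)) *
        (Matrix.of fun i l => fderiv ℝ (Γ.cube q).map s (Pi.single l 1) i).det /
          ∏ i, (Γ.cube q).map s i) =
      ∑ d' ∈ F, t d' * (Γ.cube q).integral d' v - (Γ.cube q).integral d w := by
    intro q
    simp only [BranchCube.integral, ← MeasureTheory.integral_const_mul]
    rw [← MeasureTheory.integral_finsetSum _ fun d' _ =>
      ((Γ.cube q).integrableOn d' v).const_mul (t d'),
      ← MeasureTheory.integral_sub (MeasureTheory.integrable_finsetSum _ fun d' _ =>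
        ((Γ.cube q).integrableOn d' v).const_mul (t d')) ((Γ.cube q).integrableOn d w)]
    refine MeasureTheory.setIntegral_congr_fun measurableSet_Icc fun s hs => ?_
    have := (h _ _ ((Γ.cube q).isBranch s hs)).eq_of_nhds
    beta_reduce at this ⊢
    rw [this, sub_mul, sub_div, Finset.sum_mul, Finset.sum_div]
    congr 1
    exact Finset.sum_congr rfl fun d' _ => by ring
  simp only [h2, mul_sub, Finset.sum_sub_distrib, Finset.mul_sum] at h1
  rw [Finset.sum_comm] at h1
  have h3 := (sub_eq_zero.mp h1).symm
  rw [BranchChain.integral, h3]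
  refine Finset.sum_congr rfl fun d' _ => ?_
  rw [BranchChain.integral, Finset.mul_sum]
  exact Finset.sum_congr rfl fun q _ => by ring

/-- Exactness of the commutator with `d` means that the integral conserves the grading. A nonzero
coordinate must have the same eigenvalue as the given monomial, which fixes its degree. -/
lemma BranchChain.IsClosed.finite_monomial {Γ : BranchChain k j m} (hΓ : Γ.IsClosed)
    (d₀ : Osc →₀ ℕ) :
    {d | Γ.integral d (ofPoly j (MvPolynomial.monomial d₀ 1)) ≠ 0}.Finite := by
  refine (finite_wt_eq (gradeEig k j d₀ - vacGrade k (j - 2 * m))).subset fun d hd => ?_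
  have h := hΓ.integral_row hk0 hk2 (isExact_grading hk0 hk2 j m) (d := d)
    (v := ofPoly j (MvPolynomial.monomial d₀ 1))
    (w := gradeEig k j d₀ • ofPoly j (MvPolynomial.monomial d₀ 1))
    (by rw [grading_ofPoly_monomial]; rfl) (F := {d}) (t := fun d => gradeEig k (j - 2 * m) d)
    (fun u _ => by rw [Finset.sum_singleton, coord_grading])
  have h1 : Γ.integral d (gradeEig k j d₀ • ofPoly j (MvPolynomial.monomial d₀ 1)) =
      gradeEig k j d₀ * Γ.integral d (ofPoly j (MvPolynomial.monomial d₀ 1)) :=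
    (Γ.integralₗ hk0 hk2 d).map_smul _ _
  rw [h1, Finset.sum_singleton] at h
  have h2 := mul_right_cancel₀ hd h
  change (wt d : ℂ) = _
  rw [h2, gradeEig]
  ring

lemma BranchChain.IsClosed.finite_support {Γ : BranchChain k j m} (hΓ : Γ.IsClosed) (v : fock j) :
    {d | Γ.integral d v ≠ 0}.Finite := by
  obtain ⟨p, rfl⟩ := exists_ofPoly v
  refine ((Finset.finite_toSet p.support).biUnion fun d₀ _ =>
    hΓ.finite_monomial hk0 hk2 d₀).subset fun d hd => ?_
  by_contra hc
  simp only [mem_iUnion, not_exists] at hc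
  refine hd ?_
  change (Γ.integralₗ hk0 hk2 d ∘ₗ ofPoly j) p = 0
  rw [p.as_sum, map_sum]
  refine Finset.sum_eq_zero fun d₀ h₀ => ?_
  have : MvPolynomial.monomial d₀ (p.coeff d₀) = p.coeff d₀ • MvPolynomial.monomial d₀ (1 : ℂ) := by
    rw [MvPolynomial.smul_monomial, smul_eq_mul, mul_one]
  rw [this, map_smul]
  have h2 : (Γ.integralₗ hk0 hk2 d ∘ₗ ofPoly j) (MvPolynomial.monomial d₀ 1) = 0 :=
    not_not.mp (hc d₀ h₀)
  rw [h2, smul_zero]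

/-- Each vector has finitely many nonzero integrated coordinates, so they are the coefficients of a
polynomial. Its linear dependence on the vector is checked coordinatewise. -/
theorem exists_screeningCharge {Γ : BranchChain k j m} (hΓ : Γ.IsClosed) :
    ∃ Q : fock j →ₗ[ℂ] FockSum, IsScreeningCharge Γ Q := by
  classical
  let P : fock j → MvPolynomial Osc ℂ := fun v =>
    ∑ d ∈ (hΓ.finite_support hk0 hk2 v).toFinset, MvPolynomial.monomial d (Γ.integral d v)
  have hP : ∀ d v, (P v).coeff d = Γ.integral d v := by
    intro d v
    simp only [P, MvPolynomial.coeff_sum, MvPolynomial.coeff_monomial, Finset.sum_ite_eq',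
      Finite.mem_toFinset, mem_ofPred_eq]
    split_ifs with h
    · rfl
    · exact (not_not.mp h).symm
  let P' : fock j →ₗ[ℂ] MvPolynomial Osc ℂ :=
    { toFun := P
      map_add' := fun v w => MvPolynomial.ext _ _ fun d => by
        rw [MvPolynomial.coeff_add, hP, hP, hP]
        exact (Γ.integralₗ hk0 hk2 d).map_add v w
      map_smul' := fun c v => MvPolynomial.ext _ _ fun d => by
        rw [RingHom.id_apply, MvPolynomial.coeff_smul, hP, hP]
        exact (Γ.integralₗ hk0 hk2 d).map_smul c v }
  refine ⟨(fock (j - 2 * m)).subtype ∘ₗ ofPoly (j - 2 * m) ∘ₗ P', fun v => (ofPoly _ (P v)).2,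
    fun d v => ?_⟩
  exact (coord_ofPoly _ d (P v)).trans (hP d v)

/-- Coordinates are compared. Homogeneity makes the row of `T` finite, so `integral_row` expresses
the integral for `T v` through the coordinates of `Q v` exactly as `T` does. -/
theorem IsScreeningCharge.commutesOn {Γ : BranchChain k j m} (hΓ : Γ.IsClosed)
    {Q : fock j →ₗ[ℂ] FockSum} (hQ : IsScreeningCharge Γ Q) {T : Op} {μ : ℂ}
    (hT : cm (grading k) T = μ • T) (hs : T ∈ shiftOps 0) (he : IsExact k j m T) :
    CommutesOn Q T := by
  have hmem : ∀ {j' : ℂ} {u : FockSum}, u ∈ fock j' → T u ∈ fock j' := fun hu => by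
    simpa using hs _ _ hu
  intro v
  refine ⟨⟨T v, hmem v.2⟩, rfl, fock_ext (hQ.1 _) (hmem (hQ.1 v)) fun d => ?_⟩
  obtain ⟨F, t, ht⟩ := exists_row hT (j - 2 * m) d
  rw [hQ.2, ht _ (hQ.1 v), hΓ.integral_row hk0 hk2 he rfl ht]
  simp only [hQ.2]

end

/-! ### Homogeneity of the currents -/

lemma cm_grading_betaField (k : ℂ) (n : ℤ) : cm (grading k) (coeffMode (betaField k) n) =
    (-(n : ℂ)) • coeffMode (betaField k) n := by
  rw [coeffMode, betaField, ofModes_neg, cm_smul, cm_grading_mode, smul_comm]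

lemma betaField_mem (k : ℂ) (n : ℤ) : coeffMode (betaField k) n ∈ shiftOps 0 := by
  rw [coeffMode, betaField, ofModes_neg]
  exact (shiftOps 0).smul_mem _ (mode_mem_shiftOps k 0 n)

lemma cm_grading_xField {k : ℂ} (hk2 : k ≠ -2) (n : ℤ) : cm (grading k) (coeffMode (xField k) n) =
    (-(n : ℂ)) • coeffMode (xField k) n := by
  rw [coeffMode, xField, cm_smul, cm_add, cm_grading_vertexInsert hk2, cm_grading_vertexInsert hk2,
    ← smul_add, smul_comm]
  congr 1
  simp

lemma xField_mem (k : ℂ) (n : ℤ) : coeffMode (xField k) n ∈ shiftOps 0 := by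
  have := xOp_mem k (-n)
  rwa [xOp, Int.cast_neg] at this

end ZAlg

end

/-! ### The commutation relations and the screening charges -/

theorem mainTheorem3 (k : ℂ) (hk0 : k ≠ 0) (hk2 : k ≠ -2) :
    -- `S(ζ)` maps `F_{j,k}` to `F_{j-2,k}`
    (∀ j a : ℂ, ∀ v ∈ fock j, screening k a v ∈ fock (j - 2)) ∧
    -- `[β(ζ), S(ξ)] = 0`
    bracket (betaField k) (screening k) = 0 ∧
    -- `[x(ζ), S(ξ)]` is the stated total derivative
    bracket (xField k) (screening k) =
      ((k + 2) / 2) • derivXi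
        (-deltaMul 1 (potential k 1) + deltaMul (-1) (potential k (-1))) ∧
    -- `S(ξ_1) ⋯ S(ξ_m)` converges for `|ξ_1| > ⋯ > |ξ_m| > 0`
    (∀ (j : ℂ) (m : ℕ) (d : Osc →₀ ℕ) (v : fock j), ∀ ξ ∈ radialRegion m,
      Summable (corrTerm k j d v ξ)) ∧
    -- the charge of a closed contour is well defined and commutes with the action
    ∀ (j : ℂ) (m : ℕ) (Γ : BranchChain k j m), Γ.IsClosed →
      ∃ Q : fock j →ₗ[ℂ] FockSum, IsScreeningCharge Γ Q ∧
        (∀ n : ℤ, CommutesOn Q (coeffMode (betaField k) n)) ∧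
        (∀ n : ℤ, CommutesOn Q (coeffMode (xField k) n)) ∧
        CommutesOn Q (grading k) := by
  refine ⟨fun j a v hv => ?_, bracket_betaField_screening hk0 hk2, bracket_xField_screening hk0 hk2,
    fun j m d v ξ hξ => ?_, fun j m Γ hΓ => ?_⟩
  · rw [sub_eq_add_neg]
    exact screening_mem hk2 a j v hv
  · obtain ⟨R, hR⟩ := exists_represents hk0 hk2 (m := m) d v
    exact (hR.2 ξ hξ).summable
  · obtain ⟨Q, hQ⟩ := exists_screeningCharge hk0 hk2 hΓ
    refine ⟨Q, hQ, fun n => ?_, fun n => ?_, ?_⟩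
    · exact hQ.commutesOn hk0 hk2 hΓ (cm_grading_betaField k n) (betaField_mem k n)
        (isExact_betaField hk0 hk2 j m n)
    · exact hQ.commutesOn hk0 hk2 hΓ (cm_grading_xField hk2 n) (xField_mem k n)
        (isExact_xField hk0 hk2 j m n)
    · exact hQ.commutesOn hk0 hk2 hΓ (μ := 0) (by rw [zero_smul]; exact sub_self _)
        (grading_mem_shiftOps k) (isExact_grading hk0 hk2 j m)
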